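/- \textbf{Setting.} Let $G$ be a countable discrete group and $\mu$ a probability measure on $G$ whose support generates $G$ as a semigroup and whose Shannon entropy $H(\mu)=-\sum_g\mu(g)\log\mu(g)$ is finite. Let $\mathbb P_\mu$ be the law on $G^{\mathbb N}$ of the random walk $\omega=(\omega_n)_{n\ge 0}$, $\omega_0=e$, $\omega_n=s_1\cdots s_n$ with $(s_i)$ i.i.d. of law $\mu$. All $G$-spaces below are standard Borel probability spaces with a measurable $G$-action. A probability measure $\eta$ is stationary if $\mu*\eta=\eta$; then $\eta_\omega:=\lim_n\omega_n\eta$ exists $\mathbb P_\mu$-a.s. (i.e. for each measurable $A$, $(\omega_n\eta)(A)\to\eta_\omega(A)$ a.s.), and one puts $\eta\curlyvee\mathbb P_\mu=\int\eta_\omega\times\delta_\omega\,d\mathbb P_\mu(\omega)$ on $X\times G^{\mathbb N}$. The Furstenberg entropy is $h_\mu(X,\eta)=\int_G D(g\eta\,\|\,\eta)\,d\mu(g)$, where $D$ is the Kullback--Leibler divergence. Let $(X,\eta)$ be a standard system over $(Y,\nu)$: $\eta$ is stationary; $(Y,\nu)$ is a $\mu$-boundary, i.e. $\nu$ is stationary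 and $\nu_\omega$ is a.s. a point mass; $\pi:X\to Y$ is a measurable $G$-equivariant map with $\pi_*\eta=\nu$; and the disintegration $\eta=\int_Y\eta^y\,d\nu(y)$ over $\pi$ satisfies $g\eta^y=\eta^{gy}$ for all $g\in G$ and $\nu$-a.e. $y$. Let $x\mapsto L_x$ be a measurable map from $X$ to the space of subgroups of $G$ with $L_{gx}=gL_xg^{-1}$, satisfying assumption (S): $L_x\subseteq \mathrm{Stab}_G(\pi(x))$ for every $x\in X$. Let $W_\Omega=\bigsqcup_{x\in X}\{x\}\times(L_x\backslash G)^{\mathbb N}$, with $G$-action $g(x,(L_x\omega_n)_n)=(gx,(L_{gx}g\omega_n)_n)$, and let $\overline{\mathbb P}_\mu$ be the image of $\eta\curlyvee\mathbb P_\mu$ under $(x,\omega)\mapsto(x,(L_x\omega_n)_n)$. The Poisson bundle $(Z,\lambda)$ over $(X,\eta)$ is a point realisation, as a measured $G$-space, of the completion of the $\sigma$-field of sets invariant under the time shift $(x,(c_n)_n)\mapsto(x,(c_{n+1})_n)$ of $W_\Omega$, equipped with $\overline{\mathbb P}_\mu$. For $n\ge0$ let $\xi_n^x$ be the random coset $L_x\omega_n$,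 where $\omega$ is distributed according to the conditional law over $x$ in the disintegration of $\eta\curlyvee\mathbb P_\mu$ over $X$; let $H(\xi_n^x)$ be its Shannon entropy and $H(\xi_n|X,\eta)=\int_X H(\xi_n^x)\,d\eta(x)$. \textbf{Theorem (Random walk entropy formula).} The quantities $h_\mu(Z,\lambda)$, $h_\mu(Y,\nu)$ and $H(\xi_n|X,\eta)$, $n\ge 0$, are all finite, and \begin{align*} h_\mu(Z,\lambda)&=h_\mu(Y,\nu)+\lim_{n\to\infty}\int_X\bigl(H(\xi_n^x)-H(\xi_{n-1}^x)\bigr)\,d\eta(x)\\ &=h_\mu(Y,\nu)+\lim_{n\to\infty}\frac1n H(\xi_n|X,\eta). \end{align*} In both lines $\lim_{n\to\infty}$ can be replaced by $\inf_{n\ge1}$. -/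

import Mathlib

open MeasureTheory ProbabilityTheory Filter Topology
open scoped ENNReal Pointwise

namespace PoissonBundle

section Walk

variable {G : Type*} [Group G]

/-- The random walk trajectory `ω₀ = 1`, `ωₙ = s₀ s₁ ⋯ sₙ₋₁` with increments `s`. -/
def walk (s : ℕ → G) : ℕ → G
  | 0 => 1
  | n + 1 => walk s n * s n

/-- The law `ℙ_μ`, on trajectories `(ωₙ)_{n ≥ 0}`, of the `μ`-random walk started at the identity:
the increments are independent with common law `μ`. -/
noncomputable def walkLaw [MeasurableSpace G] (μ : Measure G) : Measure (ℕ → G) :=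
  (Measure.infinitePi fun _ : ℕ => μ).map walk

theorem measurable_walk [Countable G] [MeasurableSpace G] [DiscreteMeasurableSpace G] :
    Measurable (walk : (ℕ → G) → ℕ → G) := by
  refine measurable_pi_lambda _ fun n => ?_
  induction n with
  | zero => exact measurable_const
  | succ n ih =>
    have h : Measurable fun s : ℕ → G => (walk s n, s n) := ih.prodMk (measurable_pi_apply n)
    exact (Measurable.of_discrete (f := fun p : G × G => p.1 * p.2)).comp h

instance [Countable G] [MeasurableSpace G] [DiscreteMeasurableSpace G] (μ : Measure G)
    [IsProbabilityMeasure μ] : IsProbabilityMeasure (walkLaw μ) :=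
  Measure.isProbabilityMeasure_map measurable_walk.aemeasurable

/-- `μ` is nondegenerate: its support generates `G` as a semigroup. -/
def Nondegenerate [MeasurableSpace G] (μ : Measure G) : Prop :=
  Subsemigroup.closure {g : G | μ {g} ≠ 0} = ⊤

end Walk

section Entropy

/-- Shannon entropy `-∑ m(a) log m(a)` of a probability measure carried by a countable set. -/
noncomputable def shannonEntropy {α : Type*} [MeasurableSpace α] (m : Measure α) : ℝ≥0∞ :=
  ∑' a, ENNReal.ofReal (Real.negMulLog (m.real {a}))

variable {G : Type*} [Group G] [MeasurableSpace G]
variable {X : Type*} [MeasurableSpace X] [MulAction G X]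

/-- Furstenberg entropy `h_μ(X, η) = ∫_G D(gη ‖ η) dμ(g)`, where `D` is the Kullback-Leibler
divergence. -/
noncomputable def furstenbergEntropy (μ : Measure G) (η : Measure X) : ℝ≥0∞ :=
  ∫⁻ g, InformationTheory.klDiv (η.map (g • ·)) η ∂μ

/-- `μ * η = η`. -/
def IsStationary (μ : Measure G) (η : Measure X) : Prop :=
  μ.bind (fun g => η.map (g • ·)) = η

end Entropy

section Standard

variable {G : Type*} [Group G] [MeasurableSpace G]
variable {X : Type*} [MeasurableSpace X] [MulAction G X]
variable {Y : Type*} [MeasurableSpace Y] [MulAction G Y]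

/-- `κ ω` is the almost sure limit of the measures `ωₙ η`: for every measurable set `A`, almost
surely `(ωₙ η)(A) → (κ ω)(A)`. -/
def IsLimitKernel (μ : Measure G) (η : Measure X) (κ : Kernel (ℕ → G) X) : Prop :=
  ∀ A : Set X, MeasurableSet A →
    ∀ᵐ ω ∂walkLaw μ, Tendsto (fun n => (η.map (ω n • ·)) A) atTop (𝓝 (κ ω A))

open Classical in
/-- The random measure `ω ↦ η_ω = lim ωₙ η`. For stationary `η` on a standard Borel space the limit
exists, by martingale convergence, and is almost surely unique (the constant `η` is only a default
value). -/
noncomputable def limitKernel (μ : Measure G) (η : Measure X) : Kernel (ℕ → G) X :=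
  if h : ∃ κ : Kernel (ℕ → G) X, IsMarkovKernel κ ∧ IsLimitKernel μ η κ then h.choose
  else Kernel.const _ η

instance (μ : Measure G) (η : Measure X) [IsProbabilityMeasure η] :
    IsMarkovKernel (limitKernel μ η) := by
  unfold limitKernel
  split_ifs with h
  · exact h.choose_spec.1
  · infer_instance

/-- `(Y, ν)` is a `μ`-boundary (a `μ`-proximal system): it is stationary and the limit measures
`ν_ω` are almost surely point masses. -/
structure IsBoundary (μ : Measure G) (ν : Measure Y) : Prop where
  stationary : IsStationary μ ν
  dirac : ∀ᵐ ω ∂walkLaw μ, ∃ y : Y, limitKernel μ ν ω = Measure.dirac y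

/-- `(X, η)` is a standard system with structure map `π : (X, η) → (Y, ν)`: `η` is stationary,
`π` is a `G`-factor map onto a `μ`-boundary, and `π` is a measure preserving extension, i.e. the
disintegration `y ↦ η^y` of `η` over `π` is `G`-equivariant. -/
structure IsStandardSystem [StandardBorelSpace X] [Nonempty X]
    (μ : Measure G) (η : Measure X) [IsFiniteMeasure η] (ν : Measure Y) (π : X → Y) : Prop where
  stationary : IsStationary μ η
  boundary : IsBoundary μ ν
  measurePreserving : MeasurePreserving π η ν
  equivariant : ∀ (g : G) (x : X), π (g • x) = g • π x
  disintegration : ∀ g : G, ∀ᵐ y ∂ν,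
    (condDistrib id π η y).map (g • ·) = condDistrib id π η (g • y)

/-- The measure `η ⋎ ℙ_μ = ∫ η_ω × δ_ω dℙ_μ(ω)` on `X × G^ℕ`. -/
noncomputable def joining (μ : Measure G) (η : Measure X) : Measure (X × (ℕ → G)) :=
  ((walkLaw μ).compProd (limitKernel μ η)).map Prod.swap

instance [Countable G] [DiscreteMeasurableSpace G] (μ : Measure G) (η : Measure X)
    [IsProbabilityMeasure μ] [IsProbabilityMeasure η] : IsProbabilityMeasure (joining μ η) :=
  Measure.isProbabilityMeasure_map measurable_swap.aemeasurable

end Standard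

section Bundle

/-- A measurable `G`-equivariant map `x ↦ L_x` from `X` to the subgroups of the discrete group `G`:
`L_{gx} = g L_x g⁻¹`. For a countable discrete group, the Borel structure of the Chabauty topology
is generated by the sets `{H | g ∈ H}`. -/
structure SubgroupMap (G X : Type*) [Group G] [MulAction G X] [MeasurableSpace X] where
  toFun : X → Subgroup G
  measurable : ∀ g : G, MeasurableSet {x | g ∈ toFun x}
  equivariant : ∀ (g : G) (x : X) (h : G), h ∈ toFun (g • x) ↔ g⁻¹ * h * g ∈ toFun x

variable {G : Type*} [Group G]
variable {X : Type*} [MeasurableSpace X] [MulAction G X]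

/-- The coset `H g`, as a subset of `G`. -/
def rightCoset (H : Subgroup G) (g : G) : Set G := {h | h * g⁻¹ ∈ H}

/-- The space `W_Ω = ⨆_x {x} × (L_x \ G)^ℕ` of trajectories in coset spaces, with the Borel
structure induced from `X × (Set G)^ℕ`. -/
def CosetPath (L : SubgroupMap G X) : Type _ :=
  {p : X × (ℕ → Set G) // ∃ ω : ℕ → G, ∀ n, p.2 n = rightCoset (L.toFun p.1) (ω n)}

instance (L : SubgroupMap G X) : MeasurableSpace (CosetPath L) :=
  inferInstanceAs (MeasurableSpace
    {p : X × (ℕ → Set G) // ∃ ω : ℕ → G, ∀ n, p.2 n = rightCoset (L.toFun p.1) (ω n)})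

theorem smul_rightCoset (L : SubgroupMap G X) (g : G) (x : X) (a : G) :
    g • rightCoset (L.toFun x) a = rightCoset (L.toFun (g • x)) (g * a) := by
  ext h
  simp only [Set.mem_smul_set_iff_inv_smul_mem, rightCoset, Set.mem_ofPred_eq, L.equivariant,
    smul_eq_mul]
  group

/-- The action `g (x, (L_x ωₙ)ₙ) = (g x, (L_{gx} g ωₙ)ₙ)`; as subsets of `G`,
`L_{gx} g ωₙ = g L_x ωₙ`. -/
def CosetPath.act (L : SubgroupMap G X) (g : G) (w : CosetPath L) : CosetPath L :=
  ⟨(g • w.1.1, fun n => g • w.1.2 n), by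
    obtain ⟨ω, hω⟩ := w.2
    exact ⟨fun n => g * ω n, fun n => by
      simp only [hω n]
      exact smul_rightCoset L g w.1.1 (ω n)⟩⟩

/-- The time shift `(x, (c₀, c₁, …)) ↦ (x, (c₁, c₂, …))`. -/
def CosetPath.shift (L : SubgroupMap G X) (w : CosetPath L) : CosetPath L :=
  ⟨(w.1.1, fun n => w.1.2 (n + 1)), by
    obtain ⟨ω, hω⟩ := w.2
    exact ⟨fun n => ω (n + 1), fun n => hω (n + 1)⟩⟩

/-- The map `ϑ (x, ω) = (x, (L_x ωₙ)ₙ)`. -/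
def toCosetPath (L : SubgroupMap G X) (p : X × (ℕ → G)) : CosetPath L :=
  ⟨(p.1, fun n => rightCoset (L.toFun p.1) (p.2 n)), p.2, fun _ => rfl⟩

theorem measurable_rightCoset [Countable G] [MeasurableSpace G] [DiscreteMeasurableSpace G]
    (L : SubgroupMap G X) (n : ℕ) :
    Measurable fun p : X × (ℕ → G) => rightCoset (L.toFun p.1) (p.2 n) := by
  refine measurable_set_iff.2 fun h => ?_
  refine measurable_to_prop ?_
  have : ((fun p : X × (ℕ → G) => h ∈ rightCoset (L.toFun p.1) (p.2 n)) ⁻¹' {True})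
      = ⋃ g : G, {x | h * g⁻¹ ∈ L.toFun x} ×ˢ {ω | ω n = g} := by
    ext p
    simp [rightCoset]
  rw [this]
  exact MeasurableSet.iUnion fun g =>
    (L.measurable _).prod ((measurableSet_singleton g).preimage (measurable_pi_apply n))

theorem measurable_toCosetPath [Countable G] [MeasurableSpace G] [DiscreteMeasurableSpace G]
    (L : SubgroupMap G X) : Measurable (toCosetPath L) :=
  Measurable.subtype_mk
    (measurable_fst.prodMk (measurable_pi_lambda _ fun n => measurable_rightCoset L n))

variable [MeasurableSpace G]

/-- The measure `ϑ_*(η ⋎ ℙ_μ)` on the space of coset trajectories. -/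
noncomputable def cosetPathLaw (μ : Measure G) (η : Measure X) (L : SubgroupMap G X) :
    Measure (CosetPath L) :=
  (joining μ η).map (toCosetPath L)

/-- The `σ`-field of shift invariant measurable sets of coset trajectories. -/
abbrev invariantField (L : SubgroupMap G X) : MeasurableSpace (CosetPath L) :=
  MeasurableSpace.invariants (CosetPath.shift L)

/-- `(Z, lam)` is a Poisson bundle over `(X, η)`, i.e. a point realisation, as a `G`-space, of the
completion of the invariant `σ`-field with the coset trajectory law: there is a map `θ` on coset
trajectories, measurable with respect to the completed invariant `σ`-field, with image measure
`lam`, almost everywhere `G`-equivariant, such that every invariant set agrees modulo null sets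
with the preimage under `θ` of a measurable set. -/
def IsPoissonBundle (μ : Measure G) (η : Measure X) (L : SubgroupMap G X)
    {Z : Type*} [MeasurableSpace Z] [MulAction G Z] (lam : Measure Z) : Prop :=
  ∃ θ : CosetPath L → Z,
    AEMeasurable[invariantField L] θ
      ((cosetPathLaw μ η L).trim (MeasurableSpace.invariants_le (CosetPath.shift L))) ∧
    (cosetPathLaw μ η L).map θ = lam ∧
    (∀ g : G, ∀ᵐ w ∂cosetPathLaw μ η L, θ (CosetPath.act L g w) = g • θ w) ∧
    ∀ A : Set (CosetPath L), MeasurableSet[invariantField L] A →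
      ∃ B : Set Z, MeasurableSet B ∧ A =ᵐ[cosetPathLaw μ η L] θ ⁻¹' B

variable [Countable G] [DiscreteMeasurableSpace G]

/-- The law of `ξₙˣ`, the position `L_x ωₙ` at time `n` in the fiber over `x`: the image under
`ω ↦ L_x ωₙ` of the conditional law over `x` given by the disintegration of `η ⋎ ℙ_μ` over `X`. -/
noncomputable def fiberLaw (μ : Measure G) [IsProbabilityMeasure μ] (η : Measure X)
    [IsProbabilityMeasure η] (L : SubgroupMap G X) (n : ℕ) (x : X) : Measure (Set G) :=
  (condDistrib Prod.snd Prod.fst (joining μ η) x).map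
    fun ω : ℕ → G => rightCoset (L.toFun x) (ω n)

/-- `H(ξₙˣ)`. -/
noncomputable def fiberEntropy (μ : Measure G) [IsProbabilityMeasure μ] (η : Measure X)
    [IsProbabilityMeasure η] (L : SubgroupMap G X) (n : ℕ) (x : X) : ℝ≥0∞ :=
  shannonEntropy (fiberLaw μ η L n x)

/-- `H(ξₙ | X, η) = ∫ H(ξₙˣ) dη(x)`. -/
noncomputable def condEntropy (μ : Measure G) [IsProbabilityMeasure μ] (η : Measure X)
    [IsProbabilityMeasure η] (L : SubgroupMap G X) (n : ℕ) : ℝ≥0∞ :=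
  ∫⁻ x, fiberEntropy μ η L n x ∂η

end Bundle

end PoissonBundle

open PoissonBundle

open MeasureTheory ProbabilityTheory Filter Topology
open scoped ENNReal Pointwise

/-! Everything reduces to one quantity, the conditional entropy of the first step `ω 1` of the walk.
Write `H(μ)` for the Shannon entropy of `μ`. For a stationary space with a compatible family of path
laws, the density of `μ(g) gη` with respect to `η` is the conditional probability of `ω 1 = g`, so
Furstenberg entropy plus the conditional entropy of the first step equals `H(μ)`. Applied to `Y`
this gives `h(Y) + B = H(μ)`, with `B` the entropy of the first step given the point
(`baseEntropy`). Applied to `Z` it gives `h(Z) + K = H(μ)`, with `K` the entropy of the first step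
given the shift-invariant sets. Hence `h(Z) - h(Y) = B - K`, and finiteness of `H(μ)` makes all
these terms finite.

Uniqueness of step invariant measures with a given projection shows that, for a measure preserving
extension, the trajectory depends on `x` only through `π x`. With `L_x` contained in the stabilizer
of `π x`, the coset trajectories then form a Markov chain over each point. Expanding the joint
entropy of the first step and of the coset at time `n + 1` in both orders
(`stepEntropy_add_timeEntropy`) gives `H(ξ_{n+1}) - H(ξ_n) = B - A_n`, where `A_n` is the entropy of
the first step given the point and the coset at time `n + 1`. By the Markov property, `A_n` is also
the entropy given all later cosets, so it increases with `n`; it is at most `K` because the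
invariant sets are seen from any time on. It remains to prove that `A_n` tends to `K`.

The limit of `A_n` naturally involves the tail field rather than the invariant field. The two are
not compared directly: deterministic times are replaced by uniform random ones. The posterior
densities of the first step given the coset at a uniform time satisfy a von Neumann type estimate
(`le_integral_orbitSum_mul`) that forces convergence in mean square to the density on the invariant
field (`tendsto_mean_sq`). So `K` is at most any bound for the first step entropies at uniform
times. Conversely, concavity of entropy and the iterated chain rule bound these by `sup A_n`
(`stepEntropy_meanLaw_le`). The averaged formula and the infima follow by Cesàro summation of
increments that converge to their lower bound. -/

namespace PoissonBundle

set_option linter.unusedSectionVars false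

/-! ### Almost sure setwise limits of random measures. -/

section LimitOfKernels

variable {Ω : Type*} [MeasurableSpace Ω] {X : Type*} [MeasurableSpace X]

/-- If the expectations of a decreasing sequence of nonnegative functions tend to `0`, the functions
tend to `0` almost surely. -/
theorem ae_forall_pos_exists_lt_of_tendsto_lintegral {P : Measure Ω} {g : ℕ → Ω → ℝ≥0∞}
    (hg : ∀ k, Measurable (g k)) (h : Tendsto (fun k => ∫⁻ ω, g k ω ∂P) atTop (𝓝 0)) :
    ∀ᵐ ω ∂P, ∀ ε : ℝ≥0∞, 0 < ε → ∃ k, g k ω < ε := by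
  have h0 : ∫⁻ ω, ⨅ k, g k ω ∂P = 0 := by
    refine le_antisymm (ge_of_tendsto' h fun k => ?_) zero_le
    exact lintegral_mono fun ω => iInf_le _ k
  rw [lintegral_eq_zero_iff (Measurable.iInf hg)] at h0
  filter_upwards [h0] with ω hω ε hε
  rw [← iInf_lt_iff]
  simpa [hω] using hε

/-- The upper limit of the measures of a set. -/
noncomputable def upperLimit (ρ : ℕ → Kernel Ω X) (A : Set X) (ω : Ω) : ℝ≥0∞ :=
  limsup (fun n => ρ n ω A) atTop

theorem measurable_upperLimit (ρ : ℕ → Kernel Ω X) {A : Set X} (hA : MeasurableSet A) :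
    Measurable (upperLimit ρ A) :=
  Measurable.limsup fun n => (ρ n).measurable_coe hA

/-- A sequence of Markov kernels, with constant barycenter `m`, that converges almost surely on each
measurable set. -/
structure ConvergesSetwise (P : Measure Ω) (ρ : ℕ → Kernel Ω X) (m : Measure X) : Prop where
  exists_tendsto : ∀ A, MeasurableSet A → ∀ᵐ ω ∂P, ∃ l, Tendsto (fun n => ρ n ω A) atTop (𝓝 l)
  lintegral_eq : ∀ A, MeasurableSet A → ∀ n, ∫⁻ ω, ρ n ω A ∂P = m A

namespace ConvergesSetwise

variable {P : Measure Ω} [IsProbabilityMeasure P] {ρ : ℕ → Kernel Ω X} [∀ n, IsMarkovKernel (ρ n)]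
  {m : Measure X} (h : ConvergesSetwise P ρ m)

include h

theorem tendsto_upperLimit {A : Set X} (hA : MeasurableSet A) :
    ∀ᵐ ω ∂P, Tendsto (fun n => ρ n ω A) atTop (𝓝 (upperLimit ρ A ω)) := by
  filter_upwards [h.exists_tendsto A hA] with ω ⟨l, hl⟩
  rwa [upperLimit, hl.limsup_eq]

theorem lintegral_upperLimit {A : Set X} (hA : MeasurableSet A) :
    ∫⁻ ω, upperLimit ρ A ω ∂P = m A := by
  have h1 : Tendsto (fun n => ∫⁻ ω, ρ n ω A ∂P) atTop (𝓝 (∫⁻ ω, upperLimit ρ A ω ∂P)) :=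
    tendsto_lintegral_of_dominated_convergence (fun _ => 1)
      (fun n => (ρ n).measurable_coe hA) (fun n => Eventually.of_forall fun ω => prob_le_one)
      (by simp) (h.tendsto_upperLimit hA)
  simp only [h.lintegral_eq A hA] at h1
  exact (tendsto_nhds_unique h1 tendsto_const_nhds)

theorem upperLimit_disjoint_union {A B C : Set X} (hA : MeasurableSet A) (hB : MeasurableSet B)
    (hd : Disjoint A B) (hC : A ∪ B = C) :
    ∀ᵐ ω ∂P, upperLimit ρ C ω = upperLimit ρ A ω + upperLimit ρ B ω := by
  subst hC
  filter_upwards [h.tendsto_upperLimit hA, h.tendsto_upperLimit hB,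
    h.tendsto_upperLimit (hA.union hB)] with ω h1 h2 h3
  refine tendsto_nhds_unique h3 ?_
  simpa only [measure_union hd hB] using h1.add h2

/-- The expectation of the upper limit of `A k` is `m (A k)`. This carries continuity of the
barycenter `m` along shrinking sets over to almost every random limit, with one null set for all
`ε`. -/
theorem ae_upperLimit_lt {A : ℕ → Set X} (hA : ∀ k, MeasurableSet (A k))
    (h0 : Tendsto (fun k => m (A k)) atTop (𝓝 0)) :
    ∀ᵐ ω ∂P, ∀ ε : ℝ≥0∞, 0 < ε → ∃ k, upperLimit ρ (A k) ω < ε := by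
  refine ae_forall_pos_exists_lt_of_tendsto_lintegral
    (fun k => measurable_upperLimit ρ (hA k)) ?_
  simpa only [h.lintegral_upperLimit (hA _)] using h0

/-- The almost sure limits on the sets of a generating `π`-system determine those on all
measurable sets. -/
theorem of_generateFrom {κ : Kernel Ω X} [IsMarkovKernel κ] {S : Set (Set X)}
    (hgen : ‹MeasurableSpace X› = MeasurableSpace.generateFrom S) (hpi : IsPiSystem S)
    (hS : ∀ A ∈ S, upperLimit ρ A =ᵐ[P] fun ω => κ ω A) (A : Set X) (hA : MeasurableSet A) :
    upperLimit ρ A =ᵐ[P] fun ω => κ ω A := by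
  have huniv : ∀ ω, upperLimit ρ Set.univ ω = 1 := fun ω => by simp [upperLimit]
  induction A, hA using MeasurableSpace.induction_on_inter hgen hpi with
  | empty => exact Eventually.of_forall fun ω => by simp [upperLimit]
  | basic A hA => exact hS A hA
  | compl A hA ih =>
    filter_upwards [ih, h.upperLimit_disjoint_union hA hA.compl disjoint_compl_right
      (Set.union_compl_self A)] with ω h1 h2
    rw [huniv, h1] at h2
    rw [prob_compl_eq_one_sub hA, h2, ENNReal.add_sub_cancel_left (measure_ne_top _ _)]
  | iUnion f hd hm ih =>
    -- Pointwise, finite partial sums give only one inequality for a countable union. Equality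
    -- almost everywhere follows because both sides have the same integral, namely the `m`-mass of
    -- the union.
    have hle : (fun ω => κ ω (⋃ i, f i)) ≤ᵐ[P] upperLimit ρ (⋃ i, f i) := by
      filter_upwards [ae_all_iff.2 ih, ae_all_iff.2 fun i => h.tendsto_upperLimit (hm i),
        h.tendsto_upperLimit (MeasurableSet.iUnion hm)] with ω h1 h2 h3
      rw [measure_iUnion hd hm, ENNReal.tsum_eq_iSup_sum]
      refine iSup_le fun s => ?_
      have h4 : Tendsto (fun n => ∑ i ∈ s, ρ n ω (f i)) atTop (𝓝 (∑ i ∈ s, κ ω (f i))) :=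
        tendsto_finsetSum _ fun i _ => by simpa only [← h1 i] using h2 i
      refine le_of_tendsto_of_tendsto' h4 h3 fun n => ?_
      rw [measure_iUnion hd hm]
      exact ENNReal.sum_le_tsum s
    refine (ae_eq_of_ae_le_of_lintegral_le hle ?_ ?_ ?_).symm
    · exact ((lintegral_mono fun ω => prob_le_one).trans_lt (by simp)).ne
    · exact (measurable_upperLimit ρ (MeasurableSet.iUnion hm)).aemeasurable
    · rw [h.lintegral_upperLimit (MeasurableSet.iUnion hm), measure_iUnion hd hm]
      simp only [measure_iUnion hd hm]
      rw [lintegral_tsum fun i => (κ.measurable_coe (hm i)).aemeasurable]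
      refine ENNReal.tsum_le_tsum fun i => ?_
      rw [← h.lintegral_upperLimit (hm i)]
      exact (lintegral_congr_ae (ih i)).le

end ConvergesSetwise

end LimitOfKernels

/-! ### Realising the setwise limit as a Markov kernel. -/

namespace ConvergesSetwise

variable {Ω : Type*} [MeasurableSpace Ω]
  {P : Measure Ω} [IsProbabilityMeasure P]

/-- Restricting to half-lines with rational endpoints leaves countably many null sets. Monotonicity
comes from almost sure additivity, while the limits at infinity and right continuity come from
`ae_upperLimit_lt` applied to half-lines and half-open intervals decreasing to the empty set. -/
theorem ae_isRatStieltjesPoint {ρ : ℕ → Kernel Ω ℝ} [∀ n, IsMarkovKernel (ρ n)]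
    {m : Measure ℝ} [IsFiniteMeasure m] (h : ConvergesSetwise P ρ m) :
    ∀ᵐ ω ∂P, IsRatStieltjesPoint
      (fun ω (q : ℚ) => (upperLimit ρ (Set.Iic (q : ℝ)) ω).toReal) ω := by
  have hle1 : ∀ A ω, upperLimit ρ A ω ≤ 1 := fun A ω =>
    limsup_le_of_le (by isBoundedDefault) (Eventually.of_forall fun n => prob_le_one)
  have hfin : ∀ A ω, upperLimit ρ A ω ≠ ∞ := fun A ω => ne_top_of_le_ne_top (by simp) (hle1 A ω)
  have huniv : ∀ ω, upperLimit ρ Set.univ ω = 1 := fun ω => by simp [upperLimit]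
  have hIoc : ∀ᵐ ω ∂P, ∀ q r : ℚ, q ≤ r → upperLimit ρ (Set.Iic (r : ℝ)) ω
      = upperLimit ρ (Set.Iic (q : ℝ)) ω + upperLimit ρ (Set.Ioc (q : ℝ) r) ω := by
    refine ae_all_iff.2 fun q => ae_all_iff.2 fun r => ?_
    by_cases hqr : q ≤ r
    · filter_upwards [h.upperLimit_disjoint_union measurableSet_Iic measurableSet_Ioc
        (Set.disjoint_left.2 fun x h1 h2 => not_lt.2 h1 h2.1)
        (Set.Iic_union_Ioc_eq_Iic (Rat.cast_le.2 hqr))] with ω hω _ using hω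
    · exact Eventually.of_forall fun ω h => absurd h hqr
  have hIoi : ∀ᵐ ω ∂P, ∀ q : ℚ, 1
      = upperLimit ρ (Set.Iic (q : ℝ)) ω + upperLimit ρ (Set.Ioi (q : ℝ)) ω := by
    refine ae_all_iff.2 fun q => ?_
    filter_upwards [h.upperLimit_disjoint_union measurableSet_Iic measurableSet_Ioi
        (Set.Iic_disjoint_Ioi le_rfl)
        (Set.Iic_union_Ioi (a := (q : ℝ)))] with ω hω
    rw [← hω, huniv]
  have hTop : ∀ᵐ ω ∂P, ∀ ε : ℝ≥0∞, 0 < ε →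
      ∃ k : ℕ, upperLimit ρ (Set.Ioi (((k : ℕ) : ℚ) : ℝ)) ω < ε := by
    refine h.ae_upperLimit_lt (fun k => measurableSet_Ioi) ?_
    have := tendsto_measure_iInter_atTop (μ := m) (s := fun k : ℕ => Set.Ioi (((k : ℕ) : ℚ) : ℝ))
      (fun k => measurableSet_Ioi.nullMeasurableSet)
      (fun i j hij => Set.Ioi_subset_Ioi (by exact_mod_cast hij)) ⟨0, measure_ne_top _ _⟩
    have he : ⋂ k : ℕ, Set.Ioi (((k : ℕ) : ℚ) : ℝ) = ∅ := by
      refine Set.eq_empty_of_forall_notMem fun x hx => ?_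
      obtain ⟨k, hk⟩ := exists_nat_gt x
      have := Set.mem_iInter.1 hx k
      simp only [Set.mem_Ioi, Rat.cast_natCast] at this
      linarith
    rwa [he, measure_empty] at this
  have hBot : ∀ᵐ ω ∂P, ∀ ε : ℝ≥0∞, 0 < ε →
      ∃ k : ℕ, upperLimit ρ (Set.Iic ((-(k : ℕ) : ℚ) : ℝ)) ω < ε := by
    refine h.ae_upperLimit_lt (fun k => measurableSet_Iic) ?_
    have := tendsto_measure_iInter_atTop (μ := m)
      (s := fun k : ℕ => Set.Iic ((-(k : ℕ) : ℚ) : ℝ))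
      (fun k => measurableSet_Iic.nullMeasurableSet)
      (fun i j hij => Set.Iic_subset_Iic.2 (by push_cast; simpa using hij))
      ⟨0, measure_ne_top _ _⟩
    have he : ⋂ k : ℕ, Set.Iic ((-(k : ℕ) : ℚ) : ℝ) = ∅ := by
      refine Set.eq_empty_of_forall_notMem fun x hx => ?_
      obtain ⟨k, hk⟩ := exists_nat_gt (-x)
      have := Set.mem_iInter.1 hx k
      simp only [Set.mem_Iic, Rat.cast_natCast, Rat.cast_neg] at this
      linarith
    rwa [he, measure_empty] at this
  have hRight : ∀ᵐ ω ∂P, ∀ t : ℚ, ∀ ε : ℝ≥0∞, 0 < ε →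
      ∃ k : ℕ, upperLimit ρ (Set.Ioc (t : ℝ) ((t + 1 / ((k : ℚ) + 1) : ℚ) : ℝ)) ω < ε := by
    refine ae_all_iff.2 fun t => h.ae_upperLimit_lt (fun k => measurableSet_Ioc) ?_
    have := tendsto_measure_iInter_atTop (μ := m)
      (s := fun k : ℕ => Set.Ioc (t : ℝ) ((t + 1 / ((k : ℚ) + 1) : ℚ) : ℝ))
      (fun k => measurableSet_Ioc.nullMeasurableSet)
      (fun i j hij => Set.Ioc_subset_Ioc_right (by
        push_cast
        have : (i : ℝ) ≤ j := by exact_mod_cast hij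
        gcongr)) ⟨0, measure_ne_top _ _⟩
    have he : ⋂ k : ℕ, Set.Ioc (t : ℝ) ((t + 1 / ((k : ℚ) + 1) : ℚ) : ℝ) = ∅ := by
      refine Set.eq_empty_of_forall_notMem fun x hx => ?_
      have hx0 := (Set.mem_iInter.1 hx 0).1
      obtain ⟨k, hk⟩ := exists_nat_one_div_lt (sub_pos.2 hx0)
      have := (Set.mem_iInter.1 hx k).2
      push_cast at this
      linarith
    rwa [he, measure_empty] at this
  filter_upwards [hIoc, hIoi, hTop, hBot, hRight] with ω h1 h2 h3 h4 h5
  have hmono : Monotone fun q : ℚ => (upperLimit ρ (Set.Iic (q : ℝ)) ω).toReal := fun q r hqr =>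
    ENNReal.toReal_mono (hfin _ _) ((h1 q r hqr).symm ▸ le_self_add)
  refine ⟨hmono, ?_, ?_, fun t => ?_⟩
  · refine tendsto_order.2 ⟨fun a ha => ?_, fun a ha => Eventually.of_forall fun q => ?_⟩
    · obtain ⟨k, hk⟩ := h3 (ENNReal.ofReal (1 - a)) (by simpa using ha)
      filter_upwards [eventually_ge_atTop (k : ℚ)] with q hq
      refine lt_of_lt_of_le ?_ (hmono hq)
      have h6 := congrArg ENNReal.toReal (h2 k)
      rw [ENNReal.toReal_add (hfin _ _) (hfin _ _), ENNReal.toReal_one] at h6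
      have h7 := (ENNReal.lt_ofReal_iff_toReal_lt (hfin _ _)).1 hk
      linarith
    · exact lt_of_le_of_lt (ENNReal.toReal_mono (by simp) (hle1 _ _)) (by simpa using ha)
  · refine tendsto_order.2 ⟨fun a ha => Eventually.of_forall fun q => ?_, fun a ha => ?_⟩
    · exact lt_of_lt_of_le ha ENNReal.toReal_nonneg
    · obtain ⟨k, hk⟩ := h4 (ENNReal.ofReal a) (by simpa using ha)
      filter_upwards [eventually_le_atBot (-(k : ℕ) : ℚ)] with q hq
      exact (hmono hq).trans_lt ((ENNReal.lt_ofReal_iff_toReal_lt (hfin _ _)).1 hk)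
  · have hbdd : BddBelow (Set.range fun r : Set.Ioi t =>
        (upperLimit ρ (Set.Iic ((r : ℚ) : ℝ)) ω).toReal) :=
      ⟨0, by rintro _ ⟨r, rfl⟩; exact ENNReal.toReal_nonneg⟩
    refine le_antisymm (le_of_forall_pos_le_add fun ε hε => ?_)
      (le_ciInf fun r => hmono (le_of_lt r.2))
    obtain ⟨k, hk⟩ := h5 t (ENNReal.ofReal ε) (by simpa using hε)
    have hlt : t < t + 1 / ((k : ℚ) + 1) := lt_add_of_pos_right _ (by positivity)
    refine (ciInf_le hbdd ⟨_, hlt⟩).trans ?_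
    have h6 := congrArg ENNReal.toReal (h1 t _ hlt.le)
    rw [ENNReal.toReal_add (hfin _ _) (hfin _ _)] at h6
    have h7 := (ENNReal.lt_ofReal_iff_toReal_lt (hfin _ _)).1 hk
    simp only at h6 ⊢
    linarith

/-- The rational distribution function is replaced by a default one wherever it is not a Stieltjes
point, so the kernel is Markov everywhere. It agrees with the limits on rational half-lines, which
form a generating `π`-system. -/
theorem exists_kernel_real {ρ : ℕ → Kernel Ω ℝ} [∀ n, IsMarkovKernel (ρ n)]
    {m : Measure ℝ} [IsFiniteMeasure m] (h : ConvergesSetwise P ρ m) :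
    ∃ κ : Kernel Ω ℝ, IsMarkovKernel κ ∧
      ∀ A, MeasurableSet A → upperLimit ρ A =ᵐ[P] fun ω => κ ω A := by
  let f : Ω → ℚ → ℝ := fun ω q => (upperLimit ρ (Set.Iic (q : ℝ)) ω).toReal
  have hfm : Measurable f := measurable_pi_lambda _ fun q =>
    (measurable_upperLimit ρ measurableSet_Iic).ennreal_toReal
  let κ : Kernel Ω ℝ := ⟨fun ω => (stieltjesOfMeasurableRat f hfm ω).measure,
    measurable_measure_stieltjesOfMeasurableRat hfm⟩
  have : IsMarkovKernel κ := ⟨fun ω => instIsProbabilityMeasure_stieltjesOfMeasurableRat hfm ω⟩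
  refine ⟨κ, this, h.of_generateFrom (S := ⋃ a : ℚ, {Set.Iic (a : ℝ)}) ?_
    Real.isPiSystem_Iic_rat ?_⟩
  · rw [← Real.borel_eq_generateFrom_Iic_rat]
    exact BorelSpace.measurable_eq
  · intro A hA
    obtain ⟨q, rfl⟩ := Set.mem_iUnion.1 hA
    filter_upwards [h.ae_isRatStieltjesPoint] with ω hω
    change _ = (stieltjesOfMeasurableRat f hfm ω).measure (Set.Iic (q : ℝ))
    rw [measure_stieltjesOfMeasurableRat_Iic, stieltjesOfMeasurableRat_eq,
      toRatCDF_of_isRatStieltjesPoint hω, ENNReal.ofReal_toReal]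
    exact ne_top_of_le_ne_top ENNReal.one_ne_top
      (limsup_le_of_le (by isBoundedDefault) (Eventually.of_forall fun n => prob_le_one))

/-- Almost surely setwise convergent random measures on a standard Borel space have a limit that is
a random measure. -/
theorem exists_kernel {X : Type*} [MeasurableSpace X] [StandardBorelSpace X] [Nonempty X]
    {ρ : ℕ → Kernel Ω X} [∀ n, IsMarkovKernel (ρ n)]
    {m : Measure X} [IsFiniteMeasure m] (h : ConvergesSetwise P ρ m) :
    ∃ κ : Kernel Ω X, IsMarkovKernel κ ∧ ∀ A, MeasurableSet A →
      ∀ᵐ ω ∂P, Tendsto (fun n => ρ n ω A) atTop (𝓝 (κ ω A)) := by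
  classical
  -- The general case is transported from the line along a Borel embedding.
  have he := measurableEmbedding_embeddingReal X
  set e := embeddingReal X
  have hmap : ∀ n ω (A : Set ℝ), MeasurableSet A →
      (ρ n).map e ω A = ρ n ω (e ⁻¹' A) := fun n ω A hA => by
    rw [Kernel.map_apply' _ he.measurable _ hA]
  have : ∀ n, IsMarkovKernel ((ρ n).map e) := fun n => Kernel.IsMarkovKernel.map _ he.measurable
  have h' : ConvergesSetwise P (fun n => (ρ n).map e) (m.map e) := by
    refine ⟨fun A hA => ?_, fun A hA n => ?_⟩
    · simpa only [hmap _ _ A hA] using h.exists_tendsto _ (he.measurable hA)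
    · simpa only [hmap _ _ A hA, Measure.map_apply he.measurable hA] using
        h.lintegral_eq _ (he.measurable hA) n
  obtain ⟨κ, hκ, hlim⟩ := h'.exists_kernel_real
  have hrange : ∀ᵐ ω ∂P, κ ω (Set.range e) = 1 := by
    filter_upwards [hlim _ he.measurableSet_range] with ω hω
    rw [← hω]
    simp [upperLimit, hmap _ _ _ he.measurableSet_range]
  -- Off this event of full measure, the real-valued limit may charge points outside the image of
  -- `X`, so a Dirac mass serves as default value.
  set S : Set Ω := {ω | κ ω (Set.range e) = 1}
  have hS : MeasurableSet S := κ.measurable_coe he.measurableSet_range (measurableSet_singleton 1)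
  obtain ⟨x0⟩ := ‹Nonempty X›
  refine ⟨Kernel.piecewise hS (κ.comapRight he) (Kernel.const _ (Measure.dirac x0)),
    ⟨fun ω => ?_⟩, fun A hA => ?_⟩
  · by_cases hω : ω ∈ S
    · rw [Kernel.piecewise_apply, if_pos hω]
      refine ⟨?_⟩
      rw [Kernel.comapRight_apply' _ _ _ MeasurableSet.univ, Set.image_univ]
      exact hω
    · rw [Kernel.piecewise_apply, if_neg hω]
      infer_instance
  · filter_upwards [hrange, hlim _ (he.measurableSet_image.2 hA),
      h.tendsto_upperLimit hA] with ω h1 h2 h3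
    rw [Kernel.piecewise_apply, if_pos (show ω ∈ S from h1), Kernel.comapRight_apply' _ _ _ hA,
      ← h2]
    convert h3 using 2
    simp only [upperLimit, hmap _ _ _ (he.measurableSet_image.2 hA),
      Set.preimage_image_eq _ he.injective]

end ConvergesSetwise

/-! ### First step recursion for the random walk. -/

section WalkRecursion

variable {G : Type*} [Group G]

/-- The trajectory that starts at the identity and continues with the translate `s ω`. -/
def stepPath (s : G) (ω : ℕ → G) : ℕ → G
  | 0 => 1
  | n + 1 => s * ω n

@[simp] theorem stepPath_zero (s : G) (ω : ℕ → G) : stepPath s ω 0 = 1 := rfl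

@[simp] theorem stepPath_succ (s : G) (ω : ℕ → G) (n : ℕ) :
    stepPath s ω (n + 1) = s * ω n := rfl

variable [MeasurableSpace G]

/-- Prepending a coordinate to an infinite product. -/
theorem infinitePi_eq_map_prod (μ : Measure G) [IsProbabilityMeasure μ] :
    Measure.infinitePi (fun _ : ℕ => μ)
      = (μ.prod (Measure.infinitePi fun _ : ℕ => μ)).map
        (fun p : G × (ℕ → G) => fun n => Nat.casesOn n p.1 p.2) := by
  have hm : Measurable (fun p : G × (ℕ → G) => fun n => (Nat.casesOn n p.1 p.2 : G)) := by
    refine measurable_pi_lambda _ fun n => ?_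
    cases n with
    | zero => exact measurable_fst
    | succ n => exact (measurable_pi_apply n).comp measurable_snd
  refine (Measure.eq_infinitePi _ fun s t ht => ?_).symm
  classical
  obtain ⟨N, hN⟩ : ∃ N, s ⊆ Finset.range (N + 1) := by
    obtain ⟨N, hN⟩ := s.exists_nat_subset_range
    exact ⟨N, hN.trans (Finset.range_subset_range.2 (Nat.le_succ N))⟩
  -- Padding with the whole space turns the index set into an initial segment, from which coordinate
  -- `0` splits off.
  set t' : ℕ → Set G := fun i => if i ∈ s then t i else Set.univ with ht'
  have ht'm : ∀ i, MeasurableSet (t' i) := fun i => by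
    rw [ht']; dsimp only; split_ifs; exacts [ht i, MeasurableSet.univ]
  have hprod : ∏ i ∈ s, μ (t i) = ∏ i ∈ Finset.range (N + 1), μ (t' i) := by
    rw [← Finset.prod_subset hN]
    · exact Finset.prod_congr rfl fun i hi => by simp [ht', hi]
    · intro i _ hi
      simp [ht', hi]
  have hset : (fun p : G × (ℕ → G) => fun n => (Nat.casesOn n p.1 p.2 : G)) ⁻¹' (Set.pi s t)
      = t' 0 ×ˢ (Set.pi (Finset.range N) fun i => t' (i + 1)) := by
    ext p
    simp only [Set.mem_preimage, Set.mem_pi, Finset.mem_coe, Set.mem_prod, Finset.mem_range]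
    constructor
    · intro h
      refine ⟨?_, fun i _ => ?_⟩
      · simp only [ht']; split_ifs with h0
        exacts [h 0 h0, trivial]
      · simp only [ht']; split_ifs with h0
        exacts [h (i + 1) h0, trivial]
    · rintro ⟨h0, h1⟩ i hi
      cases i with
      | zero => simpa [ht', hi] using h0
      | succ i =>
        have := h1 i (by simpa using hN hi)
        simpa [ht', hi] using this
  rw [Measure.map_apply hm (MeasurableSet.pi s.countable_toSet fun i _ => ht i), hset,
    Measure.prod_prod, Measure.infinitePi_pi _ fun i _ => ht'm _, hprod, Finset.prod_range_succ',
    mul_comm]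

variable [Countable G] [DiscreteMeasurableSpace G]

theorem measurable_stepPath : Measurable fun p : G × (ℕ → G) => stepPath p.1 p.2 := by
  refine measurable_pi_lambda _ fun n => ?_
  cases n with
  | zero => exact measurable_const
  | succ n =>
    exact (Measurable.of_discrete (f := fun p : G × G => p.1 * p.2)).comp
      (measurable_fst.prodMk ((measurable_pi_apply n).comp measurable_snd))

theorem walk_cons (s : G) (t : ℕ → G) :
    walk (fun n => (Nat.casesOn n s t : G)) = stepPath s (walk t) := by
  funext n
  cases n with
  | zero => rfl
  | succ n =>
    induction n with
    | zero => simp [walk]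
    | succ n ih => rw [walk, ih]; simp [walk, mul_assoc]

/-- First step decomposition of the law of the random walk. -/
theorem lintegral_walkLaw (μ : Measure G) [IsProbabilityMeasure μ] {Φ : (ℕ → G) → ℝ≥0∞}
    (hΦ : Measurable Φ) :
    ∫⁻ ω, Φ ω ∂walkLaw μ = ∫⁻ s, ∫⁻ ω, Φ (stepPath s ω) ∂walkLaw μ ∂μ := by
  have hm : Measurable (fun p : G × (ℕ → G) => fun n => (Nat.casesOn n p.1 p.2 : G)) := by
    refine measurable_pi_lambda _ fun n => ?_
    cases n with
    | zero => exact measurable_fst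
    | succ n => exact (measurable_pi_apply n).comp measurable_snd
  have hs : ∀ s : G, Measurable fun ω : ℕ → G => Φ (stepPath s ω) := fun s =>
    hΦ.comp (measurable_stepPath.comp measurable_prodMk_left)
  rw [walkLaw, lintegral_map hΦ measurable_walk]
  conv_lhs => rw [infinitePi_eq_map_prod]
  rw [lintegral_map (f := fun t => Φ (walk t)) (hΦ.comp measurable_walk) hm]
  rw [lintegral_congr fun p : G × (ℕ → G) => congrArg Φ (walk_cons p.1 p.2)]
  have hmm : Measurable fun p : G × (ℕ → G) => Φ (stepPath p.1 (walk p.2)) :=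
    hΦ.comp (measurable_stepPath.comp
      (measurable_fst.prodMk (measurable_walk.comp measurable_snd)))
  rw [lintegral_prod _ hmm.aemeasurable]
  exact lintegral_congr fun s => (lintegral_map (hs s) measurable_walk).symm

theorem walkLaw_zero (μ : Measure G) [IsProbabilityMeasure μ] :
    ∀ᵐ ω ∂walkLaw μ, ω 0 = 1 := by
  have hm : MeasurableSet {ω : ℕ → G | ω 0 = 1}ᶜ :=
    ((measurableSet_singleton (1 : G)).preimage (measurable_pi_apply 0)).compl
  rw [ae_iff, ← Set.compl_ofPred, ← lintegral_indicator_one hm,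
    lintegral_walkLaw _ (measurable_one.indicator hm)]
  simp

/-- Almost sure properties of the walk after its first step. -/
theorem ae_ae_stepPath (μ : Measure G) [IsProbabilityMeasure μ] {p : (ℕ → G) → Prop}
    (hp : ∀ᵐ ω ∂walkLaw μ, p ω) : ∀ᵐ s ∂μ, ∀ᵐ ω ∂walkLaw μ, p (stepPath s ω) := by
  obtain ⟨N, hN, hNm, hN0⟩ := exists_measurable_superset_of_null (ae_iff.1 hp)
  rw [← lintegral_indicator_one hNm, lintegral_walkLaw _ (measurable_one.indicator hNm),
    lintegral_eq_zero_iff Measurable.of_discrete] at hN0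
  filter_upwards [hN0] with s hs
  have hm : Measurable fun ω : ℕ → G => N.indicator (1 : (ℕ → G) → ℝ≥0∞) (stepPath s ω) :=
    (measurable_one.indicator hNm).comp (measurable_stepPath.comp measurable_prodMk_left)
  rw [Pi.zero_apply, lintegral_eq_zero_iff hm] at hs
  filter_upwards [hs] with ω hω
  by_contra h
  simp [Set.indicator_of_mem (hN h)] at hω

end WalkRecursion

/-! ### Existence of the limit measures by martingale convergence. -/

section LimitKernel

variable {G : Type*} [Group G] [Countable G] [MeasurableSpace G] [DiscreteMeasurableSpace G]
variable {X : Type*} [MeasurableSpace X] [MulAction G X] [MeasurableConstSMul G X]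

theorem IsStationary.lintegral_apply {μ : Measure G} {η : Measure X} (h : IsStationary μ η)
    {A : Set X} (hA : MeasurableSet A) : ∫⁻ s, η ((s • ·) ⁻¹' A) ∂μ = η A := by
  conv_rhs => rw [← h, Measure.bind_apply hA Measurable.of_discrete.aemeasurable]
  exact lintegral_congr fun s => (Measure.map_apply (measurable_const_smul s) hA).symm

/-- The random measures `ω ↦ ωₙ η`. -/
noncomputable def translateKernel (η : Measure X) (n : ℕ) : Kernel (ℕ → G) X :=
  (⟨fun g : G => η.map (g • ·), Measurable.of_discrete⟩ : Kernel G X).comap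
    (fun ω => ω n) (measurable_pi_apply n)

theorem translateKernel_apply (η : Measure X) (n : ℕ) (ω : ℕ → G) {A : Set X}
    (hA : MeasurableSet A) : translateKernel η n ω A = η ((ω n • ·) ⁻¹' A) :=
  Measure.map_apply (measurable_const_smul (ω n)) hA

instance (η : Measure X) [IsProbabilityMeasure η] (n : ℕ) :
    IsMarkovKernel (translateKernel (G := G) η n) :=
  ⟨fun ω => Measure.isProbabilityMeasure_map (measurable_const_smul (ω n)).aemeasurable⟩

/-- The martingale property of `n ↦ (ω_n η)(A)`, tested against functionals of the past. Peeling off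
the first step `s` replaces `A` by its preimage under `s` and lowers `n`, so stationarity is needed
only at time `0`. -/
theorem lintegral_mul_translateKernel_succ {μ : Measure G} [IsProbabilityMeasure μ]
    {η : Measure X} (h : IsStationary μ η) (n : ℕ) {A : Set X} (hA : MeasurableSet A)
    {Φ : (ℕ → G) → ℝ≥0∞} (hΦ : Measurable Φ) (hdep : DependsOn Φ (Set.Iic n)) :
    ∫⁻ ω, Φ ω * translateKernel η (n + 1) ω A ∂walkLaw μ
      = ∫⁻ ω, Φ ω * translateKernel η n ω A ∂walkLaw μ := by
  have hm : ∀ (n : ℕ) {A : Set X} (hA : MeasurableSet A) {Φ : (ℕ → G) → ℝ≥0∞},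
      Measurable Φ → Measurable fun ω : ℕ → G => Φ ω * translateKernel η n ω A :=
    fun n A hA Φ hΦ => hΦ.mul ((translateKernel η n).measurable_coe hA)
  have hpre : ∀ (s t : G) (A : Set X), ((s * t) • · : X → X) ⁻¹' A
      = (t • ·) ⁻¹' ((s • ·) ⁻¹' A) := fun s t A => by
    ext x; simp [mul_smul]
  induction n generalizing A Φ with
  | zero =>
    rw [lintegral_walkLaw μ (hm 1 hA hΦ), lintegral_walkLaw μ (hm 0 hA hΦ)]
    have hc : ∀ s (ω : ℕ → G), Φ (stepPath s ω) = Φ 1 := fun s ω =>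
      hdep fun i hi => by
        obtain rfl : i = 0 := by simpa using hi
        rfl
    have h1 : ∀ s, ∫⁻ ω, Φ (stepPath s ω) * translateKernel η (0 + 1) (stepPath s ω) A ∂walkLaw μ
        = Φ 1 * η ((s • ·) ⁻¹' A) := fun s => by
      have : ∀ᵐ ω ∂walkLaw μ, Φ (stepPath s ω) * translateKernel η (0 + 1) (stepPath s ω) A
          = Φ 1 * η ((s • ·) ⁻¹' A) := by
        filter_upwards [walkLaw_zero μ] with ω hω
        rw [hc, translateKernel_apply _ _ _ hA, stepPath_succ, hω, mul_one]
      rw [lintegral_congr_ae this, lintegral_const, measure_univ, mul_one]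
    rw [lintegral_congr h1]
    simp only [hc, translateKernel_apply _ _ _ hA, stepPath_zero, one_smul, Set.preimage_id',
      lintegral_const, measure_univ, mul_one]
    rw [lintegral_const_mul _ Measurable.of_discrete, h.lintegral_apply hA]
  | succ n ih =>
    rw [lintegral_walkLaw μ (hm _ hA hΦ), lintegral_walkLaw μ (hm _ hA hΦ)]
    refine lintegral_congr fun s => ?_
    have h1 := ih (A := (s • ·) ⁻¹' A) (measurable_const_smul s hA)
      (Φ := fun ω => Φ (stepPath s ω))
      (hΦ.comp (measurable_stepPath.comp measurable_prodMk_left)) (fun ω ω' hω => hdep fun i hi => by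
        cases i with
        | zero => rfl
        | succ i => simp [hω i (by simpa using hi)])
    simpa only [translateKernel_apply _ _ _ hA,
      translateKernel_apply _ _ _ (measurable_const_smul s hA), stepPath_succ, hpre] using h1

theorem lintegral_translateKernel {μ : Measure G} [IsProbabilityMeasure μ]
    {η : Measure X} (h : IsStationary μ η) (n : ℕ) {A : Set X} (hA : MeasurableSet A) :
    ∫⁻ ω, translateKernel η n ω A ∂walkLaw μ = η A := by
  induction n with
  | zero =>
    have : ∀ᵐ ω ∂walkLaw μ, translateKernel η 0 ω A = η A := by
      filter_upwards [walkLaw_zero μ] with ω hω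
      simp [translateKernel_apply _ _ _ hA, hω]
    rw [lintegral_congr_ae this, lintegral_const, measure_univ, mul_one]
  | succ n ih =>
    have := lintegral_mul_translateKernel_succ h n hA (Φ := fun _ => 1) measurable_const
      (fun _ _ _ => rfl)
    simpa only [one_mul, ih] using this

/-- For each set the masses form a martingale with values in `[0, 1]`, which converges almost
surely. -/
theorem convergesSetwise_translateKernel {μ : Measure G} [IsProbabilityMeasure μ]
    {η : Measure X} [IsProbabilityMeasure η] (h : IsStationary μ η) :
    ConvergesSetwise (walkLaw μ) (translateKernel (G := G) η) η := by
  refine ⟨fun A hA => ?_, fun A hA n => lintegral_translateKernel h n hA⟩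
  set f : ℕ → (ℕ → G) → ℝ := fun n ω => (translateKernel η n ω A).toReal with hf
  have hfm : ∀ n, Measurable (f n) := fun n =>
    ((translateKernel η n).measurable_coe hA).ennreal_toReal
  have hle : ∀ n ω, ‖f n ω‖ ≤ 1 := fun n ω => by
    rw [Real.norm_eq_abs, abs_of_nonneg ENNReal.toReal_nonneg]
    exact ENNReal.toReal_mono ENNReal.one_ne_top prob_le_one
  have hint : ∀ n, Integrable (f n) (walkLaw μ) := fun n =>
    Integrable.of_bound (hfm n).aestronglyMeasurable 1 (Eventually.of_forall (hle n))
  have hmart : Martingale f (Filtration.piLE (X := fun _ : ℕ => G)) (walkLaw μ) := by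
    refine martingale_of_setIntegral_eq_succ (fun n => ?_) hint fun n S hS => ?_
    · refine Measurable.stronglyMeasurable ?_
      have h1 : Measurable[Filtration.piLE (X := fun _ : ℕ => G) n] fun ω : ℕ → G => ω n :=
        (measurable_pi_apply (⟨n, le_refl n⟩ : Set.Iic n)).comp
          (comap_measurable (Preorder.restrictLe (π := fun _ : ℕ => G) n))
      exact (Measurable.of_discrete
        (f := fun g : G => ((η.map (g • ·)) A).toReal)).comp h1
    · have hSm := Filtration.piLE.le n S hS
      obtain ⟨T, -, rfl⟩ := hS
      have h2 : ∀ n', ∫ ω in Preorder.restrictLe (π := fun _ : ℕ => G) n ⁻¹' T, f n' ω ∂walkLaw μ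
          = (∫⁻ ω, (Preorder.restrictLe (π := fun _ : ℕ => G) n ⁻¹' T).indicator 1 ω
              * translateKernel η n' ω A ∂walkLaw μ).toReal := fun n' => by
        rw [integral_toReal ((translateKernel η n').measurable_coe hA).aemeasurable
          (Eventually.of_forall fun ω => measure_lt_top _ _), ← lintegral_indicator hSm]
        congr 2 with ω
        by_cases hω : ω ∈ Preorder.restrictLe (π := fun _ : ℕ => G) n ⁻¹' T <;> simp [hω]
      rw [h2, h2, lintegral_mul_translateKernel_succ h n hA (measurable_one.indicator hSm)]
      intro ω ω' hω
      have : Preorder.restrictLe (π := fun _ : ℕ => G) n ω = Preorder.restrictLe n ω' :=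
        funext fun i => hω i i.2
      have hiff : (ω ∈ Preorder.restrictLe (π := fun _ : ℕ => G) n ⁻¹' T)
          = (ω' ∈ Preorder.restrictLe (π := fun _ : ℕ => G) n ⁻¹' T) := congrArg (· ∈ T) this
      by_cases hmem : ω ∈ Preorder.restrictLe (π := fun _ : ℕ => G) n ⁻¹' T
      · rw [Set.indicator_of_mem hmem, Set.indicator_of_mem (hiff.mp hmem)]; rfl
      · rw [Set.indicator_of_notMem hmem, Set.indicator_of_notMem (hiff ▸ hmem)]
  have hconv := hmart.submartingale.ae_tendsto_limitProcess (R := 1) fun n => by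
    refine (eLpNorm_le_of_ae_bound (C := 1) (Eventually.of_forall (hle n))).trans ?_
    simp
  filter_upwards [hconv] with ω hω
  refine ⟨ENNReal.ofReal (Filtration.piLE.limitProcess f (walkLaw μ) ω), ?_⟩
  have := (ENNReal.continuous_ofReal.tendsto _).comp hω
  refine this.congr fun n => ?_
  simp [hf, ENNReal.ofReal_toReal, measure_ne_top]

/-- For stationary measures the default branch in the definition of `limitKernel` never occurs. -/
theorem limitKernel_spec {μ : Measure G} [IsProbabilityMeasure μ] [StandardBorelSpace X]
    [Nonempty X] {η : Measure X} [IsProbabilityMeasure η] (h : IsStationary μ η) :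
    IsLimitKernel μ η (limitKernel μ η) := by
  have hex : ∃ κ : Kernel (ℕ → G) X, IsMarkovKernel κ ∧ IsLimitKernel μ η κ := by
    obtain ⟨κ, h1, h2⟩ := (convergesSetwise_translateKernel h).exists_kernel
    exact ⟨κ, h1, h2⟩
  rw [limitKernel, dif_pos hex]
  exact hex.choose_spec.2

end LimitKernel

/-! ### Step invariance and the joining of a stationary measure with the walk. -/

section Joining

variable {G : Type*} [Group G] [Countable G] [MeasurableSpace G] [DiscreteMeasurableSpace G]
variable {X : Type*} [MeasurableSpace X] [MulAction G X] [MeasurableConstSMul G X]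

/-- First step decomposition of a measure on `X × G^ℕ`: a random pair `(x, ω)` with law `J` is
distributed as `(s x', (1, s ω'₀, s ω'₁, …))` with `s` of law `μ` and `(x', ω')` an independent
pair with law `J`. -/
def IsStepInvariant (μ : Measure G) (J : Measure (X × (ℕ → G))) : Prop :=
  ∀ Φ : X × (ℕ → G) → ℝ≥0∞, Measurable Φ →
    ∫⁻ p, Φ p ∂J = ∫⁻ s, ∫⁻ p, Φ (s • p.1, stepPath s p.2) ∂J ∂μ

theorem measurable_stepPair (s : G) :
    Measurable fun p : X × (ℕ → G) => (s • p.1, stepPath s p.2) :=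
  (measurable_fst.const_smul s).prodMk
    (measurable_stepPath.comp (measurable_const.prodMk measurable_snd))

theorem IsStepInvariant.apply_prod {μ : Measure G} {J : Measure (X × (ℕ → G))}
    (h : IsStepInvariant μ J) {A : Set X} (hA : MeasurableSet A) {C : Set (ℕ → G)}
    (hC : MeasurableSet C) :
    J (A ×ˢ C) = ∫⁻ s, J (((s • ·) ⁻¹' A) ×ˢ (stepPath s ⁻¹' C)) ∂μ := by
  rw [← lintegral_indicator_one (hA.prod hC), h _ (measurable_one.indicator (hA.prod hC))]
  refine lintegral_congr fun s => ?_
  rw [← lintegral_indicator_one]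
  · rfl
  · exact measurable_stepPair s (hA.prod hC)

/-- A step invariant measure is determined by its projection to `X`. -/
theorem IsStepInvariant.ext {μ : Measure G} {J J' : Measure (X × (ℕ → G))}
    [IsFiniteMeasure J] [IsFiniteMeasure J'] (h : IsStepInvariant μ J) (h' : IsStepInvariant μ J')
    (hfst : J.fst = J'.fst) : J = J' := by
  have huniv : ∀ A : Set X, MeasurableSet A → J (A ×ˢ Set.univ) = J' (A ×ˢ Set.univ) :=
    fun A hA => by
      have := congrArg (fun m => m A) hfst
      simpa only [Measure.fst_apply hA, ← Set.prod_univ] using this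
  -- Step invariance expresses the measure of a cylinder over `n + 1` coordinates through cylinders
  -- over `n`, since coordinate `0` of `stepPath` is fixed. At depth `0` only the projection to `X`
  -- is left.
  have hcyl : ∀ (n : ℕ) (A : Set X) (C : Set (ℕ → G)), MeasurableSet A → MeasurableSet C →
      DependsOn (· ∈ C) (Set.Iio n) → J (A ×ˢ C) = J' (A ×ˢ C) := by
    intro n
    induction n with
    | zero =>
      intro A C hA hC hdep
      have : C = ∅ ∨ C = Set.univ := by
        rcases C.eq_empty_or_nonempty with h | ⟨c, hc⟩
        · exact Or.inl h
        · refine Or.inr (Set.eq_univ_of_forall fun ω => ?_)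
          have := hdep (x := ω) (y := c) fun i hi => absurd hi (by simp)
          simpa only [eq_iff_iff, hc, iff_true] using this
      rcases this with rfl | rfl
      · simp
      · exact huniv A hA
    | succ n ih =>
      intro A C hA hC hdep
      rw [h.apply_prod hA hC, h'.apply_prod hA hC]
      refine lintegral_congr fun s => ih _ _ (measurable_const_smul s hA)
        ((measurable_stepPath.comp measurable_prodMk_left) hC) fun ω ω' hω => ?_
      refine hdep (x := stepPath s ω) (y := stepPath s ω') fun i hi => ?_
      cases i with
      | zero => rfl
      | succ i => simp [hω i (by simpa using hi)]
  refine Measure.ext_prod fun {A C} hA hC => ?_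
  -- For fixed `A`, agreement on cylinders determines a finite measure on trajectories.
  let mk : Measure (X × (ℕ → G)) → Measure (ℕ → G) := fun J => (J.restrict (A ×ˢ Set.univ)).snd
  have hmk : ∀ (J : Measure (X × (ℕ → G))) (C : Set (ℕ → G)), MeasurableSet C →
      mk J C = J (A ×ˢ C) := fun J C hC => by
    rw [Measure.snd_apply hC, Measure.restrict_apply (measurable_snd hC)]
    congr 1
    ext p
    simp [and_comm]
  rw [← hmk J C hC, ← hmk J' C hC]
  congr 1
  refine ext_of_generate_finite _ generateFrom_measurableCylinders.symm
    isPiSystem_measurableCylinders (fun S hS => ?_) ?_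
  · obtain ⟨t, T, hT, rfl⟩ := (mem_measurableCylinders _).1 hS
    rw [hmk _ _ hT.cylinder, hmk _ _ hT.cylinder]
    obtain ⟨N, hN⟩ := t.exists_nat_subset_range
    refine hcyl N A _ hA hT.cylinder fun ω ω' hω => ?_
    have : t.restrict ω = t.restrict ω' := funext fun i => hω i (by simpa using hN i.2)
    simp only [mem_cylinder, this]
  · rw [hmk _ _ MeasurableSet.univ, hmk _ _ MeasurableSet.univ, huniv A hA]

variable [StandardBorelSpace X] [Nonempty X]

theorem joining_apply_prod (μ : Measure G) [IsProbabilityMeasure μ] (η : Measure X)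
    [IsProbabilityMeasure η] {A : Set X} (hA : MeasurableSet A) {C : Set (ℕ → G)}
    (hC : MeasurableSet C) :
    joining μ η (A ×ˢ C) = ∫⁻ ω, C.indicator 1 ω * limitKernel μ η ω A ∂walkLaw μ := by
  rw [joining, Measure.map_apply measurable_swap (hA.prod hC), Set.preimage_swap_prod,
    Measure.compProd_apply_prod hC hA, ← lintegral_indicator hC]
  refine lintegral_congr fun ω => ?_
  by_cases h : ω ∈ C <;> simp [h]

variable {μ : Measure G} [IsProbabilityMeasure μ] {η : Measure X} [IsProbabilityMeasure η]

/-- Dropping the initial term does not change a limit, and the later terms along `stepPath s ω` are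
the translates by `s` of those along `ω`. -/
theorem limitKernel_stepPath (h : IsStationary μ η) {A : Set X} (hA : MeasurableSet A) :
    ∀ᵐ s ∂μ, ∀ᵐ ω ∂walkLaw μ,
      limitKernel μ η (stepPath s ω) A = limitKernel μ η ω ((s • ·) ⁻¹' A) := by
  filter_upwards [ae_ae_stepPath μ (limitKernel_spec h A hA)] with s hs
  filter_upwards [hs, limitKernel_spec h _ (measurable_const_smul s hA)] with ω h1 h2
  have h3 := (tendsto_add_atTop_iff_nat 1).2 h1
  refine tendsto_nhds_unique h3 (h2.congr fun n => ?_)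
  rw [Measure.map_apply (measurable_const_smul _) hA,
    Measure.map_apply (measurable_const_smul _) (measurable_const_smul s hA)]
  congr 1
  ext x
  simp [mul_smul]

/-- Combine the first step decomposition of the walk with equivariance of the limit measures. It
suffices to compare rectangles, so the exceptional null sets of `limitKernel_stepPath` may depend on
the set `A`. -/
theorem isStepInvariant_joining (h : IsStationary μ η) : IsStepInvariant μ (joining μ η) := by
  have hJ : joining μ η = μ.bind fun s => (joining μ η).map
      fun p : X × (ℕ → G) => (s • p.1, stepPath s p.2) := by
    have hprob : IsProbabilityMeasure (μ.bind fun s => (joining μ η).map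
        fun p : X × (ℕ → G) => (s • p.1, stepPath s p.2)) := by
      refine ⟨?_⟩
      rw [Measure.bind_apply MeasurableSet.univ Measurable.of_discrete.aemeasurable]
      simp [Measure.map_apply (measurable_stepPair _) MeasurableSet.univ]
    refine Measure.ext_prod fun {A C} hA hC => ?_
    have hstep : ∀ s : G, MeasurableSet (stepPath s ⁻¹' C) := fun s =>
      (measurable_stepPath.comp measurable_prodMk_left) hC
    rw [Measure.bind_apply (hA.prod hC) Measurable.of_discrete.aemeasurable,
      joining_apply_prod μ η hA hC, lintegral_walkLaw
        (Φ := fun ω => C.indicator 1 ω * limitKernel μ η ω A) _ ((measurable_one.indicator hC).mul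
        ((limitKernel μ η).measurable_coe hA))]
    refine lintegral_congr_ae ?_
    filter_upwards [limitKernel_stepPath h hA] with s hs
    rw [Measure.map_apply (measurable_stepPair s) (hA.prod hC)]
    have : (fun p : X × (ℕ → G) => (s • p.1, stepPath s p.2)) ⁻¹' (A ×ˢ C)
      = ((s • ·) ⁻¹' A) ×ˢ (stepPath s ⁻¹' C) := rfl
    rw [this, joining_apply_prod μ η (measurable_const_smul s hA) (hstep s)]
    refine lintegral_congr_ae ?_
    filter_upwards [hs] with ω hω
    rw [hω]
    rfl
  intro Φ hΦ
  conv_lhs => rw [hJ]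
  rw [Measure.lintegral_bind Measurable.of_discrete.aemeasurable hΦ.aemeasurable]
  exact lintegral_congr fun s => lintegral_map hΦ (measurable_stepPair s)

theorem fst_joining (h : IsStationary μ η) : (joining μ η).fst = η := by
  ext A hA
  rw [Measure.fst_apply hA, ← Set.prod_univ, joining_apply_prod μ η hA MeasurableSet.univ]
  simp only [Set.indicator_univ, Pi.one_apply, one_mul]
  rw [← (convergesSetwise_translateKernel h).lintegral_upperLimit hA]
  refine lintegral_congr_ae ?_
  filter_upwards [limitKernel_spec h A hA] with ω hω
  exact hω.limsup_eq.symm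

/-- The conditional law of the trajectory given the point. -/
noncomputable def pathKernel (μ : Measure G) [IsProbabilityMeasure μ] (η : Measure X)
    [IsProbabilityMeasure η] : Kernel X (ℕ → G) :=
  condDistrib Prod.snd Prod.fst (joining μ η)

instance : IsMarkovKernel (pathKernel μ η) := by unfold pathKernel; infer_instance

theorem joining_eq_compProd (h : IsStationary μ η) : joining μ η = η ⊗ₘ pathKernel μ η := by
  have := compProd_map_condDistrib (mβ := ‹_›) (μ := joining μ η) (X := Prod.fst) (Y := Prod.snd)
    measurable_snd.aemeasurable
  have h1 : (joining μ η).map Prod.fst = η := fst_joining h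
  rw [h1] at this
  simpa [pathKernel] using this.symm

end Joining

/-! ### Measure preserving extensions: the walk over `x` depends only on `π x`. -/

section Extension

variable {G : Type*} [Group G] [Countable G] [MeasurableSpace G] [DiscreteMeasurableSpace G]
  {X : Type*} [MeasurableSpace X] [StandardBorelSpace X] [Nonempty X]
  [MulAction G X] [MeasurableConstSMul G X]
  {Y : Type*} [MeasurableSpace Y] [StandardBorelSpace Y] [Nonempty Y]
  [MulAction G Y] [MeasurableConstSMul G Y]
  {μ : Measure G} [IsProbabilityMeasure μ] {η : Measure X} [IsProbabilityMeasure η]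
  {ν : Measure Y} [IsProbabilityMeasure ν] {π : X → Y}

/-- Both sides choose `y` in the base, then `x` in the fiber and a trajectory, independently given
`y`. Only the order of the last two integrations differs. -/
theorem lintegral_compProd_comap_pathKernel (hν : IsStationary μ ν)
    (hπ : MeasurePreserving π η ν) {Φ : X × (ℕ → G) → ℝ≥0∞} (hΦ : Measurable Φ) :
    ∫⁻ p, Φ p ∂(η ⊗ₘ (pathKernel μ ν).comap π hπ.measurable)
      = ∫⁻ p, ∫⁻ x, Φ (x, p.2) ∂condDistrib id π η p.1 ∂joining μ ν := by
  have hD : ν ⊗ₘ condDistrib id π η = η.map fun x => (π x, x) := by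
    have := compProd_map_condDistrib (mβ := ‹_›) (μ := η) (X := π) (Y := id) aemeasurable_id
    rwa [hπ.map_eq] at this
  have hpair : Measurable fun x : X => (π x, x) := hπ.measurable.prodMk measurable_id
  have hF : Measurable fun q : Y × X => ∫⁻ ω, Φ (q.2, ω) ∂pathKernel μ ν q.1 := by
    have : Measurable fun q : (Y × X) × (ℕ → G) => Φ (q.1.2, q.2) := by fun_prop
    exact this.lintegral_kernel_prod_right' (κ := (pathKernel μ ν).comap Prod.fst measurable_fst)
  have hK : Measurable fun q : Y × (ℕ → G) => ∫⁻ x, Φ (x, q.2) ∂condDistrib id π η q.1 := by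
    have : Measurable fun q : (Y × (ℕ → G)) × X => Φ (q.2, q.1.2) := by fun_prop
    exact this.lintegral_kernel_prod_right'
      (κ := (condDistrib id π η).comap Prod.fst measurable_fst)
  rw [Measure.lintegral_compProd hΦ, joining_eq_compProd hν, Measure.lintegral_compProd hK]
  simp only [Kernel.comap_apply]
  rw [← lintegral_map (f := fun q : Y × X => ∫⁻ ω, Φ (q.2, ω) ∂pathKernel μ ν q.1) hF hpair, ← hD,
    Measure.lintegral_compProd hF]
  refine lintegral_congr fun y => ?_
  exact lintegral_lintegral_swap (μ := condDistrib id π η y) (ν := pathKernel μ ν y)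
    (f := fun x ω => Φ (x, ω)) hΦ.aemeasurable

/-- For a measure preserving extension, the trajectory depends on the point only through its image
in the base. -/
theorem IsStandardSystem.joining_eq (h : IsStandardSystem μ η ν π) :
    joining μ η = η ⊗ₘ (pathKernel μ ν).comap π h.measurePreserving.measurable := by
  have hν := h.boundary.stationary
  -- The candidate measure has the correct projection, and it is step invariant because the base
  -- joining is and the disintegration is equivariant. Uniqueness of step invariant measures
  -- identifies it with the joining.
  refine (isStepInvariant_joining h.stationary).ext (fun Φ hΦ => ?_) ?_
  · have hK : Measurable fun q : Y × (ℕ → G) => ∫⁻ x, Φ (x, q.2) ∂condDistrib id π η q.1 := by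
      have : Measurable fun q : (Y × (ℕ → G)) × X => Φ (q.2, q.1.2) := by fun_prop
      exact this.lintegral_kernel_prod_right'
        (κ := (condDistrib id π η).comap Prod.fst measurable_fst)
    rw [lintegral_compProd_comap_pathKernel hν h.measurePreserving hΦ,
      isStepInvariant_joining hν _ hK]
    refine lintegral_congr fun s => ?_
    rw [lintegral_compProd_comap_pathKernel (Φ := fun p => Φ (s • p.1, stepPath s p.2)) hν
      h.measurePreserving (hΦ.comp (measurable_stepPair s))]
    have hfst := fst_joining hν
    have hae : ∀ᵐ p ∂joining μ ν, (condDistrib id π η p.1).map (s • ·)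
        = condDistrib id π η (s • p.1) := by
      have := h.disintegration s
      rw [← hfst] at this
      exact ae_of_ae_map measurable_fst.aemeasurable this
    refine lintegral_congr_ae ?_
    filter_upwards [hae] with p hp
    rw [← hp]
    exact lintegral_map (f := fun x => Φ (x, stepPath s p.2)) (hΦ.comp measurable_prodMk_right)
      (measurable_const_smul s)
  · rw [fst_joining h.stationary, Measure.fst_compProd]

theorem IsStandardSystem.pathKernel_ae_eq (h : IsStandardSystem μ η ν π) :
    ∀ᵐ x ∂η, pathKernel μ η x = pathKernel μ ν (π x) := by
  have h1 : (joining μ η).map Prod.fst = η := fst_joining h.stationary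
  have := condDistrib_ae_eq_of_measure_eq_compProd (μ := joining μ η) (Y := Prod.snd)
    (X := Prod.fst) (κ := (pathKernel μ ν).comap π h.measurePreserving.measurable)
    measurable_snd.aemeasurable (by rw [h1, ← h.joining_eq]; simp)
  rw [h1] at this
  exact this

end Extension

/-! ### Right cosets and densities on them. -/

section Coset

variable {G : Type*} [Group G]

theorem mem_rightCoset_self (H : Subgroup G) (h : G) : h ∈ rightCoset H h := by
  simp [rightCoset, H.one_mem]

theorem rightCoset_mul_left {H : Subgroup G} {l : G} (hl : l ∈ H) (h : G) :
    rightCoset H (l * h) = rightCoset H h := by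
  ext k
  simp only [rightCoset, Set.mem_ofPred_eq, mul_inv_rev, ← mul_assoc]
  exact H.mul_mem_cancel_right (H.inv_mem hl)

theorem rightCoset_eq_of_mem {H : Subgroup G} {h k : G} (hk : k ∈ rightCoset H h) :
    rightCoset H k = rightCoset H h := by
  have := rightCoset_mul_left hk h
  rwa [inv_mul_cancel_right] at this

variable [MeasurableSpace G] [Countable G] [DiscreteMeasurableSpace G]

/-- A measure dominated by `m` has, on functions invariant under left translations by `H`, the
density `m' (H h) / m (H h)` with respect to `m`. -/
theorem lintegral_div_rightCoset (H : Subgroup G) {m m' : Measure G} [IsFiniteMeasure m]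
    (hle : m' ≤ m) {F : G → ℝ≥0∞} (hF : ∀ l ∈ H, ∀ h, F (l * h) = F h) :
    ∫⁻ h, m' (rightCoset H h) / m (rightCoset H h) * F h ∂m = ∫⁻ h, F h ∂m' := by
  let q : G → Quotient (QuotientGroup.rightRel H) := Quotient.mk _
  let _ : MeasurableSpace (Quotient (QuotientGroup.rightRel H)) := ⊤
  have hrel : ∀ a b : G, q a = q b ↔ b * a⁻¹ ∈ H := fun a b =>
    Quotient.eq.trans QuotientGroup.rightRel_apply
  have hfib : ∀ h, q ⁻¹' {q h} = rightCoset H h := fun h => by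
    ext k
    rw [Set.mem_preimage, Set.mem_singleton_iff, eq_comm, hrel]
    rfl
  obtain ⟨Fb, hFb⟩ : ∃ Fb : Quotient (QuotientGroup.rightRel H) → ℝ≥0∞, ∀ h, Fb (q h) = F h := by
    refine ⟨Quotient.lift F fun a b hab => ?_, fun h => rfl⟩
    have := hF _ ((hrel a b).1 (Quotient.sound hab)) a
    rwa [inv_mul_cancel_right, eq_comm] at this
  have hq : Measurable q := Measurable.of_discrete
  simp only [← hFb, ← hfib]
  rw [← lintegral_map (f := fun d => m' (q ⁻¹' {d}) / m (q ⁻¹' {d}) * Fb d) (g := q)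
    Measurable.of_discrete hq, ← lintegral_map (f := Fb) (g := q) Measurable.of_discrete hq,
    lintegral_countable', lintegral_countable']
  refine tsum_congr fun d => ?_
  rw [Measure.map_apply hq (measurableSet_singleton d),
    Measure.map_apply hq (measurableSet_singleton d)]
  have h1 : m (q ⁻¹' {d}) ≠ ∞ := measure_ne_top _ _
  -- A coset that is null for `m` is null for `m'`, so the value given to `0 / 0` is immaterial.
  by_cases h0 : m (q ⁻¹' {d}) = 0
  · simp [h0, le_antisymm ((hle _).trans h0.le) zero_le]
  · rw [mul_right_comm, ENNReal.div_mul_cancel h0 h1, mul_comm]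

end Coset

/-! ### Positions at random times and the posterior of the first step. -/

section Positions

variable {G : Type*} [MeasurableSpace G] [Countable G] [DiscreteMeasurableSpace G]
variable {X : Type*} [MeasurableSpace X]

theorem measurable_eval_nat : Measurable fun q : ℕ × (ℕ → G) => q.2 q.1 :=
  measurable_from_prod_countable_right fun n => measurable_pi_apply n

/-- The law of the position at an independent random time with law `b`. -/
noncomputable def posLaw (Q : Kernel X (ℕ → G)) (b : Measure ℕ) : Kernel X G :=
  (Kernel.const X b ×ₖ Q).map fun q : ℕ × (ℕ → G) => q.2 q.1

theorem measurableSet_first (g : G) : MeasurableSet {ω : ℕ → G | ω 1 = g} :=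
  (measurableSet_singleton g).preimage (measurable_pi_apply 1)

/-- The law of the position at time `1 + τ`, with `τ` of law `b`, on the event that the first
step is `g`. -/
noncomputable def firstPosLaw (Q : Kernel X (ℕ → G)) (b : Measure ℕ) (g : G) : Kernel X G :=
  (Kernel.const X b ×ₖ Q.restrict (measurableSet_first g)).map
    fun q : ℕ × (ℕ → G) => q.2 (q.1 + 1)

/-- The translate of a law on `ℕ` by `1`. -/
noncomputable def succLaw (b : Measure ℕ) : Measure ℕ := b.map (· + 1)

instance (b : Measure ℕ) [IsProbabilityMeasure b] : IsProbabilityMeasure (succLaw b) :=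
  Measure.isProbabilityMeasure_map Measurable.of_discrete.aemeasurable

theorem lintegral_succLaw (b : Measure ℕ) (f : ℕ → ℝ≥0∞) :
    ∫⁻ j, f j ∂succLaw b = ∫⁻ j, f (j + 1) ∂b :=
  lintegral_map Measurable.of_discrete Measurable.of_discrete

variable (Q : Kernel X (ℕ → G)) [IsMarkovKernel Q] (b : Measure ℕ) [IsProbabilityMeasure b]

instance : IsMarkovKernel (posLaw Q b) := by
  unfold posLaw; exact Kernel.IsMarkovKernel.map _ measurable_eval_nat

theorem measurable_eval_succ : Measurable fun q : ℕ × (ℕ → G) => q.2 (q.1 + 1) :=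
  measurable_from_prod_countable_right fun n => measurable_pi_apply (n + 1)

theorem lintegral_posLaw (x : X) (F : G → ℝ≥0∞) :
    ∫⁻ h, F h ∂posLaw Q b x = ∫⁻ j, ∫⁻ ω, F (ω j) ∂Q x ∂b := by
  have hF : Measurable F := Measurable.of_discrete
  rw [posLaw, Kernel.map_apply _ measurable_eval_nat, lintegral_map hF measurable_eval_nat,
    Kernel.prod_apply, Kernel.const_apply, lintegral_prod]
  exact (hF.comp measurable_eval_nat).aemeasurable

theorem lintegral_firstPosLaw (g : G) (x : X) (F : G → ℝ≥0∞) :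
    ∫⁻ h, F h ∂firstPosLaw Q b g x = ∫⁻ j, ∫⁻ ω in {ω | ω 1 = g}, F (ω (j + 1)) ∂Q x ∂b := by
  have hF : Measurable F := Measurable.of_discrete
  rw [firstPosLaw, Kernel.map_apply _ measurable_eval_succ, lintegral_map hF measurable_eval_succ,
    Kernel.prod_apply, Kernel.const_apply, Kernel.restrict_apply, lintegral_prod]
  exact (hF.comp measurable_eval_succ).aemeasurable

theorem lintegral_posLaw_succLaw (x : X) (F : G → ℝ≥0∞) :
    ∫⁻ h, F h ∂posLaw Q (succLaw b) x = ∫⁻ j, ∫⁻ ω, F (ω (j + 1)) ∂Q x ∂b := by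
  rw [lintegral_posLaw, lintegral_succLaw]

theorem firstPosLaw_le (g : G) (x : X) : firstPosLaw Q b g x ≤ posLaw Q (succLaw b) x := by
  refine Measure.le_iff.2 fun s hs => ?_
  rw [← lintegral_indicator_one hs, ← lintegral_indicator_one hs, lintegral_firstPosLaw,
    lintegral_posLaw_succLaw]
  exact lintegral_mono fun j => setLIntegral_le_lintegral _ _

/-- The conditional probability that the first step is `g`, given the point `x` and that the
position at time `1 + τ` lies in `c`. -/
noncomputable def posterior (g : G) (x : X) (c : Set G) : ℝ≥0∞ :=
  firstPosLaw Q b g x c / posLaw Q (succLaw b) x c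

theorem posterior_le_one (g : G) (x : X) (c : Set G) : posterior Q b g x c ≤ 1 :=
  ENNReal.div_le_of_le_mul (by simpa using firstPosLaw_le Q b g x c)

theorem posterior_mul (g : G) (x : X) (c : Set G) :
    posterior Q b g x c * posLaw Q (succLaw b) x c = firstPosLaw Q b g x c := by
  by_cases h0 : posLaw Q (succLaw b) x c = 0
  · rw [h0, mul_zero, le_antisymm ((firstPosLaw_le Q b g x c).trans h0.le) zero_le]
  · exact ENNReal.div_mul_cancel h0 (measure_ne_top _ _)

/-- The set has to vary together with the point because the coset `L_x h` does. On a countable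
group, the mass of a set is a countable sum of indicators. -/
theorem measurable_kernel_prod_set (κ : Kernel X G) :
    Measurable fun p : X × Set G => κ p.1 p.2 := by
  have h : ∀ p : X × Set G, κ p.1 p.2
      = ∑' h, ({p : X × Set G | h ∈ p.2}).indicator (fun p => κ p.1 {h}) p := fun p => by
    rw [← Measure.tsum_indicator_apply_singleton _ _ MeasurableSet.of_discrete]
    rfl
  simp only [h]
  refine Measurable.tsum fun h => ?_
  refine Measurable.indicator ((κ.measurable_coe (measurableSet_singleton h)).comp measurable_fst) ?_
  exact measurableSet_setOfPred.2 ((measurable_set_mem h).comp measurable_snd)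

theorem measurable_posterior (g : G) : Measurable fun p : X × Set G => posterior Q b g p.1 p.2 :=
  (measurable_kernel_prod_set _).div (measurable_kernel_prod_set _)

end Positions

/-! ### The Markov property of step invariant measures. -/

section Markov

variable {G : Type*} [Group G] [Countable G] [MeasurableSpace G] [DiscreteMeasurableSpace G]
variable {X : Type*} [MeasurableSpace X] [MulAction G X] [MeasurableConstSMul G X]

theorem IsStepInvariant.ae_zero {μ : Measure G} {J : Measure (X × (ℕ → G))}
    (h : IsStepInvariant μ J) : ∀ᵐ p ∂J, p.2 0 = 1 := by
  have hm : MeasurableSet {p : X × (ℕ → G) | p.2 0 = 1}ᶜ :=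
    ((measurableSet_singleton (1 : G)).preimage
      ((measurable_pi_apply 0).comp measurable_snd)).compl
  rw [ae_iff, ← Set.compl_ofPred, ← lintegral_indicator_one hm, h _ (measurable_one.indicator hm)]
  simp

/-- The law of the position of the walk at time `n`. -/
noncomputable def stepProb (μ : Measure G) : ℕ → G → ℝ≥0∞
  | 0, h => ({1} : Set G).indicator 1 h
  | n + 1, h => ∫⁻ s, stepProb μ n (s⁻¹ * h) ∂μ

theorem measurableSet_pos (n : ℕ) (h : G) : MeasurableSet {p : X × (ℕ → G) | p.2 n = h} :=
  (measurableSet_singleton h).preimage ((measurable_pi_apply n).comp measurable_snd)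

theorem measurable_future (n : ℕ) :
    Measurable fun p : X × (ℕ → G) => (p.1, fun m => p.2 (n + m)) :=
  measurable_fst.prodMk
    (measurable_pi_lambda _ fun m => (measurable_pi_apply (n + m)).comp measurable_snd)

theorem measurable_translate (h : G) :
    Measurable fun p : X × (ℕ → G) => (h • p.1, fun m => h * p.2 m) :=
  (measurable_fst.const_smul h).prodMk (measurable_pi_lambda _ fun m =>
    (Measurable.of_discrete (f := fun k : G => h * k)).comp
      ((measurable_pi_apply m).comp measurable_snd))

/-- The Markov property at time `n`. -/
theorem IsStepInvariant.setLIntegral_pos {μ : Measure G} {J : Measure (X × (ℕ → G))}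
    (hJ : IsStepInvariant μ J) (n : ℕ) (h : G) {Ψ : X × (ℕ → G) → ℝ≥0∞} (hΨ : Measurable Ψ) :
    ∫⁻ p in {p | p.2 n = h}, Ψ (p.1, fun m => p.2 (n + m)) ∂J
      = stepProb μ n h * ∫⁻ p, Ψ (h • p.1, fun m => h * p.2 m) ∂J := by
  induction n generalizing h Ψ with
  | zero =>
    rw [← lintegral_indicator (measurableSet_pos 0 h)]
    by_cases h1 : h = 1
    · subst h1
      simp only [stepProb, Set.mem_singleton, Set.indicator_of_mem, Pi.one_apply, one_mul, one_smul]
      refine lintegral_congr_ae ?_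
      filter_upwards [hJ.ae_zero] with p hp
      rw [Set.indicator_of_mem (show p ∈ {p : X × (ℕ → G) | p.2 0 = 1} from hp)]
      simp
    · have h2 : stepProb μ 0 h = 0 := by simp [stepProb, h1]
      rw [h2, zero_mul]
      refine (lintegral_congr_ae ?_).trans lintegral_zero
      filter_upwards [hJ.ae_zero] with p hp
      refine Set.indicator_of_notMem (fun hc => h1 ?_) _
      rw [← hp]; exact hc.symm
  | succ n ih =>
    have hfm : Measurable fun p : X × (ℕ → G) => Ψ (p.1, fun m => p.2 (n + 1 + m)) :=
      hΨ.comp (measurable_future (n + 1))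
    rw [← lintegral_indicator (measurableSet_pos (n + 1) h),
      hJ _ (hfm.indicator (measurableSet_pos (n + 1) h)), stepProb, ← lintegral_mul_const _ Measurable.of_discrete]
    refine lintegral_congr fun s => ?_
    have := ih (s⁻¹ * h) (Ψ := fun p => Ψ (s • p.1, fun m => s * p.2 m))
      (hΨ.comp (measurable_translate s))
    simp only [← mul_smul, ← mul_assoc, mul_inv_cancel, one_mul] at this
    rw [← this, ← lintegral_indicator (measurableSet_pos n _)]
    refine lintegral_congr fun p => ?_
    have hiff : (s • p.1, stepPath s p.2) ∈ {p : X × (ℕ → G) | p.2 (n + 1) = h}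
        ↔ p ∈ {p : X × (ℕ → G) | p.2 n = s⁻¹ * h} := by
      simp [eq_inv_mul_iff_mul_eq]
    have hfut : (fun m => stepPath s p.2 (n + 1 + m)) = fun m => s * p.2 (n + m) := by
      funext m
      rw [add_right_comm, stepPath_succ]
    by_cases hp : p ∈ {p : X × (ℕ → G) | p.2 n = s⁻¹ * h}
    · rw [Set.indicator_of_mem hp, Set.indicator_of_mem (hiff.2 hp), hfut]
    · rw [Set.indicator_of_notMem hp, Set.indicator_of_notMem (mt hiff.1 hp)]

theorem measurableSet_firstStep (g : G) : MeasurableSet {p : X × (ℕ → G) | p.2 1 = g} :=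
  measurableSet_pos 1 g

/-- The decomposition according to the first step. -/
theorem IsStepInvariant.setLIntegral_first {μ : Measure G} {J : Measure (X × (ℕ → G))}
    (hJ : IsStepInvariant μ J) (g : G) {Ψ : X × (ℕ → G) → ℝ≥0∞} (hΨ : Measurable Ψ) :
    ∫⁻ p in {p | p.2 1 = g}, Ψ p ∂J
      = μ {g} * ∫⁻ p, Ψ (g • p.1, stepPath g p.2) ∂J := by
  rw [← lintegral_indicator (measurableSet_firstStep g),
    hJ _ (hΨ.indicator (measurableSet_firstStep g)),
    lintegral_countable', tsum_eq_single g]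
  · rw [mul_comm]
    congr 1
    refine lintegral_congr_ae ?_
    filter_upwards [hJ.ae_zero] with p hp
    exact Set.indicator_of_mem (by simp [hp]) _
  · intro s hs
    rw [mul_eq_zero]
    left
    refine (lintegral_congr_ae ?_).trans lintegral_zero
    filter_upwards [hJ.ae_zero] with p hp
    refine Set.indicator_of_notMem (fun hc => hs ?_) _
    simpa [hp] using hc

/-- The Markov property after the first step. -/
theorem IsStepInvariant.setLIntegral_first_pos {μ : Measure G} {J : Measure (X × (ℕ → G))}
    (hJ : IsStepInvariant μ J) (g : G) (n : ℕ) (h : G) {Ψ : X × (ℕ → G) → ℝ≥0∞}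
    (hΨ : Measurable Ψ) :
    ∫⁻ p in {p | p.2 1 = g} ∩ {p | p.2 (n + 1) = h}, Ψ (p.1, fun m => p.2 (n + 1 + m)) ∂J
      = μ {g} * stepProb μ n (g⁻¹ * h) * ∫⁻ p, Ψ (h • p.1, fun m => h * p.2 m) ∂J := by
  have hfm : Measurable fun p : X × (ℕ → G) => Ψ (p.1, fun m => p.2 (n + 1 + m)) :=
    hΨ.comp (measurable_future (n + 1))
  rw [Set.inter_comm, ← Measure.restrict_restrict (measurableSet_pos (n + 1) h),
    ← lintegral_indicator (measurableSet_pos (n + 1) h), hJ.setLIntegral_first g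
      (hfm.indicator (measurableSet_pos (n + 1) h)), mul_assoc]
  congr 1
  have := hJ.setLIntegral_pos n (g⁻¹ * h) (Ψ := fun p => Ψ (g • p.1, fun m => g * p.2 m))
    (hΨ.comp (measurable_translate g))
  simp only [← mul_smul, ← mul_assoc, mul_inv_cancel, one_mul] at this
  rw [← this, ← lintegral_indicator (measurableSet_pos n _)]
  refine lintegral_congr fun p => ?_
  have hiff : (g • p.1, stepPath g p.2) ∈ {p : X × (ℕ → G) | p.2 (n + 1) = h}
      ↔ p ∈ {p : X × (ℕ → G) | p.2 n = g⁻¹ * h} := by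
    simp [eq_inv_mul_iff_mul_eq]
  have hfut : (fun m => stepPath g p.2 (n + 1 + m)) = fun m => g * p.2 (n + m) := by
    funext m
    rw [add_right_comm, stepPath_succ]
  by_cases hp : p ∈ {p : X × (ℕ → G) | p.2 n = g⁻¹ * h}
  · rw [Set.indicator_of_mem hp, Set.indicator_of_mem (hiff.2 hp)]
    exact congrArg (fun f => Ψ (g • p.1, f)) hfut
  · rw [Set.indicator_of_notMem hp, Set.indicator_of_notMem (mt hiff.1 hp)]

end Markov

/-! ### The Markov property of coset trajectories over a point. -/

section FiberWalk

variable {G : Type*} [Group G] [Countable G] [MeasurableSpace G] [DiscreteMeasurableSpace G]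
variable {X : Type*} [MeasurableSpace X] [MulAction G X] [MeasurableConstSMul G X]

/-- The laws `Q x` of trajectories over the points `x` are compatible with the random walk, and
are invariant under the groups `L_x` in such a way that the coset trajectories form, over every
point, a Markov chain. -/
structure IsFiberWalk (μ : Measure G) (η : Measure X) (L : SubgroupMap G X)
    (Q : Kernel X (ℕ → G)) : Prop where
  step : IsStepInvariant μ (η ⊗ₘ Q)
  invariant : ∀ (x : X) (l h : G), l ∈ L.toFun x → Q (h⁻¹ • l⁻¹ • x) = Q (h⁻¹ • x)

/-- The coset trajectory from time `n` on. -/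
def futureCosets (L : SubgroupMap G X) (n : ℕ) (p : X × (ℕ → G)) : CosetPath L :=
  toCosetPath L (p.1, fun m => p.2 (n + m))

theorem measurable_futureCosets (L : SubgroupMap G X) (n : ℕ) :
    Measurable (futureCosets L n) :=
  (measurable_toCosetPath L).comp (measurable_future n)

/-- The expectation of a function of the coset trajectory started at `L_x h` in the fiber
over `x`. -/
noncomputable def cosetExpectation (L : SubgroupMap G X) (Q : Kernel X (ℕ → G))
    (Ψ : CosetPath L → ℝ≥0∞) (x : X) (h : G) : ℝ≥0∞ :=
  ∫⁻ ω, Ψ (toCosetPath L (x, fun m => h * ω m)) ∂Q (h⁻¹ • x)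

theorem measurable_cosetExpectation (L : SubgroupMap G X) (Q : Kernel X (ℕ → G)) [IsMarkovKernel Q]
    {Ψ : CosetPath L → ℝ≥0∞} (hΨ : Measurable Ψ) (h : G) :
    Measurable fun x => cosetExpectation L Q Ψ x h := by
  have h1 : Measurable fun p : X × (ℕ → G) => Ψ (toCosetPath L (p.1, fun m => h * p.2 m)) := by
    refine hΨ.comp ((measurable_toCosetPath L).comp (measurable_fst.prodMk
      (measurable_pi_lambda _ fun m => ?_)))
    exact (Measurable.of_discrete (f := fun k : G => h * k)).comp
      ((measurable_pi_apply m).comp measurable_snd)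
  exact h1.lintegral_kernel_prod_right' (κ := Q.comap (h⁻¹ • ·) (measurable_const_smul h⁻¹))

theorem measurable_cosetAt (L : SubgroupMap G X) (h : G) :
    Measurable fun x => rightCoset (L.toFun x) h := by
  have := (measurable_rightCoset L 0).comp
    (measurable_id.prodMk (measurable_const (a := fun _ : ℕ => h)))
  exact this

theorem lintegral_nat_swap (b : Measure ℕ) [SFinite b] (η : Measure X) [SFinite η]
    {f : ℕ → X → ℝ≥0∞} (hf : ∀ j, Measurable (f j)) :
    ∫⁻ j, ∫⁻ x, f j x ∂η ∂b = ∫⁻ x, ∫⁻ j, f j x ∂b ∂η :=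
  lintegral_lintegral_swap (measurable_from_prod_countable_right hf).aemeasurable

theorem measurable_eval_pair {f : X → G → ℝ≥0∞} (hf : ∀ h, Measurable fun x => f x h) (j : ℕ) :
    Measurable fun p : X × (ℕ → G) => f p.1 (p.2 j) := by
  have h1 : Measurable fun q : X × G => f q.1 q.2 := measurable_from_prod_countable_left hf
  exact h1.comp (measurable_fst.prodMk ((measurable_pi_apply j).comp measurable_snd))

variable {μ : Measure G} {η : Measure X} [IsProbabilityMeasure η] {L : SubgroupMap G X}
  {Q : Kernel X (ℕ → G)} [IsMarkovKernel Q] (hQ : IsFiberWalk μ η L Q)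

include hQ

/-- The invariance clause of `IsFiberWalk` enters here: the law of the future from position `h`
depends only on the coset `L_x h`, which makes coset trajectories Markovian. -/
theorem IsFiberWalk.cosetExpectation_mul (Ψ : CosetPath L → ℝ≥0∞) (x : X) {l : G}
    (hl : l ∈ L.toFun x) (h : G) :
    cosetExpectation L Q Ψ x (l * h) = cosetExpectation L Q Ψ x h := by
  have h1 : ∀ ω : ℕ → G, toCosetPath L (x, fun m => l * h * ω m)
      = toCosetPath L (x, fun m => h * ω m) := fun ω => by
    refine Subtype.ext (Prod.ext rfl (funext fun m => ?_))
    simp only [toCosetPath, mul_assoc]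
    exact rightCoset_mul_left hl _
  simp only [cosetExpectation, h1, mul_inv_rev, mul_smul]
  rw [hQ.invariant x l h hl]

/-- Decompose by the position `h` at time `j + 1`. By the Markov property the future is then
independent of the first step, and it may be replaced by its expectation given `x` and `h`. -/
theorem IsFiberWalk.setLIntegral_future (g : G) (j : ℕ) {Ψ : CosetPath L → ℝ≥0∞}
    (hΨ : Measurable Ψ) {r : X → G → ℝ≥0∞} (hr : ∀ h, Measurable fun x => r x h) :
    ∫⁻ p in {p | p.2 1 = g}, r p.1 (p.2 (j + 1)) * Ψ (futureCosets L (j + 1) p) ∂(η ⊗ₘ Q)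
      = ∫⁻ p in {p | p.2 1 = g}, r p.1 (p.2 (j + 1)) * cosetExpectation L Q Ψ p.1 (p.2 (j + 1))
        ∂(η ⊗ₘ Q) := by
  have hdec : ∀ f : X × (ℕ → G) → ℝ≥0∞, ∫⁻ p in {p | p.2 1 = g}, f p ∂(η ⊗ₘ Q)
      = ∑' h, ∫⁻ p in {p | p.2 1 = g} ∩ {p | p.2 (j + 1) = h}, f p ∂(η ⊗ₘ Q) := fun f => by
    rw [← lintegral_iUnion (fun h => (measurableSet_firstStep g).inter (measurableSet_pos _ h))]
    · rw [← Set.inter_iUnion]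
      have : ⋃ h : G, {p : X × (ℕ → G) | p.2 (j + 1) = h} = Set.univ := by ext ω; simp
      rw [this, Set.inter_univ]
    · intro h h' hne
      exact Set.disjoint_left.2 fun p hp hp' => hne (hp.2.symm.trans hp'.2)
  rw [hdec, hdec]
  refine tsum_congr fun h => ?_
  have hset := (measurableSet_firstStep (X := X) g).inter (measurableSet_pos (j + 1) h)
  have hm1 : Measurable fun p : X × (ℕ → G) => r p.1 h * Ψ (toCosetPath L p) :=
    ((hr h).comp measurable_fst).mul (hΨ.comp (measurable_toCosetPath L))
  have hm2 : Measurable fun p : X × (ℕ → G) => r p.1 h * cosetExpectation L Q Ψ p.1 h :=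
    ((hr h).comp measurable_fst).mul
      ((measurable_cosetExpectation L Q hΨ h).comp measurable_fst)
  have h1 := hQ.step.setLIntegral_first_pos g j h hm1
  have h2 := hQ.step.setLIntegral_first_pos g j h hm2
  have h3 : ∫⁻ p in {p | p.2 1 = g} ∩ {p | p.2 (j + 1) = h},
      r p.1 (p.2 (j + 1)) * cosetExpectation L Q Ψ p.1 (p.2 (j + 1)) ∂(η ⊗ₘ Q)
      = ∫⁻ p in {p | p.2 1 = g} ∩ {p | p.2 (j + 1) = h},
        r p.1 h * cosetExpectation L Q Ψ p.1 h ∂(η ⊗ₘ Q) :=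
    setLIntegral_congr_fun hset fun p hp => by rw [hp.2]
  have h4 : ∫⁻ p in {p | p.2 1 = g} ∩ {p | p.2 (j + 1) = h},
      r p.1 (p.2 (j + 1)) * Ψ (futureCosets L (j + 1) p) ∂(η ⊗ₘ Q)
      = ∫⁻ p in {p | p.2 1 = g} ∩ {p | p.2 (j + 1) = h},
        r p.1 h * Ψ (futureCosets L (j + 1) p) ∂(η ⊗ₘ Q) :=
    setLIntegral_congr_fun hset fun p hp => by rw [hp.2]
  rw [h3, h4]
  refine h1.trans (Eq.trans ?_ h2.symm)
  congr 1
  rw [Measure.lintegral_compProd (f := fun p : X × (ℕ → G) =>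
      r (h • p.1) h * Ψ (toCosetPath L (h • p.1, fun m => h * p.2 m)))
      (hm1.comp (measurable_translate h)),
    Measure.lintegral_compProd (f := fun p : X × (ℕ → G) =>
      r (h • p.1) h * cosetExpectation L Q Ψ (h • p.1) h) (hm2.comp (measurable_translate h))]
  refine lintegral_congr fun x => ?_
  have hm3 : Measurable fun ω : ℕ → G => Ψ (toCosetPath L (h • x, fun m => h * ω m)) :=
    hΨ.comp ((measurable_toCosetPath L).comp
      ((measurable_translate h).comp measurable_prodMk_left))
  simp [cosetExpectation, lintegral_const_mul _ hm3]

theorem IsFiberWalk.lintegral_future (j : ℕ) {Ψ : CosetPath L → ℝ≥0∞} (hΨ : Measurable Ψ)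
    {r : X → G → ℝ≥0∞} (hr : ∀ h, Measurable fun x => r x h) :
    ∫⁻ p, r p.1 (p.2 (j + 1)) * Ψ (futureCosets L (j + 1) p) ∂(η ⊗ₘ Q)
      = ∫⁻ p, r p.1 (p.2 (j + 1)) * cosetExpectation L Q Ψ p.1 (p.2 (j + 1)) ∂(η ⊗ₘ Q) := by
  have hdec : ∀ f : X × (ℕ → G) → ℝ≥0∞, ∫⁻ p, f p ∂(η ⊗ₘ Q)
      = ∑' g, ∫⁻ p in {p | p.2 1 = g}, f p ∂(η ⊗ₘ Q) := fun f => by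
    rw [← lintegral_iUnion (fun h => measurableSet_firstStep h)]
    · have : ⋃ h : G, {p : X × (ℕ → G) | p.2 1 = h} = Set.univ := by ext ω; simp
      rw [this, Measure.restrict_univ]
    · intro h h' hne
      exact Set.disjoint_left.2 fun p hp hp' => hne (hp.symm.trans hp')
  rw [hdec, hdec]
  exact tsum_congr fun g => hQ.setLIntegral_future g j hΨ hr

/-- The posterior probability of the first step given the coset at time `1 + τ` is also the
conditional probability given the whole coset trajectory after time `1 + τ`. -/
theorem IsFiberWalk.lintegral_posterior (b : Measure ℕ) [IsProbabilityMeasure b] (g : G)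
    {Ψ : CosetPath L → ℝ≥0∞} (hΨ : Measurable Ψ) :
    ∫⁻ j, ∫⁻ p, posterior Q b g p.1 (rightCoset (L.toFun p.1) (p.2 (j + 1)))
        * Ψ (futureCosets L (j + 1) p) ∂(η ⊗ₘ Q) ∂b
      = ∫⁻ j, ∫⁻ p in {p | p.2 1 = g}, Ψ (futureCosets L (j + 1) p) ∂(η ⊗ₘ Q) ∂b := by
  set T := cosetExpectation L Q Ψ with hT
  have hTm : ∀ h, Measurable fun x => T x h := measurable_cosetExpectation L Q hΨ
  have hpm : ∀ h, Measurable fun x => posterior Q b g x (rightCoset (L.toFun x) h) := fun h =>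
    (measurable_posterior Q b g).comp (measurable_id.prodMk (measurable_cosetAt L h))
  have hGm := fun {f : X → G → ℝ≥0∞} (hf : ∀ h, Measurable fun x => f x h) (j : ℕ) =>
    measurable_eval_pair hf j
  have h1 : ∀ j, ∫⁻ p, posterior Q b g p.1 (rightCoset (L.toFun p.1) (p.2 (j + 1)))
        * Ψ (futureCosets L (j + 1) p) ∂(η ⊗ₘ Q)
      = ∫⁻ x, ∫⁻ ω, posterior Q b g x (rightCoset (L.toFun x) (ω (j + 1))) * T x (ω (j + 1)) ∂Q x
        ∂η := fun j => by
    rw [hQ.lintegral_future j hΨ hpm, Measure.lintegral_compProd]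
    exact (hGm hpm _).mul (hGm hTm _)
  have h2 : ∀ j, ∫⁻ p in {p | p.2 1 = g}, Ψ (futureCosets L (j + 1) p) ∂(η ⊗ₘ Q)
      = ∫⁻ x, ∫⁻ ω in {ω | ω 1 = g}, T x (ω (j + 1)) ∂Q x ∂η := fun j => by
    have := hQ.setLIntegral_future g j hΨ (r := fun _ _ => 1) (fun _ => measurable_const)
    simp only [one_mul] at this
    rw [this, ← lintegral_indicator (measurableSet_firstStep g), Measure.lintegral_compProd
      ((hGm hTm _).indicator (measurableSet_firstStep g))]
    refine lintegral_congr fun x => ?_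
    rw [← lintegral_indicator (measurableSet_first g)]
    rfl
  have h3 : ∀ j, Measurable fun x =>
      ∫⁻ ω, posterior Q b g x (rightCoset (L.toFun x) (ω (j + 1))) * T x (ω (j + 1)) ∂Q x :=
    fun j => ((hGm hpm (j + 1)).mul (hGm hTm (j + 1))).lintegral_kernel_prod_right'
  have h4 : ∀ j, Measurable fun x => ∫⁻ ω in {ω | ω 1 = g}, T x (ω (j + 1)) ∂Q x := fun j => by
    simp only [← lintegral_indicator (measurableSet_first g)]
    exact ((hGm hTm (j + 1)).indicator (measurableSet_firstStep g)).lintegral_kernel_prod_right'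
  simp only [h1, h2]
  rw [lintegral_nat_swap b η h3, lintegral_nat_swap b η h4]
  refine lintegral_congr fun x => ?_
  -- Over a fixed point everything is an integral over positions in `G`. As `T x` is left invariant
  -- under `L_x`, the ratio of coset masses acts as a density.
  rw [← lintegral_firstPosLaw, ← lintegral_posLaw_succLaw Q b x fun h =>
    posterior Q b g x (rightCoset (L.toFun x) h) * T x h]
  exact lintegral_div_rightCoset (L.toFun x) (firstPosLaw_le Q b g x)
    fun l hl h => hQ.cosetExpectation_mul Ψ x hl h

end FiberWalk

/-! ### Information, Shannon entropy and Gibbs' inequality. -/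

section NegLog

/-- The information `-log t` of an event of probability `t`. -/
noncomputable def nlog (t : ℝ≥0∞) : ℝ≥0∞ :=
  if t = 0 then ∞ else ENNReal.ofReal (-Real.log t.toReal)

theorem measurable_nlog : Measurable nlog :=
  Measurable.ite (measurableSet_singleton 0) measurable_const
    (Real.measurable_log.comp ENNReal.measurable_toReal).neg.ennreal_ofReal

theorem nlog_of_ne_zero {t : ℝ≥0∞} (h : t ≠ 0) :
    nlog t = ENNReal.ofReal (-Real.log t.toReal) := if_neg h

@[simp] theorem nlog_zero : nlog 0 = ∞ := if_pos rfl

@[simp] theorem nlog_one : nlog 1 = 0 := by simp [nlog]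

theorem nlog_mul {a b : ℝ≥0∞} (ha : a ≤ 1) (hb : b ≤ 1) : nlog (a * b) = nlog a + nlog b := by
  by_cases ha0 : a = 0
  · simp [ha0]
  by_cases hb0 : b = 0
  · simp [hb0]
  have hat : a ≠ ∞ := ne_top_of_le_ne_top ENNReal.one_ne_top ha
  have hbt : b ≠ ∞ := ne_top_of_le_ne_top ENNReal.one_ne_top hb
  have h1 : ∀ {c : ℝ≥0∞}, c ≤ 1 → 0 ≤ -Real.log c.toReal := fun {c} hc =>
    neg_nonneg.2 (Real.log_nonpos ENNReal.toReal_nonneg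
      (ENNReal.toReal_mono ENNReal.one_ne_top hc))
  rw [nlog_of_ne_zero (mul_ne_zero ha0 hb0), nlog_of_ne_zero ha0, nlog_of_ne_zero hb0,
    ← ENNReal.ofReal_add (h1 ha) (h1 hb), ENNReal.toReal_mul, Real.log_mul
      (ENNReal.toReal_ne_zero.2 ⟨ha0, hat⟩) (ENNReal.toReal_ne_zero.2 ⟨hb0, hbt⟩), neg_add]

theorem nlog_antitone {a b : ℝ≥0∞} (hab : a ≤ b) (hb : b ≤ 1) : nlog b ≤ nlog a := by
  by_cases ha0 : a = 0
  · simp [ha0]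
  have hb0 : b ≠ 0 := (lt_of_lt_of_le (pos_iff_ne_zero.2 ha0) hab).ne'
  have hbt : b ≠ ∞ := ne_top_of_le_ne_top ENNReal.one_ne_top hb
  rw [nlog_of_ne_zero ha0, nlog_of_ne_zero hb0]
  refine ENNReal.ofReal_le_ofReal (neg_le_neg (Real.log_le_log ?_ (ENNReal.toReal_mono hbt hab)))
  exact ENNReal.toReal_pos ha0 (ne_top_of_le_ne_top hbt hab)

theorem ofReal_negMulLog {t : ℝ≥0∞} (ht : t ≤ 1) :
    ENNReal.ofReal (Real.negMulLog t.toReal) = t * nlog t := by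
  by_cases h0 : t = 0
  · simp [h0]
  have htt : t ≠ ∞ := ne_top_of_le_ne_top ENNReal.one_ne_top ht
  rw [nlog_of_ne_zero h0, Real.negMulLog, neg_mul, ← mul_neg,
    ENNReal.ofReal_mul ENNReal.toReal_nonneg, ENNReal.ofReal_toReal htt]

/-- The termwise form of Gibbs' inequality. -/
theorem mul_nlog_add_le {r t : ℝ≥0∞} (hr : r ≤ 1) (ht : t ≤ 1) :
    r * nlog r + r ≤ r * nlog t + t := by
  by_cases hr0 : r = 0
  · simp [hr0]
  by_cases ht0 : t = 0
  · simp [ht0, ENNReal.mul_top hr0]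
  have hrt : r ≠ ∞ := ne_top_of_le_ne_top ENNReal.one_ne_top hr
  have htt : t ≠ ∞ := ne_top_of_le_ne_top ENNReal.one_ne_top ht
  have h1 : ∀ {c : ℝ≥0∞}, c ≤ 1 → 0 ≤ -Real.log c.toReal := fun {c} hc =>
    neg_nonneg.2 (Real.log_nonpos ENNReal.toReal_nonneg
      (ENNReal.toReal_mono ENNReal.one_ne_top hc))
  have hrpos := ENNReal.toReal_pos hr0 hrt
  have htpos := ENNReal.toReal_pos ht0 htt
  have h2 : r = ENNReal.ofReal r.toReal := (ENNReal.ofReal_toReal hrt).symm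
  have h3 : t = ENNReal.ofReal t.toReal := (ENNReal.ofReal_toReal htt).symm
  rw [nlog_of_ne_zero hr0, nlog_of_ne_zero ht0]
  conv_lhs => rw [h2]
  conv_rhs => rw [h2, h3]
  simp only [ENNReal.toReal_ofReal ENNReal.toReal_nonneg]
  rw [← ENNReal.ofReal_mul hrpos.le, ← ENNReal.ofReal_mul hrpos.le,
    ← ENNReal.ofReal_add (mul_nonneg hrpos.le (h1 hr)) hrpos.le,
    ← ENNReal.ofReal_add (mul_nonneg hrpos.le (h1 ht)) htpos.le]
  refine ENNReal.ofReal_le_ofReal ?_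
  have h4 := Real.log_le_sub_one_of_pos (div_pos htpos hrpos)
  rw [Real.log_div htpos.ne' hrpos.ne'] at h4
  have h5 := mul_le_mul_of_nonneg_left h4 hrpos.le
  rw [mul_sub, mul_sub, mul_one, mul_div_cancel₀ _ hrpos.ne'] at h5
  linarith

/-- Shannon entropy is the expected information. -/
theorem shannonEntropy_eq_lintegral {α : Type*} [MeasurableSpace α] [Countable α]
    [MeasurableSingletonClass α] (m : Measure α) [IsProbabilityMeasure m] :
    shannonEntropy m = ∫⁻ a, nlog (m {a}) ∂m := by
  rw [lintegral_countable', shannonEntropy]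
  exact tsum_congr fun a => by rw [measureReal_def, ofReal_negMulLog prob_le_one, mul_comm]

/-- The target `β` may be uncountable, as for cosets viewed in `Set G`; only countably many fibers
are nonempty, and the sum is regrouped over points of `α`. -/
theorem tsum_measure_fiber_mul {α β : Type*} [MeasurableSpace α] [Countable α]
    [DiscreteMeasurableSpace α] (m : Measure α) (f : α → β) (F : β → ℝ≥0∞) :
    ∑' c, m (f ⁻¹' {c}) * F c = ∫⁻ a, F (f a) ∂m := by
  classical
  have h1 : ∀ c, m (f ⁻¹' {c}) * F c = ∑' a, if f a = c then F c * m {a} else 0 := fun c => by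
    rw [← Measure.tsum_indicator_apply_singleton _ _ MeasurableSet.of_discrete, mul_comm,
      ← ENNReal.tsum_mul_left]
    refine tsum_congr fun a => ?_
    by_cases h : f a = c
    · rw [if_pos h, Set.indicator_of_mem (show a ∈ f ⁻¹' {c} from h)]
    · rw [if_neg h, Set.indicator_of_notMem (show a ∉ f ⁻¹' {c} from h), mul_zero]
  rw [tsum_congr h1, ENNReal.tsum_comm, lintegral_countable']
  refine tsum_congr fun a => ?_
  rw [tsum_eq_single (f a) fun c hc => if_neg (Ne.symm hc), if_pos rfl]

/-- The Shannon entropy of the image of a measure on a countable set. -/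
theorem shannonEntropy_map {α β : Type*} [MeasurableSpace α] [Countable α]
    [DiscreteMeasurableSpace α] [MeasurableSpace β] [MeasurableSingletonClass β] (m : Measure α)
    [IsProbabilityMeasure m] (f : α → β) :
    shannonEntropy (m.map f) = ∫⁻ a, nlog (m (f ⁻¹' {f a})) ∂m := by
  rw [← tsum_measure_fiber_mul m f fun c => nlog (m (f ⁻¹' {c}))]
  refine tsum_congr fun c => ?_
  rw [measureReal_def, Measure.map_apply Measurable.of_discrete (measurableSet_singleton c),
    ofReal_negMulLog prob_le_one]

/-- Gibbs' inequality for the images of two measures. -/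
theorem lintegral_nlog_fiber_le {α β : Type*} [MeasurableSpace α] [Countable α]
    [DiscreteMeasurableSpace α] (m m' : Measure α) [IsProbabilityMeasure m]
    [IsProbabilityMeasure m'] (f : α → β) :
    ∫⁻ a, nlog (m (f ⁻¹' {f a})) ∂m ≤ ∫⁻ a, nlog (m' (f ⁻¹' {f a})) ∂m := by
  have h1 : ∀ (k : Measure α) [IsProbabilityMeasure k], ∑' c, k (f ⁻¹' {c}) = 1 := fun k _ => by
    have := tsum_measure_fiber_mul k f 1
    simpa using this
  have h2 := ENNReal.tsum_le_tsum fun c =>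
    mul_nlog_add_le (prob_le_one (μ := m) (s := f ⁻¹' {c})) (prob_le_one (μ := m') (s := f ⁻¹' {c}))
  rw [ENNReal.tsum_add, ENNReal.tsum_add, h1, h1] at h2
  rw [← tsum_measure_fiber_mul m f fun c => nlog (m (f ⁻¹' {c})),
    ← tsum_measure_fiber_mul m f fun c => nlog (m' (f ⁻¹' {c}))]
  exact ENNReal.le_of_add_le_add_right ENNReal.one_ne_top h2

end NegLog

/-! ### Conditional entropies of the first step and the chain rule. -/

section Entropy

variable {G : Type*} [Group G] [Countable G] [MeasurableSpace G] [DiscreteMeasurableSpace G]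
variable {X : Type*} [MeasurableSpace X] [MulAction G X] [MeasurableConstSMul G X]

/-- The posterior probability of the first step as a function of the coset trajectory after the
random time. -/
noncomputable def posteriorAt (L : SubgroupMap G X) (Q : Kernel X (ℕ → G)) (b : Measure ℕ) (g : G)
    (w : CosetPath L) : ℝ≥0∞ :=
  posterior Q b g w.1.1 (w.1.2 0)

/-- The entropy of the coset of the position at a random time with law `b`, given the point. -/
noncomputable def timeEntropy (η : Measure X) (L : SubgroupMap G X) (Q : Kernel X (ℕ → G))
    (b : Measure ℕ) : ℝ≥0∞ :=
  ∫⁻ j, ∫⁻ p, nlog (posLaw Q b p.1 (rightCoset (L.toFun p.1) (p.2 j))) ∂(η ⊗ₘ Q) ∂b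

/-- The entropy of the first step given the point and the coset of the position at a random time
`1 + τ`, with `τ` of law `b`. -/
noncomputable def stepEntropy (η : Measure X) (L : SubgroupMap G X) (Q : Kernel X (ℕ → G))
    (b : Measure ℕ) : ℝ≥0∞ :=
  ∑' g, ∫⁻ j, ∫⁻ p, posteriorAt L Q b g (futureCosets L (j + 1) p)
    * nlog (posteriorAt L Q b g (futureCosets L (j + 1) p)) ∂(η ⊗ₘ Q) ∂b

/-- The entropy of the first step given the point. -/
noncomputable def baseEntropy (η : Measure X) (Q : Kernel X (ℕ → G)) : ℝ≥0∞ :=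
  ∑' g, ∫⁻ x, Q x {ω | ω 1 = g} * nlog (Q x {ω | ω 1 = g}) ∂η

theorem measurable_posteriorAt (L : SubgroupMap G X) (Q : Kernel X (ℕ → G)) [IsMarkovKernel Q]
    (b : Measure ℕ) [IsProbabilityMeasure b] (g : G) : Measurable (posteriorAt L Q b g) :=
  (measurable_posterior Q b g).comp ((measurable_fst.comp measurable_subtype_coe).prodMk
      ((measurable_pi_apply 0).comp (measurable_snd.comp measurable_subtype_coe)))

theorem posteriorAt_le_one (L : SubgroupMap G X) (Q : Kernel X (ℕ → G)) [IsMarkovKernel Q]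
    (b : Measure ℕ) [IsProbabilityMeasure b] (g : G) (w : CosetPath L) :
    posteriorAt L Q b g w ≤ 1 :=
  posterior_le_one Q b g _ _

theorem measurable_kernel_coset (L : SubgroupMap G X) (κ : Kernel X G) (j : ℕ) :
    Measurable fun p : X × (ℕ → G) => κ p.1 (rightCoset (L.toFun p.1) (p.2 j)) :=
  measurable_eval_pair (f := fun x h => κ x (rightCoset (L.toFun x) h)) (fun h =>
    (measurable_kernel_prod_set κ).comp (measurable_id.prodMk (measurable_cosetAt L h))) j

variable {μ : Measure G} [IsProbabilityMeasure μ] {η : Measure X} [IsProbabilityMeasure η]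
  {L : SubgroupMap G X} {Q : Kernel X (ℕ → G)} [IsMarkovKernel Q] (hQ : IsFiberWalk μ η L Q)

theorem tsum_setLIntegral_firstStep (J : Measure (X × (ℕ → G))) (f : X × (ℕ → G) → ℝ≥0∞) :
    ∑' g, ∫⁻ p in {p | p.2 1 = g}, f p ∂J = ∫⁻ p, f p ∂J := by
  rw [← lintegral_iUnion (fun h => measurableSet_firstStep h)]
  · have : ⋃ h : G, {p : X × (ℕ → G) | p.2 1 = h} = Set.univ := by ext ω; simp
    rw [this, Measure.restrict_univ]
  · intro h h' hne
    exact Set.disjoint_left.2 fun p hp hp' => hne (hp.symm.trans hp')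

include hQ

theorem IsFiberWalk.lintegral_posteriorAt (b : Measure ℕ) [IsProbabilityMeasure b] (g : G)
    {Ψ : CosetPath L → ℝ≥0∞} (hΨ : Measurable Ψ) :
    ∫⁻ j, ∫⁻ p, posteriorAt L Q b g (futureCosets L (j + 1) p)
        * Ψ (futureCosets L (j + 1) p) ∂(η ⊗ₘ Q) ∂b
      = ∫⁻ j, ∫⁻ p in {p | p.2 1 = g}, Ψ (futureCosets L (j + 1) p) ∂(η ⊗ₘ Q) ∂b :=
  hQ.lintegral_posterior b g hΨ

/-- The conditional law of the trajectory given the first step. -/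
theorem IsFiberWalk.restrict_first_ae_eq (g : G) :
    ∀ᵐ x ∂η, (Q x).restrict {ω | ω 1 = g}
      = Q x {ω | ω 1 = g} • (Q (g⁻¹ • x)).map (stepPath g) := by
  have hstepm : Measurable (stepPath g) := measurable_stepPath.comp measurable_prodMk_left
  let κ : Kernel X (ℕ → G) := ⟨fun x => Q x {ω | ω 1 = g} • (Q (g⁻¹ • x)).map (stepPath g), by
    refine Measure.measurable_of_measurable_coe _ fun s hs => ?_
    simp only [Measure.smul_apply, smul_eq_mul, Measure.map_apply hstepm hs]
    exact (Q.measurable_coe (measurableSet_first g)).mul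
      ((Q.measurable_coe (hstepm hs)).comp (measurable_const_smul g⁻¹))⟩
  have hκa : ∀ x s, MeasurableSet s →
      κ x s = Q x {ω | ω 1 = g} * Q (g⁻¹ • x) (stepPath g ⁻¹' s) := fun x s hs => by
    change (Q x {ω | ω 1 = g} • (Q (g⁻¹ • x)).map (stepPath g)) s = _
    rw [Measure.smul_apply, smul_eq_mul, Measure.map_apply hstepm hs]
  have : IsFiniteKernel κ := ⟨1, ENNReal.one_lt_top, fun x => by
    rw [hκa _ _ MeasurableSet.univ]
    exact mul_le_one' prob_le_one prob_le_one⟩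
  -- Both kernels induce the same measure on `X × G^ℕ`, by two applications of the first step
  -- decomposition. Almost everywhere equality of the kernels follows.
  have heq : η ⊗ₘ Q.restrict (measurableSet_first g) = η ⊗ₘ κ := by
    refine Measure.ext_prod fun {A C} hA hC => ?_
    rw [Measure.compProd_apply_prod hA hC, Measure.compProd_apply_prod hA hC]
    have hm1 : Measurable fun p : X × (ℕ → G) => (A ×ˢ C).indicator (1 : X × (ℕ → G) → ℝ≥0∞) p :=
      measurable_one.indicator (hA.prod hC)
    have hm2 : Measurable fun p : X × (ℕ → G) =>
        A.indicator (fun x => Q (g⁻¹ • x) (stepPath g ⁻¹' C)) p.1 :=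
      (((Q.measurable_coe (hstepm hC)).comp (measurable_const_smul g⁻¹)).indicator hA).comp
        measurable_fst
    have h1 := hQ.step.setLIntegral_first g hm1
    have h2 := hQ.step.setLIntegral_first g hm2
    have h3 : ∀ f : X × (ℕ → G) → ℝ≥0∞, Measurable f →
        ∫⁻ p in {p | p.2 1 = g}, f p ∂(η ⊗ₘ Q)
          = ∫⁻ x, ∫⁻ ω in {ω | ω 1 = g}, f (x, ω) ∂Q x ∂η := fun f hf => by
      rw [← lintegral_indicator (measurableSet_firstStep g), Measure.lintegral_compProd
        (hf.indicator (measurableSet_firstStep g))]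
      refine lintegral_congr fun x => ?_
      rw [← lintegral_indicator (measurableSet_first g)]
      rfl
    rw [h3 _ hm1] at h1
    rw [h3 _ hm2] at h2
    rw [Measure.lintegral_compProd (f := fun p : X × (ℕ → G) =>
      (A ×ˢ C).indicator (1 : X × (ℕ → G) → ℝ≥0∞) (g • p.1, stepPath g p.2))
      (hm1.comp (measurable_stepPair g))] at h1
    rw [Measure.lintegral_compProd (f := fun p : X × (ℕ → G) =>
      A.indicator (fun x => Q (g⁻¹ • x) (stepPath g ⁻¹' C)) (g • p.1))
      (hm2.comp (measurable_stepPair g))] at h2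
    rw [← lintegral_indicator hA, ← lintegral_indicator hA]
    have h4 : ∀ x, A.indicator (fun x => Q.restrict (measurableSet_first g) x C) x
        = ∫⁻ ω in {ω | ω 1 = g}, (A ×ˢ C).indicator (1 : X × (ℕ → G) → ℝ≥0∞) (x, ω) ∂Q x := fun x => by
      by_cases hx : x ∈ A
      · rw [Set.indicator_of_mem hx, Kernel.restrict_apply, ← lintegral_indicator_one hC]
        refine lintegral_congr fun ω => ?_
        by_cases hω : ω ∈ C
        · rw [Set.indicator_of_mem hω, Set.indicator_of_mem (Set.mk_mem_prod hx hω)]; rfl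
        · rw [Set.indicator_of_notMem hω, Set.indicator_of_notMem fun h => hω h.2]
      · simp [Set.indicator, hx]
    have h5 : ∀ x, A.indicator (fun x => κ x C) x
        = ∫⁻ ω in {ω | ω 1 = g}, A.indicator (fun x => Q (g⁻¹ • x) (stepPath g ⁻¹' C)) x ∂Q x :=
      fun x => by
        rw [setLIntegral_const, mul_comm]
        by_cases hx : x ∈ A
        · rw [Set.indicator_of_mem hx, Set.indicator_of_mem hx, hκa _ _ hC]
        · simp [Set.indicator, hx]
    rw [lintegral_congr h4, lintegral_congr h5, h1, h2]
    congr 1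
    refine lintegral_congr fun x => ?_
    by_cases hx : g • x ∈ A
    · simp only [lintegral_const, measure_univ, mul_one, Set.indicator_of_mem hx, inv_smul_smul]
      rw [← lintegral_indicator_one (hstepm hC)]
      refine lintegral_congr fun ω => ?_
      by_cases hω : stepPath g ω ∈ C
      · rw [Set.indicator_of_mem (Set.mk_mem_prod hx hω), Set.indicator_of_mem (s := stepPath g ⁻¹' C) hω]; rfl
      · rw [Set.indicator_of_notMem fun h => hω h.2,
          Set.indicator_of_notMem (s := stepPath g ⁻¹' C) hω]
    · simp [Set.indicator, hx]
  filter_upwards [Kernel.ae_eq_of_compProd_eq heq] with x hx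
  exact (Kernel.restrict_apply Q (measurableSet_first g) x).symm.trans hx

/-- Conditionally on a first step `g`, the walk over `x` continues as the translate by `g` of the
walk over `g⁻¹ x`. One null set serves for all `s`. -/
theorem IsFiberWalk.firstPosLaw_ae_eq (b : Measure ℕ) [IsProbabilityMeasure b] (g : G) :
    ∀ᵐ x ∂η, ∀ s : Set G, firstPosLaw Q b g x s
      = Q x {ω | ω 1 = g} * posLaw Q b (g⁻¹ • x) ((g * ·) ⁻¹' s) := by
  have hstepm : Measurable (stepPath g) := measurable_stepPath.comp measurable_prodMk_left
  filter_upwards [hQ.restrict_first_ae_eq g] with x hx s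
  have hs : MeasurableSet s := MeasurableSet.of_discrete
  have hs' : MeasurableSet ((g * ·) ⁻¹' s) := MeasurableSet.of_discrete
  rw [← lintegral_indicator_one hs, ← lintegral_indicator_one hs', lintegral_firstPosLaw,
    lintegral_posLaw, hx]
  simp only [lintegral_smul_measure, smul_eq_mul]
  rw [lintegral_const_mul _ Measurable.of_discrete]
  congr 1
  refine lintegral_congr fun j => ?_
  rw [lintegral_map _ hstepm]
  · rfl
  · exact (Measurable.of_discrete (f := s.indicator (1 : G → ℝ≥0∞))).comp
      (measurable_pi_apply (j + 1))

/-- The chain rule for the joint entropy of the first step and the coset at time `1 + τ`. -/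
theorem IsFiberWalk.stepEntropy_add_timeEntropy (b : Measure ℕ) [IsProbabilityMeasure b] :
    stepEntropy η L Q b + timeEntropy η L Q (succLaw b)
      = baseEntropy η Q + timeEntropy η L Q b := by
  -- The contribution of `g` to the joint entropy of first step and coset. Conditioning on the coset
  -- first yields `hleft`; conditioning on the first step first yields `hright`.
  set M : G → ℝ≥0∞ := fun g => ∫⁻ j, ∫⁻ p in {p | p.2 1 = g},
    nlog (firstPosLaw Q b g p.1 (rightCoset (L.toFun p.1) (p.2 (j + 1)))) ∂(η ⊗ₘ Q) ∂b with hM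
  have hleft : stepEntropy η L Q b + timeEntropy η L Q (succLaw b) = ∑' g, M g := by
    have h1 : timeEntropy η L Q (succLaw b) = ∑' g, ∫⁻ j, ∫⁻ p in {p | p.2 1 = g},
        nlog (posLaw Q (succLaw b) p.1 (rightCoset (L.toFun p.1) (p.2 (j + 1))))
          ∂(η ⊗ₘ Q) ∂b := by
      rw [timeEntropy, lintegral_succLaw, ← lintegral_tsum fun g =>
        Measurable.of_discrete.aemeasurable]
      exact lintegral_congr fun j => (tsum_setLIntegral_firstStep _ _).symm
    rw [h1, stepEntropy, ← ENNReal.tsum_add]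
    refine tsum_congr fun g => ?_
    rw [hQ.lintegral_posteriorAt b g (Ψ := fun w => nlog (posteriorAt L Q b g w))
      (measurable_nlog.comp (measurable_posteriorAt L Q b g)),
      ← lintegral_add_left Measurable.of_discrete]
    refine lintegral_congr fun j => ?_
    have hm : Measurable fun p : X × (ℕ → G) => nlog (posLaw Q (succLaw b) p.1
        (rightCoset (L.toFun p.1) (p.2 (j + 1)))) := measurable_nlog.comp (measurable_kernel_coset L _ _)
    rw [← lintegral_add_right _ hm]
    refine lintegral_congr fun p => ?_
    have hle : posLaw Q (succLaw b) p.1 (rightCoset (L.toFun p.1) (p.2 (j + 1))) ≤ 1 :=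
      prob_le_one
    have := nlog_mul (posteriorAt_le_one L Q b g (futureCosets L (j + 1) p)) hle
    rw [← this]
    exact congrArg nlog (posterior_mul Q b g _ _)
  have hright : ∀ g, M g = ∫⁻ x, Q x {ω | ω 1 = g} * nlog (Q x {ω | ω 1 = g}) ∂η
      + μ {g} * timeEntropy η L Q b := fun g => by
    have hpm : Measurable fun p : X × (ℕ → G) => nlog (Q p.1 {ω | ω 1 = g}) :=
      measurable_nlog.comp ((Q.measurable_coe (measurableSet_first g)).comp measurable_fst)
    have hprem : ∀ j, Measurable fun p : X × (ℕ → G) =>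
        nlog (posLaw Q b p.1 (rightCoset (L.toFun p.1) (p.2 j))) := fun j =>
      measurable_nlog.comp (measurable_kernel_coset L _ _)
    have hbm : ∀ j, Measurable fun p : X × (ℕ → G) =>
        nlog (posLaw Q b (g⁻¹ • p.1) ((g * ·) ⁻¹' rightCoset (L.toFun p.1) (p.2 (j + 1)))) :=
      fun j => by
        refine measurable_nlog.comp (measurable_eval_pair (f := fun x h =>
          posLaw Q b (g⁻¹ • x) ((g * ·) ⁻¹' rightCoset (L.toFun x) h)) (fun h => ?_) (j + 1))
        refine (measurable_kernel_prod_set (posLaw Q b)).comp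
          ((measurable_const_smul g⁻¹).prodMk ?_)
        refine measurable_set_iff.2 fun k => ?_
        exact measurable_set_iff.1 (measurable_cosetAt L h) (g * k)
    have h1 : ∀ j, ∫⁻ p in {p | p.2 1 = g},
        nlog (firstPosLaw Q b g p.1 (rightCoset (L.toFun p.1) (p.2 (j + 1)))) ∂(η ⊗ₘ Q)
        = ∫⁻ p in {p | p.2 1 = g}, nlog (Q p.1 {ω | ω 1 = g}) ∂(η ⊗ₘ Q)
          + μ {g} * ∫⁻ p, nlog (posLaw Q b p.1 (rightCoset (L.toFun p.1) (p.2 j)))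
            ∂(η ⊗ₘ Q) := fun j => by
      have hae : ∀ᵐ p ∂(η ⊗ₘ Q), ∀ s : Set G, firstPosLaw Q b g p.1 s
          = Q p.1 {ω | ω 1 = g} * posLaw Q b (g⁻¹ • p.1) ((g * ·) ⁻¹' s) := by
        have hfst : (η ⊗ₘ Q).fst = η := Measure.fst_compProd _ _
        have := hQ.firstPosLaw_ae_eq b g
        rw [← hfst] at this
        exact ae_of_ae_map measurable_fst.aemeasurable this
      have h2 : ∫⁻ p in {p | p.2 1 = g},
          nlog (firstPosLaw Q b g p.1 (rightCoset (L.toFun p.1) (p.2 (j + 1)))) ∂(η ⊗ₘ Q)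
          = ∫⁻ p in {p | p.2 1 = g}, nlog (Q p.1 {ω | ω 1 = g})
            + nlog (posLaw Q b (g⁻¹ • p.1) ((g * ·) ⁻¹' rightCoset (L.toFun p.1) (p.2 (j + 1))))
            ∂(η ⊗ₘ Q) := by
        refine lintegral_congr_ae (ae_restrict_of_ae ?_)
        filter_upwards [hae] with p hp
        rw [hp, nlog_mul prob_le_one prob_le_one]
      rw [h2, lintegral_add_left hpm, hQ.step.setLIntegral_first g (hbm j)]
      congr 2
      refine lintegral_congr fun p => ?_
      congr 1
      -- Equivariance of `L` gives `g⁻¹ L_{gx} g ω_j = L_x ω_j`.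
      simp only [inv_smul_smul, stepPath_succ]
      congr 1
      ext k
      simp only [Set.mem_preimage, rightCoset, Set.mem_ofPred_eq, L.equivariant]
      group
    have h3 : ∫⁻ p in {p | p.2 1 = g}, nlog (Q p.1 {ω | ω 1 = g}) ∂(η ⊗ₘ Q)
        = ∫⁻ x, Q x {ω | ω 1 = g} * nlog (Q x {ω | ω 1 = g}) ∂η := by
      rw [← lintegral_indicator (measurableSet_firstStep g), Measure.lintegral_compProd
        (hpm.indicator (measurableSet_firstStep g))]
      refine lintegral_congr fun x => ?_
      have : ∀ ω, ({p : X × (ℕ → G) | p.2 1 = g}).indicator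
          (fun p => nlog (Q p.1 {ω | ω 1 = g})) (x, ω)
          = ({ω : ℕ → G | ω 1 = g}).indicator (fun _ => nlog (Q x {ω | ω 1 = g})) ω :=
        fun ω => rfl
      rw [lintegral_congr this, lintegral_indicator (measurableSet_first g), setLIntegral_const,
        mul_comm]
    simp only [hM, h1, h3]
    rw [lintegral_add_left measurable_const, lintegral_const, measure_univ, mul_one,
      lintegral_const_mul _ Measurable.of_discrete, timeEntropy]
  have hsum : ∑' g, μ {g} = 1 := by
    have := lintegral_countable' (μ := μ) (fun _ : G => (1 : ℝ≥0∞))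
    simpa using this.symm
  rw [hleft, tsum_congr hright, ENNReal.tsum_add, ENNReal.tsum_mul_right, hsum, one_mul,
    baseEntropy]

end Entropy

/-! ### Densities, loss of information and random shifts. -/

section Density

variable {α β : Type*} [MeasurableSpace α] [MeasurableSpace β]

/-- `r ≤ 1` is a density of `m'` with respect to `m`. -/
structure IsDensity (m m' : Measure α) (r : α → ℝ≥0∞) : Prop where
  measurable : Measurable r
  le_one : ∀ w, r w ≤ 1
  withDensity_eq : m.withDensity r = m'

theorem IsDensity.lintegral_mul {m m' : Measure α} {r : α → ℝ≥0∞} (h : IsDensity m m' r)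
    {f : α → ℝ≥0∞} (hf : Measurable f) : ∫⁻ w, r w * f w ∂m = ∫⁻ w, f w ∂m' := by
  rw [← h.withDensity_eq, lintegral_withDensity_eq_lintegral_mul _ h.measurable hf]
  rfl

theorem IsDensity.of_lintegral_mul {m m' : Measure α} {r : α → ℝ≥0∞} (hr : Measurable r)
    (hr1 : ∀ w, r w ≤ 1)
    (h : ∀ f : α → ℝ≥0∞, Measurable f → ∫⁻ w, r w * f w ∂m = ∫⁻ w, f w ∂m') :
    IsDensity m m' r := by
  refine ⟨hr, hr1, Measure.ext fun s hs => ?_⟩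
  rw [withDensity_apply _ hs, ← lintegral_indicator_one hs, ← h _ (measurable_one.indicator hs),
    ← lintegral_indicator hs]
  refine lintegral_congr fun w => ?_
  by_cases hw : w ∈ s <;> simp [hw]

theorem exists_isDensity {m m' : Measure α} [IsFiniteMeasure m] (h : m' ≤ m) :
    ∃ r, IsDensity m m' r := by
  have : IsFiniteMeasure m' := isFiniteMeasure_of_le m h
  have hm : Measurable (m'.rnDeriv m) := Measure.measurable_rnDeriv _ _
  -- Truncation makes the bound by `1` hold everywhere. It changes the derivative only on a null
  -- set, because `m' ≤ m`.
  refine ⟨fun w => min (m'.rnDeriv m w) 1, hm.min measurable_const, fun w => min_le_right _ _, ?_⟩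
  have h1 : (fun w => min (m'.rnDeriv m w) 1) =ᵐ[m] m'.rnDeriv m := by
    have : m'.rnDeriv m ≤ᵐ[m] fun _ => 1 := by
      refine ae_le_of_forall_setLIntegral_le_of_sigmaFinite hm fun s hs _ => ?_
      rw [setLIntegral_one]
      exact (Measure.setLIntegral_rnDeriv_le s).trans (h s)
    filter_upwards [this] with w hw using min_eq_left hw
  rw [withDensity_congr_ae h1, Measure.withDensity_rnDeriv_eq _ _
    (Measure.absolutelyContinuous_of_le h)]

/-- Gibbs' inequality. -/
theorem tsum_lintegral_mul_nlog_le {ι : Type*} [Countable ι] {m : Measure α}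
    {r t : ι → α → ℝ≥0∞} (hr : ∀ i, Measurable (r i)) (ht : ∀ i, Measurable (t i))
    (hr1 : ∀ i w, r i w ≤ 1) (ht1 : ∀ i w, t i w ≤ 1)
    (hle : ∑' i, ∫⁻ w, t i w ∂m ≤ ∑' i, ∫⁻ w, r i w ∂m)
    (hfin : ∑' i, ∫⁻ w, r i w ∂m ≠ ∞) :
    ∑' i, ∫⁻ w, r i w * nlog (r i w) ∂m ≤ ∑' i, ∫⁻ w, r i w * nlog (t i w) ∂m := by
  have key : ∑' i, ∫⁻ w, r i w * nlog (r i w) ∂m + ∑' i, ∫⁻ w, r i w ∂m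
      ≤ ∑' i, ∫⁻ w, r i w * nlog (t i w) ∂m + ∑' i, ∫⁻ w, t i w ∂m := by
    rw [← ENNReal.tsum_add, ← ENNReal.tsum_add]
    refine ENNReal.tsum_le_tsum fun i => ?_
    rw [← lintegral_add_right _ (hr i), ← lintegral_add_right _ (ht i)]
    exact lintegral_mono fun w => mul_nlog_add_le (hr1 i w) (ht1 i w)
  exact ENNReal.le_of_add_le_add_right hfin (key.trans (add_le_add_right hle _))

/-- Conditional entropy increases when information is lost. -/
theorem tsum_lintegral_nlog_le_map {ι : Type*} [Countable ι] {m : Measure α} {m' : ι → Measure α}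
    {f : α → β} (hf : Measurable f) {r : ι → α → ℝ≥0∞} {t : ι → β → ℝ≥0∞}
    (hr : ∀ i, IsDensity m (m' i) (r i)) (ht : ∀ i, IsDensity (m.map f) ((m' i).map f) (t i))
    (hfin : ∑' i, m' i Set.univ ≠ ∞) :
    ∑' i, ∫⁻ w, r i w * nlog (r i w) ∂m ≤ ∑' i, ∫⁻ z, t i z * nlog (t i z) ∂(m.map f) := by
  have h1 : ∀ i, ∫⁻ w, r i w ∂m = m' i Set.univ := fun i => by
    have := (hr i).lintegral_mul (measurable_const (a := (1 : ℝ≥0∞)))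
    simpa using this
  have h2 : ∀ i, ∫⁻ w, t i (f w) ∂m = m' i Set.univ := fun i => by
    have := (ht i).lintegral_mul (measurable_const (a := (1 : ℝ≥0∞)))
    simp only [mul_one, lintegral_one] at this
    rwa [lintegral_map (ht i).measurable hf, Measure.map_apply hf MeasurableSet.univ] at this
  have h3 : ∀ i, ∫⁻ w, r i w * nlog (t i (f w)) ∂m = ∫⁻ z, t i z * nlog (t i z) ∂(m.map f) :=
    fun i => by
      have hn : Measurable fun z => nlog (t i z) := measurable_nlog.comp (ht i).measurable
      rw [(ht i).lintegral_mul hn, lintegral_map hn hf]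
      exact (hr i).lintegral_mul (hn.comp hf)
  -- Gibbs' inequality compares `r i` with `t i ∘ f`, which has the same integral. By `h3` the cross
  -- entropy is exactly the entropy of the image densities.
  refine (tsum_lintegral_mul_nlog_le (t := fun i w => t i (f w)) (fun i => (hr i).measurable)
    (fun i => (ht i).measurable.comp hf) (fun i => (hr i).le_one) (fun i w => (ht i).le_one _)
    ?_ ?_).trans_eq ?_
  · exact (tsum_congr h2).trans_le (tsum_congr h1).ge
  · rwa [tsum_congr h1]
  · exact tsum_congr h3

/-- The law of `S^(τ+1) w` with `τ` of law `b` and `w` of law `m`. -/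
noncomputable def randomShift (S : α → α) (b : Measure ℕ) (m : Measure α) : Measure α :=
  (b.prod m).map fun q => S^[q.1 + 1] q.2

theorem measurable_iterate_succ {S : α → α} (hS : Measurable S) :
    Measurable fun q : ℕ × α => S^[q.1 + 1] q.2 :=
  measurable_from_prod_countable_right fun j => hS.iterate (j + 1)

theorem lintegral_randomShift {S : α → α} (hS : Measurable S) (b : Measure ℕ) (m : Measure α)
    [SFinite m] {f : α → ℝ≥0∞} (hf : Measurable f) :
    ∫⁻ w, f w ∂(randomShift S b m) = ∫⁻ j, ∫⁻ w, f (S^[j + 1] w) ∂m ∂b := by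
  have hm : Measurable fun q : ℕ × α => f (S^[q.1 + 1] q.2) := hf.comp (measurable_iterate_succ hS)
  rw [randomShift, lintegral_map hf (measurable_iterate_succ hS), lintegral_prod _ hm.aemeasurable]

theorem randomShift_succLaw {S : α → α} (hS : Measurable S) (b : Measure ℕ) (m : Measure α)
    [SFinite m] : randomShift S (succLaw b) m = (randomShift S b m).map S := by
  refine Measure.ext_of_lintegral _ fun f hf => ?_
  rw [lintegral_randomShift hS _ _ hf, lintegral_succLaw, lintegral_map hf hS,
    lintegral_randomShift (f := fun w => f (S w)) hS _ _ (hf.comp hS)]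
  simp only [Function.iterate_succ_apply']

theorem iterate_eq_of_invariant {γ : Type*} {S : α → α} {f : α → γ} (hf : ∀ w, f (S w) = f w)
    (j : ℕ) (w : α) : f (S^[j] w) = f w := by
  induction j with
  | zero => rfl
  | succ j ih => rw [Function.iterate_succ_apply', hf, ih]

/-- A map which is measurable with respect to the invariant sets does not see the shift. -/
theorem map_randomShift {S : α → α} (hS : Measurable S) (b : Measure ℕ) [IsProbabilityMeasure b]
    (m : Measure α) [SFinite m] {f : α → β}
    (hf : Measurable[MeasurableSpace.invariants S] f) :
    (randomShift S b m).map f = m.map f := by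
  have hf' : Measurable f := hf.mono (MeasurableSpace.invariants_le S) le_rfl
  refine Measure.ext fun s hs => ?_
  have hs' : MeasurableSet (f ⁻¹' s) := hf' hs
  have hinv : S ⁻¹' (f ⁻¹' s) = f ⁻¹' s := (MeasurableSpace.measurableSet_invariants.1 (hf hs)).2
  rw [Measure.map_apply hf' hs, Measure.map_apply hf' hs, ← lintegral_indicator_one hs',
    lintegral_randomShift hS _ _ (measurable_one.indicator hs')]
  have h1 : ∀ (j : ℕ) w, (f ⁻¹' s).indicator (1 : α → ℝ≥0∞) (S^[j + 1] w)
      = (f ⁻¹' s).indicator 1 w := fun j w =>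
    iterate_eq_of_invariant (f := (f ⁻¹' s).indicator (1 : α → ℝ≥0∞)) (fun w => by
      have : S w ∈ f ⁻¹' s ↔ w ∈ f ⁻¹' s := by
        rw [← Set.mem_preimage (f := S), hinv]
      by_cases hw : w ∈ f ⁻¹' s
      · rw [Set.indicator_of_mem (this.2 hw), Set.indicator_of_mem hw]; rfl
      · rw [Set.indicator_of_notMem (mt this.1 hw), Set.indicator_of_notMem hw]) _ w
  simp only [h1, lintegral_const, measure_univ, mul_one, lintegral_indicator_one hs']

end Density

/-! ### The posterior as a density on coset trajectories. -/

section Bridge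

variable {G : Type*} [Group G] [Countable G] [MeasurableSpace G] [DiscreteMeasurableSpace G]
variable {X : Type*} [MeasurableSpace X] [MulAction G X] [MeasurableConstSMul G X]

theorem measurable_shift (L : SubgroupMap G X) : Measurable (CosetPath.shift L) :=
  Measurable.subtype_mk (f := fun w : CosetPath L => (w.1.1, fun n => w.1.2 (n + 1)))
    ((measurable_fst.comp measurable_subtype_coe).prodMk (measurable_pi_lambda _ fun n =>
      (measurable_pi_apply (n + 1)).comp (measurable_snd.comp measurable_subtype_coe)))

theorem iterate_shift_toCosetPath (L : SubgroupMap G X) (j : ℕ) (p : X × (ℕ → G)) :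
    (CosetPath.shift L)^[j] (toCosetPath L p) = futureCosets L j p := by
  induction j with
  | zero => simp [futureCosets]
  | succ j ih =>
    rw [Function.iterate_succ_apply', ih]
    refine Subtype.ext (Prod.ext rfl (funext fun n => ?_))
    simp only [CosetPath.shift, futureCosets, toCosetPath]
    rw [show j + (n + 1) = j + 1 + n by omega]

/-- The law of the coset trajectory restricted to the event that the first step is `g`. -/
noncomputable def firstCosetLaw (L : SubgroupMap G X) (J : Measure (X × (ℕ → G))) (g : G) :
    Measure (CosetPath L) :=
  (J.restrict {p | p.2 1 = g}).map (toCosetPath L)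

variable {μ : Measure G} [IsProbabilityMeasure μ] {η : Measure X} [IsProbabilityMeasure η]
  {L : SubgroupMap G X} {Q : Kernel X (ℕ → G)} [IsMarkovKernel Q]

instance (g : G) : IsFiniteMeasure (firstCosetLaw L (η ⊗ₘ Q) g) := by
  unfold firstCosetLaw; infer_instance

instance : IsProbabilityMeasure ((η ⊗ₘ Q).map (toCosetPath L)) :=
  Measure.isProbabilityMeasure_map (measurable_toCosetPath L).aemeasurable

theorem lintegral_randomShift_toCosetPath (J : Measure (X × (ℕ → G))) [SFinite J] (b : Measure ℕ)
    {f : CosetPath L → ℝ≥0∞} (hf : Measurable f) :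
    ∫⁻ w, f w ∂(randomShift (CosetPath.shift L) b (J.map (toCosetPath L)))
      = ∫⁻ j, ∫⁻ p, f (futureCosets L (j + 1) p) ∂J ∂b := by
  rw [lintegral_randomShift (measurable_shift L) _ _ hf]
  refine lintegral_congr fun j => ?_
  rw [lintegral_map (f := fun w => f ((CosetPath.shift L)^[j + 1] w))
    (hf.comp ((measurable_shift L).iterate _)) (measurable_toCosetPath L)]
  simp only [iterate_shift_toCosetPath]

theorem tsum_firstCosetLaw_univ (J : Measure (X × (ℕ → G))) :
    ∑' g, firstCosetLaw L J g Set.univ = J Set.univ := by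
  have := tsum_setLIntegral_firstStep J 1
  simp only [Pi.one_apply, lintegral_one, Measure.restrict_apply_univ] at this
  rw [← this]
  refine tsum_congr fun g => ?_
  rw [firstCosetLaw, Measure.map_apply (measurable_toCosetPath L) MeasurableSet.univ,
    Set.preimage_univ, Measure.restrict_apply_univ]

/-- The Markov property enters through `lintegral_posteriorAt`: although the posterior is computed
from one coset, it is the density on the whole coset trajectory after the random time. Monotonicity
under further shifts rests on this. -/
theorem IsFiberWalk.isDensity (hQ : IsFiberWalk μ η L Q) (b : Measure ℕ) [IsProbabilityMeasure b]
    (g : G) :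
    IsDensity (randomShift (CosetPath.shift L) b ((η ⊗ₘ Q).map (toCosetPath L)))
      (randomShift (CosetPath.shift L) b (firstCosetLaw L (η ⊗ₘ Q) g))
      (posteriorAt L Q b g) := by
  refine .of_lintegral_mul (measurable_posteriorAt L Q b g) (posteriorAt_le_one L Q b g)
    fun f hf => ?_
  rw [lintegral_randomShift_toCosetPath (f := fun w => posteriorAt L Q b g w * f w) _ _
      ((measurable_posteriorAt L Q b g).mul hf),
    firstCosetLaw, lintegral_randomShift_toCosetPath _ _ hf]
  exact hQ.lintegral_posteriorAt b g hf

theorem stepEntropy_eq (b : Measure ℕ) [IsProbabilityMeasure b] :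
    stepEntropy η L Q b = ∑' g, ∫⁻ w, posteriorAt L Q b g w * nlog (posteriorAt L Q b g w)
      ∂(randomShift (CosetPath.shift L) b ((η ⊗ₘ Q).map (toCosetPath L))) := by
  refine tsum_congr fun g => ?_
  have hm := measurable_posteriorAt L Q b g
  rw [lintegral_randomShift_toCosetPath
    (f := fun w => posteriorAt L Q b g w * nlog (posteriorAt L Q b g w)) _ _
    (hm.mul (measurable_nlog.comp hm))]

theorem tsum_randomShift_univ (b : Measure ℕ) [IsProbabilityMeasure b] :
    ∑' g, randomShift (CosetPath.shift L) b (firstCosetLaw L (η ⊗ₘ Q) g) Set.univ = 1 := by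
  have : ∀ g, randomShift (CosetPath.shift L) b (firstCosetLaw L (η ⊗ₘ Q) g) Set.univ
      = firstCosetLaw L (η ⊗ₘ Q) g Set.univ := fun g => by
    rw [randomShift, Measure.map_apply (measurable_iterate_succ (measurable_shift L))
      MeasurableSet.univ, Set.preimage_univ, ← Set.univ_prod_univ, Measure.prod_prod, measure_univ,
      one_mul]
  rw [tsum_congr this, tsum_firstCosetLaw_univ, measure_univ]

/-- A later start of the observed trajectory is the image of an earlier one under the shift, so
information is lost and conditional entropy increases. -/
theorem IsFiberWalk.stepEntropy_le_succ (hQ : IsFiberWalk μ η L Q) (b : Measure ℕ)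
    [IsProbabilityMeasure b] : stepEntropy η L Q b ≤ stepEntropy η L Q (succLaw b) := by
  have h1 := hQ.isDensity b
  have h2 := hQ.isDensity (succLaw b)
  simp only [randomShift_succLaw (measurable_shift L)] at h2
  rw [stepEntropy_eq, stepEntropy_eq, randomShift_succLaw (measurable_shift L)]
  refine tsum_lintegral_nlog_le_map (measurable_shift L) h1 h2 ?_
  rw [tsum_randomShift_univ]
  exact ENNReal.one_ne_top

/-- The entropy of the first step given the coset at a random time is at most its entropy given an
invariant random variable. -/
theorem IsFiberWalk.stepEntropy_le_of_invariant {Z : Type*} [MeasurableSpace Z]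
    (hQ : IsFiberWalk μ η L Q) (b : Measure ℕ) [IsProbabilityMeasure b] {θ : CosetPath L → Z}
    (hθ : Measurable[invariantField L] θ) {t : G → Z → ℝ≥0∞}
    (ht : ∀ g, IsDensity (((η ⊗ₘ Q).map (toCosetPath L)).map θ)
      ((firstCosetLaw L (η ⊗ₘ Q) g).map θ) (t g)) :
    stepEntropy η L Q b
      ≤ ∑' g, ∫⁻ z, t g z * nlog (t g z) ∂(((η ⊗ₘ Q).map (toCosetPath L)).map θ) := by
  have hθ' : Measurable θ := hθ.mono (MeasurableSpace.invariants_le _) le_rfl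
  rw [stepEntropy_eq, ← map_randomShift (measurable_shift L) b _ hθ]
  refine tsum_lintegral_nlog_le_map hθ' (hQ.isDensity b) (fun g => ?_) ?_
  · rw [map_randomShift (measurable_shift L) b _ hθ, map_randomShift (measurable_shift L) b _ hθ]
    exact ht g
  · rw [tsum_randomShift_univ]
    exact ENNReal.one_ne_top

end Bridge

/-! ### A mean ergodic estimate for averaged densities. -/

section AverageDensity

variable {α : Type*} [MeasurableSpace α]

/-- A measurable function with values in the unit interval. -/
structure UnitFun (f : α → ℝ) : Prop where
  measurable : Measurable f
  nonneg : ∀ w, 0 ≤ f w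
  le_one : ∀ w, f w ≤ 1

namespace UnitFun

variable {f h : α → ℝ}

theorem comp (hf : UnitFun f) {S : α → α} (hS : Measurable S) : UnitFun fun w => f (S w) :=
  ⟨hf.measurable.comp hS, fun _ => hf.nonneg _, fun _ => hf.le_one _⟩

theorem mul (hf : UnitFun f) (hh : UnitFun h) : UnitFun fun w => f w * h w :=
  ⟨hf.measurable.mul hh.measurable, fun w => mul_nonneg (hf.nonneg w) (hh.nonneg w),
    fun w => mul_le_one₀ (hf.le_one w) (hh.nonneg w) (hh.le_one w)⟩

theorem integrable (hf : UnitFun f) (m : Measure α) [IsFiniteMeasure m] : Integrable f m :=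
  .of_bound hf.measurable.aestronglyMeasurable 1 (ae_of_all _ fun w => by
    rw [Real.norm_eq_abs, abs_of_nonneg (hf.nonneg w)]; exact hf.le_one w)

theorem integral_sub_sq (hf : UnitFun f) (hh : UnitFun h) (m : Measure α) [IsFiniteMeasure m] :
    ∫ w, (f w - h w) ^ 2 ∂m = ∫ w, f w ^ 2 ∂m - 2 * ∫ w, f w * h w ∂m + ∫ w, h w ^ 2 ∂m := by
  have h1 := (hf.mul hf).integrable m
  have h2 := ((hf.mul hh).integrable m).const_mul 2
  have h3 := (hh.mul hh).integrable m
  have h4 : ∀ w, (f w - h w) ^ 2 = f w * f w - 2 * (f w * h w) + h w * h w := fun w => by ring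
  simp only [h4, sq]
  rw [integral_add (f := fun w => f w * f w - 2 * (f w * h w)) (h1.sub h2) h3,
    integral_sub h1 h2, integral_const_mul]

end UnitFun

/-- The functions `r N` are the densities of the averages over `N` shifts of `P'` with respect to
those of `P`. -/
structure IsAverageDensity (S : α → α) (P P' : Measure α) (r : ℕ → α → ℝ) : Prop where
  unit : ∀ N, UnitFun (r N)
  sum_integral : ∀ N, 0 < N → ∀ f : α → ℝ, UnitFun f →
    ∑ j ∈ Finset.range N, ∫ w, r N (S^[j + 1] w) * f (S^[j + 1] w) ∂P
      = ∑ j ∈ Finset.range N, ∫ w, f (S^[j + 1] w) ∂P'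

theorem abs_sum_range_add_sub_le {f : ℕ → ℝ} (h0 : ∀ j, 0 ≤ f j) (h1 : ∀ j, f j ≤ 1) (N i : ℕ) :
    |∑ j ∈ Finset.range N, f (i + j) - ∑ j ∈ Finset.range N, f j| ≤ i := by
  induction i with
  | zero => simp
  | succ i ih =>
    have h2 : ∑ j ∈ Finset.range N, f (i + 1 + j) + f i
        = ∑ j ∈ Finset.range N, f (i + j) + f (i + N) := by
      rw [← Finset.sum_range_succ (fun j => f (i + j)), Finset.sum_range_succ']
      simp only [add_zero]
      congr 1
      exact Finset.sum_congr rfl fun j _ => by rw [add_assoc, add_comm 1 j]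
    have := h0 i
    have := h1 i
    have := h0 (i + N)
    have := h1 (i + N)
    rw [abs_le] at ih ⊢
    push_cast
    constructor <;> linarith [ih.1, ih.2]

/-- The sum of the translates of the `N`-th density. -/
noncomputable def orbitSum (S : α → α) (r : ℕ → α → ℝ) (N : ℕ) (w : α) : ℝ :=
  ∑ j ∈ Finset.range N, r N (S^[j + 1] w)

/-- The average of the translates of the `N`-th density. -/
noncomputable def orbitMean (S : α → α) (r : ℕ → α → ℝ) (N : ℕ) (w : α) : ℝ :=
  orbitSum S r N w / N

variable {S : α → α} (hS : Measurable S) {P P' : Measure α} [IsProbabilityMeasure P]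
  [IsFiniteMeasure P'] {r : ℕ → α → ℝ} (hr : IsAverageDensity S P P' r)

include hS hr

theorem IsAverageDensity.unit_iterate (N i : ℕ) : UnitFun fun w => r N (S^[i] w) :=
  (hr.unit N).comp (hS.iterate i)

theorem IsAverageDensity.measurable_orbitSum (N : ℕ) : Measurable (orbitSum S r N) :=
  Finset.measurable_sum _ fun j _ => (hr.unit_iterate hS N (j + 1)).measurable

omit hS in
theorem IsAverageDensity.orbitSum_nonneg (N : ℕ) (w : α) : 0 ≤ orbitSum S r N w :=
  Finset.sum_nonneg fun _ _ => (hr.unit N).nonneg _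

omit hS in
theorem IsAverageDensity.orbitSum_le (N : ℕ) (w : α) : orbitSum S r N w ≤ N := by
  refine (Finset.sum_le_sum fun j _ => (hr.unit N).le_one _).trans ?_
  simp

theorem IsAverageDensity.unit_orbitMean (N : ℕ) : UnitFun (orbitMean S r N) :=
  ⟨(hr.measurable_orbitSum hS N).div_const _, fun w =>
    div_nonneg (hr.orbitSum_nonneg N w) (Nat.cast_nonneg N), fun w =>
      div_le_one_of_le₀ (hr.orbitSum_le N w) (Nat.cast_nonneg N)⟩

/-- The density is tested against itself. -/
theorem IsAverageDensity.sum_sq {N : ℕ} (hN : 0 < N) :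
    ∑ j ∈ Finset.range N, ∫ w, r N (S^[j + 1] w) ^ 2 ∂P
      = ∑ j ∈ Finset.range N, ∫ w, r N (S^[j + 1] w) ∂P' := by
  rw [← hr.sum_integral N hN _ (hr.unit N)]
  simp only [sq]

/-- Cauchy-Schwarz for the sum of `N` terms, followed by `sum_sq`. -/
theorem IsAverageDensity.integral_orbitSum_sq_le {N : ℕ} (hN : 0 < N) :
    ∫ w, orbitSum S r N w ^ 2 ∂P
      ≤ N * ∑ j ∈ Finset.range N, ∫ w, r N (S^[j + 1] w) ∂P' := by
  have hi : ∀ j, Integrable (fun w => r N (S^[j + 1] w) ^ 2) P := fun j => by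
    simpa only [sq] using
      ((hr.unit_iterate hS N (j + 1)).mul (hr.unit_iterate hS N (j + 1))).integrable P
  rw [← hr.sum_sq hS hN, ← integral_finsetSum _ fun j _ => hi j, ← integral_const_mul]
  refine integral_mono_of_nonneg (ae_of_all _ fun w => sq_nonneg _)
    ((integrable_finsetSum _ fun j _ => hi j).const_mul _) (ae_of_all _ fun w => ?_)
  have := sq_sum_le_card_mul_sum_sq (s := Finset.range N) (f := fun j => r N (S^[j + 1] w))
  rwa [Finset.card_range] at this

/-- The key estimate: the average densities for two time scales are correlated. -/
theorem IsAverageDensity.le_integral_orbitSum_mul (hP' : P' Set.univ ≤ 1) {n N : ℕ} (hn : 0 < n) :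
    n * ∑ j ∈ Finset.range N, ∫ w, r N (S^[j + 1] w) ∂P' - 2 * n ^ 2
      ≤ ∫ w, orbitSum S r n w * orbitSum S r N w ∂P := by
  have hiter : ∀ i j w, S^[i + j + 1] w = S^[j] (S^[i + 1] w) := fun i j w => by
    rw [← Function.iterate_add_apply]; congr 1; omega
  have hu : ∀ i j, UnitFun fun w => r n (S^[i + 1] w) * r N (S^[j] (S^[i + 1] w)) := fun i j =>
    (hr.unit_iterate hS n (i + 1)).mul ((hr.unit_iterate hS N j).comp (hS.iterate (i + 1)))
  -- Moving the window of length `N` from start `i` to start `0` costs at most `i ≤ n`. Over the `n`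
  -- values of `i` this loses `n ^ 2`.
  have h1 : ∀ w, ∑ i ∈ Finset.range n, ∑ j ∈ Finset.range N,
      r n (S^[i + 1] w) * r N (S^[j] (S^[i + 1] w)) - n ^ 2
      ≤ orbitSum S r n w * orbitSum S r N w := fun w => by
    have : ∀ i ∈ Finset.range n, ∑ j ∈ Finset.range N,
        r n (S^[i + 1] w) * r N (S^[j] (S^[i + 1] w)) - n
        ≤ r n (S^[i + 1] w) * orbitSum S r N w := fun i hi => by
      have h2 := abs_sum_range_add_sub_le (f := fun j => r N (S^[j + 1] w))
        (fun j => (hr.unit N).nonneg _) (fun j => (hr.unit N).le_one _) N i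
      simp only [hiter] at h2
      rw [← Finset.mul_sum]
      have h3 : (i : ℝ) ≤ n := Nat.cast_le.2 (Finset.mem_range.1 hi).le
      have h4 : ∑ j ∈ Finset.range N, r N (S^[j] (S^[i + 1] w)) - orbitSum S r N w ≤ n :=
        (le_abs_self _).trans (h2.trans h3)
      have h5 := mul_le_mul_of_nonneg_left h4 ((hr.unit n).nonneg (S^[i + 1] w))
      have h6 := mul_le_mul_of_nonneg_right ((hr.unit n).le_one (S^[i + 1] w))
        (Nat.cast_nonneg (α := ℝ) n)
      linarith
    have := Finset.sum_le_sum this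
    rw [Finset.sum_sub_distrib, ← Finset.sum_mul, Finset.sum_const, Finset.card_range,
      nsmul_eq_mul, ← sq] at this
    exact this
  -- The defining identity at scale `n` is applied for each `j` to the test function `r N ∘ S^[j]`;
  -- it turns the weights `r n` into the measure `P'`.
  have h2 : ∫ w, (∑ i ∈ Finset.range n, ∑ j ∈ Finset.range N,
      r n (S^[i + 1] w) * r N (S^[j] (S^[i + 1] w)) - n ^ 2) ∂P
      = ∑ i ∈ Finset.range n, ∑ j ∈ Finset.range N, ∫ w, r N (S^[j] (S^[i + 1] w)) ∂P' - n ^ 2 := by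
    rw [integral_sub (integrable_finsetSum _ fun i _ => integrable_finsetSum _ fun j _ =>
      (hu i j).integrable P) (integrable_const _), integral_const, probReal_univ, one_smul,
      integral_finsetSum _ fun i _ => integrable_finsetSum _ fun j _ => (hu i j).integrable P]
    congr 1
    rw [Finset.sum_congr rfl fun i _ => integral_finsetSum _ fun j _ => (hu i j).integrable P,
      Finset.sum_comm, Finset.sum_congr rfl fun j _ =>
        hr.sum_integral n hn (fun w => r N (S^[j] w)) (hr.unit_iterate hS N j), Finset.sum_comm]
  -- Moving the windows back under `P'`, whose mass is at most `1`, accounts for the second loss of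
  -- `n ^ 2`.
  have h3 : ∀ i ∈ Finset.range n, ∑ j ∈ Finset.range N, ∫ w, r N (S^[j + 1] w) ∂P' - n
      ≤ ∑ j ∈ Finset.range N, ∫ w, r N (S^[j] (S^[i + 1] w)) ∂P' := fun i hi => by
    rw [← integral_finsetSum _ fun j _ => (hr.unit_iterate hS N (j + 1)).integrable P',
      ← integral_finsetSum _ fun j _ =>
        ((hr.unit_iterate hS N j).comp (hS.iterate (i + 1))).integrable P']
    have h4 : (n : ℝ) * P'.real Set.univ ≤ n := by
      refine mul_le_of_le_one_right (Nat.cast_nonneg n) ?_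
      exact ENNReal.toReal_mono ENNReal.one_ne_top hP'
    have h5 : ∫ w, (∑ j ∈ Finset.range N, r N (S^[j + 1] w) - n) ∂P'
        ≤ ∫ w, ∑ j ∈ Finset.range N, r N (S^[j] (S^[i + 1] w)) ∂P' := by
      refine integral_mono ((integrable_finsetSum _ fun j _ =>
        (hr.unit_iterate hS N (j + 1)).integrable P').sub (integrable_const _))
        (integrable_finsetSum _ fun j _ =>
          ((hr.unit_iterate hS N j).comp (hS.iterate (i + 1))).integrable P') fun w => ?_
      have h2 := abs_sum_range_add_sub_le (f := fun j => r N (S^[j + 1] w))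
        (fun j => (hr.unit N).nonneg _) (fun j => (hr.unit N).le_one _) N i
      simp only [hiter] at h2
      have h3 : (i : ℝ) ≤ n := Nat.cast_le.2 (Finset.mem_range.1 hi).le
      have := (abs_le.1 h2).1
      simp only
      linarith
    rw [integral_sub (integrable_finsetSum _ fun j _ =>
      (hr.unit_iterate hS N (j + 1)).integrable P') (integrable_const _), integral_const,
      smul_eq_mul, mul_comm] at h5
    linarith
  have h4 := Finset.sum_le_sum h3
  rw [Finset.sum_const, Finset.card_range, nsmul_eq_mul] at h4
  have h5 : ∫ w, (∑ i ∈ Finset.range n, ∑ j ∈ Finset.range N,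
      r n (S^[i + 1] w) * r N (S^[j] (S^[i + 1] w)) - n ^ 2) ∂P
      ≤ ∫ w, orbitSum S r n w * orbitSum S r N w ∂P := by
    refine integral_mono ((integrable_finsetSum _ fun i _ => integrable_finsetSum _ fun j _ =>
      (hu i j).integrable P).sub (integrable_const _)) ?_ h1
    refine .of_bound ((hr.measurable_orbitSum hS n).mul
      (hr.measurable_orbitSum hS N)).aestronglyMeasurable (n * N) (ae_of_all _ fun w => ?_)
    rw [Real.norm_eq_abs, abs_of_nonneg (mul_nonneg (hr.orbitSum_nonneg n w)
      (hr.orbitSum_nonneg N w))]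
    exact mul_le_mul (hr.orbitSum_le n w) (hr.orbitSum_le N w) (hr.orbitSum_nonneg N w)
      (Nat.cast_nonneg n)
  rw [h2] at h5
  nlinarith

omit hS hr in
/-- The mean square of the `N`-th density. -/
noncomputable def meanEnergy (S : α → α) (P' : Measure α) (r : ℕ → α → ℝ) (N : ℕ) : ℝ :=
  (∑ j ∈ Finset.range N, ∫ w, r N (S^[j + 1] w) ∂P') / N

theorem IsAverageDensity.integral_orbitMean_sq_le {N : ℕ} (hN : 0 < N) :
    ∫ w, orbitMean S r N w ^ 2 ∂P ≤ meanEnergy S P' r N := by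
  have hN' : (0 : ℝ) < N := Nat.cast_pos.2 hN
  simp only [orbitMean, div_pow]
  rw [integral_div, div_le_iff₀ (by positivity), meanEnergy]
  refine (hr.integral_orbitSum_sq_le hS hN).trans_eq ?_
  field_simp

theorem IsAverageDensity.le_integral_orbitMean_mul (hP' : P' Set.univ ≤ 1) {n N : ℕ} (hn : 0 < n)
    (hN : 0 < N) :
    meanEnergy S P' r N - 2 * (n / N) ≤ ∫ w, orbitMean S r n w * orbitMean S r N w ∂P := by
  have hN' : (0 : ℝ) < N := Nat.cast_pos.2 hN
  have hn' : (0 : ℝ) < n := Nat.cast_pos.2 hn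
  simp only [orbitMean, div_mul_div_comm]
  rw [integral_div, le_div_iff₀ (by positivity), meanEnergy]
  refine le_trans (le_of_eq ?_) (hr.le_integral_orbitSum_mul hS hP' hn (N := N))
  field_simp

/-- Expanding the square, the two energies bound the squares and the correlation estimate bounds the
cross term from below, whose error `2n/N` is doubled. -/
theorem IsAverageDensity.integral_sub_sq_le (hP' : P' Set.univ ≤ 1) {n N : ℕ} (hn : 0 < n)
    (hN : 0 < N) :
    ∫ w, (orbitMean S r n w - orbitMean S r N w) ^ 2 ∂P
      ≤ meanEnergy S P' r n - meanEnergy S P' r N + 4 * (n / N) := by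
  have h1 := hr.integral_orbitMean_sq_le hS hn
  have h2 := hr.integral_orbitMean_sq_le hS hN
  have h3 := hr.le_integral_orbitMean_mul hS hP' hn hN
  have un := hr.unit_orbitMean hS n
  have uN := hr.unit_orbitMean hS N
  rw [un.integral_sub_sq uN]
  linarith

theorem IsAverageDensity.meanEnergy_le (hP' : P' Set.univ ≤ 1) {n N : ℕ} (hn : 0 < n)
    (hN : 0 < N) : meanEnergy S P' r N ≤ meanEnergy S P' r n + 4 * (n / N) := by
  have h := hr.integral_sub_sq_le hS hP' hn hN
  have : 0 ≤ ∫ w, (orbitMean S r n w - orbitMean S r N w) ^ 2 ∂P :=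
    integral_nonneg fun w => sq_nonneg _
  linarith

omit hS in
theorem IsAverageDensity.meanEnergy_nonneg (N : ℕ) : 0 ≤ meanEnergy S P' r N :=
  div_nonneg (Finset.sum_nonneg fun _ _ => integral_nonneg fun _ => (hr.unit N).nonneg _)
    (Nat.cast_nonneg N)

/-- The mean energy is almost decreasing: the error `4n/N` vanishes as `N` grows with `n` fixed, so
the infimum over positive scales is the limit. -/
theorem IsAverageDensity.exists_tendsto_meanEnergy (hP' : P' Set.univ ≤ 1) :
    ∃ ρ, (∀ N, 0 < N → ρ ≤ meanEnergy S P' r N)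
      ∧ Tendsto (meanEnergy S P' r) atTop (𝓝 ρ) := by
  have hbdd : BddBelow (Set.range fun k : ℕ => meanEnergy S P' r (k + 1)) :=
    ⟨0, by rintro _ ⟨k, rfl⟩; exact hr.meanEnergy_nonneg _⟩
  refine ⟨⨅ k : ℕ, meanEnergy S P' r (k + 1), fun N hN => ?_, ?_⟩
  · obtain ⟨k, rfl⟩ := Nat.exists_eq_add_of_lt hN
    simpa using ciInf_le hbdd (0 + k)
  · refine tendsto_order.2 ⟨fun a ha => ?_, fun a ha => ?_⟩
    · filter_upwards [eventually_gt_atTop 0] with N hN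
      obtain ⟨k, rfl⟩ := Nat.exists_eq_add_of_lt hN
      exact ha.trans_le (by simpa using ciInf_le hbdd (0 + k))
    · obtain ⟨k, hk⟩ := exists_lt_of_ciInf_lt ha
      have h1 : Tendsto (fun N : ℕ => meanEnergy S P' r (k + 1) + 4 * (((k + 1 : ℕ) : ℝ) / N)) atTop
          (𝓝 (meanEnergy S P' r (k + 1) + 4 * 0)) :=
        ((tendsto_const_div_atTop_nhds_zero_nat _).const_mul 4).const_add _
      rw [mul_zero, add_zero] at h1
      filter_upwards [h1.eventually_lt_const hk, eventually_gt_atTop 0] with N hN hN0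
      exact (hr.meanEnergy_le hS hP' k.succ_pos hN0).trans_lt hN

end AverageDensity

/-! ### Convergence to the density on the invariant sets. -/

section InvariantLimit

variable {α : Type*} [MeasurableSpace α] {S : α → α} (hS : Measurable S) {P P' : Measure α}
  [IsProbabilityMeasure P] [IsFiniteMeasure P'] {r : ℕ → α → ℝ} (hr : IsAverageDensity S P P' r)

include hr

theorem IsAverageDensity.abs_orbitMean_shift_le (N : ℕ) (w : α) :
    |orbitMean S r N (S w) - orbitMean S r N w| ≤ 1 / N := by
  have h := abs_sum_range_add_sub_le (f := fun j => r N (S^[j + 1] w))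
    (fun j => (hr.unit N).nonneg _) (fun j => (hr.unit N).le_one _) N 1
  have h1 : orbitSum S r N (S w) = ∑ j ∈ Finset.range N, r N (S^[1 + j + 1] w) := by
    refine Finset.sum_congr rfl fun j _ => ?_
    rw [← Function.iterate_succ_apply, show 1 + j + 1 = j + 1 + 1 by omega]
  rw [← h1, Nat.cast_one] at h
  rw [orbitMean, orbitMean, ← sub_div, abs_div, Nat.abs_cast]
  exact div_le_div_of_nonneg_right h (Nat.cast_nonneg N)

include hS

/-- Along factorials successive scales separate, `n! / m! ≤ 1 / (n + 1)` for `n < m`, so the square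
distance estimate gives a Cauchy sequence in `L²`. A further subsequence converges almost
everywhere. -/
theorem IsAverageDensity.exists_tendsto_ae (hP' : P' Set.univ ≤ 1) :
    ∃ (N : ℕ → ℕ) (F : α → ℝ), Tendsto N atTop atTop
      ∧ ∀ᵐ w ∂P, Tendsto (fun k => orbitMean S r (N k) w) atTop (𝓝 (F w)) := by
  obtain ⟨ρ, hρ, hlim⟩ := hr.exists_tendsto_meanEnergy hS hP'
  have hmem : ∀ k : ℕ, MemLp (orbitMean S r k.factorial) 2 P := fun k =>
    .of_bound (hr.unit_orbitMean hS _).measurable.aestronglyMeasurable 1 (ae_of_all _ fun w => by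
      rw [Real.norm_eq_abs, abs_of_nonneg ((hr.unit_orbitMean hS _).nonneg w)]
      exact (hr.unit_orbitMean hS _).le_one w)
  have hfact : Tendsto Nat.factorial atTop atTop := tendsto_atTop_mono Nat.self_le_factorial tendsto_id
  set b : ℕ → ℝ := fun k => Real.sqrt (meanEnergy S P' r k.factorial - ρ + 4 * (1 / ((k : ℝ) + 1)))
    with hb
  have hb0 : Tendsto b atTop (𝓝 0) := by
    have h1 : Tendsto (fun k : ℕ => meanEnergy S P' r k.factorial - ρ + 4 * (1 / ((k : ℝ) + 1)))
        atTop (𝓝 (ρ - ρ + 4 * 0)) :=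
      ((hlim.comp hfact).sub_const ρ).add (tendsto_one_div_add_atTop_nhds_zero_nat.const_mul 4)
    have h2 := (Real.continuous_sqrt.tendsto _).comp h1
    rw [mul_zero, add_zero, sub_self, Real.sqrt_zero] at h2
    exact h2
  have hcauchy : CauchySeq fun k => (hmem k).toLp := by
    refine cauchySeq_of_le_tendsto_0' b (fun n m hnm => ?_) hb0
    rcases hnm.eq_or_lt with rfl | hlt
    · rw [dist_self]; exact Real.sqrt_nonneg _
    rw [dist_eq_norm, ← MemLp.toLp_sub, Lp.norm_toLp,
      ((hmem n).sub (hmem m)).eLpNorm_eq_integral_rpow_norm two_ne_zero ENNReal.ofNat_ne_top,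
      ENNReal.toReal_ofReal (by positivity)]
    have h1 : ∀ w, ‖(orbitMean S r n.factorial - orbitMean S r m.factorial) w‖ ^ (2 : ℝ≥0∞).toReal
        = (orbitMean S r n.factorial w - orbitMean S r m.factorial w) ^ 2 := fun w => by
      rw [ENNReal.toReal_ofNat, Real.rpow_two, Real.norm_eq_abs, sq_abs]; rfl
    simp only [h1]
    rw [ENNReal.toReal_ofNat, ← one_div, ← Real.sqrt_eq_rpow]
    refine Real.sqrt_le_sqrt ((hr.integral_sub_sq_le hS hP' n.factorial_pos m.factorial_pos).trans
      ?_)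
    have h2 := hρ m.factorial m.factorial_pos
    have h3 : (n.factorial : ℝ) / m.factorial ≤ 1 / ((n : ℝ) + 1) := by
      rw [div_le_div_iff₀ (Nat.cast_pos.2 m.factorial_pos) (by positivity), one_mul]
      have := Nat.factorial_le (Nat.succ_le_of_lt hlt)
      rw [Nat.factorial_succ] at this
      calc (n.factorial : ℝ) * ((n : ℝ) + 1) = (((n + 1) * n.factorial : ℕ) : ℝ) := by
            push_cast; ring
        _ ≤ m.factorial := Nat.cast_le.2 this
    linarith
  obtain ⟨F, hF⟩ := cauchySeq_tendsto_of_complete hcauchy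
  obtain ⟨ns, hns, hae⟩ := (tendstoInMeasure_of_tendsto_Lp hF).exists_seq_tendsto_ae
  refine ⟨fun k => (ns k).factorial, F, hfact.comp hns.tendsto_atTop, ?_⟩
  have h1 : ∀ᵐ w ∂P, ∀ k, (hmem k).toLp _ w = orbitMean S r k.factorial w :=
    ae_all_iff.2 fun k => (hmem k).coeFn_toLp
  filter_upwards [hae, h1] with w hw hw1
  simpa only [hw1] using hw

/-- The subsequential limit can be chosen strictly invariant. -/
theorem IsAverageDensity.exists_invariant_limit (hP' : P' Set.univ ≤ 1) :
    ∃ (N : ℕ → ℕ) (F : α → ℝ), Tendsto N atTop atTop ∧ UnitFun F ∧ (∀ w, F (S w) = F w)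
      ∧ ∀ᵐ w ∂P, Tendsto (fun k => orbitMean S r (N k) w) atTop (𝓝 (F w)) := by
  obtain ⟨N, F, hN, hF⟩ := hr.exists_tendsto_ae hS hP'
  -- The averages at `w` and at `S w` differ by at most `1 / N k`, hence have the same limits, or
  -- both none. As `limUnder` depends only on which limits exist, its default value is invariant
  -- too.
  set F' : α → ℝ := fun w => limUnder atTop fun k => orbitMean S r (N k) w with hF'
  have hm : Measurable F' := (StronglyMeasurable.limUnder fun k =>
    (hr.unit_orbitMean hS (N k)).measurable.stronglyMeasurable).measurable
  have hinv : ∀ w, F' (S w) = F' w := fun w => by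
    have h1 : Tendsto (fun k => orbitMean S r (N k) (S w) - orbitMean S r (N k) w) atTop (𝓝 0) :=
      squeeze_zero_norm (fun k => hr.abs_orbitMean_shift_le (N k) w)
        ((tendsto_const_div_atTop_nhds_zero_nat 1).comp hN)
    have h2 : ∀ l, map (fun k => orbitMean S r (N k) (S w)) atTop ≤ 𝓝 l
        ↔ map (fun k => orbitMean S r (N k) w) atTop ≤ 𝓝 l := fun l => by
      constructor
      · intro h
        have h' : Tendsto (fun k => orbitMean S r (N k) (S w)) atTop (𝓝 l) := h
        have := h'.sub h1
        simp only [sub_sub_cancel, sub_zero] at this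
        exact this
      · intro h
        have h' : Tendsto (fun k => orbitMean S r (N k) w) atTop (𝓝 l) := h
        have := h'.add h1
        simp only [add_sub_cancel, add_zero] at this
        exact this
    simp only [hF', limUnder, lim, h2]
  -- Clipping controls the values where the sequence need not converge; where it does converge the
  -- limit already lies in the unit interval.
  refine ⟨N, fun w => max 0 (min 1 (F' w)), hN, ⟨measurable_const.max (measurable_const.min hm),
    fun w => le_max_left _ _, fun w => max_le zero_le_one (min_le_left _ _)⟩,
    fun w => by simp only [hinv], ?_⟩
  filter_upwards [hF] with w hw
  have h1 : F' w = F w := hw.limUnder_eq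
  have h0 : 0 ≤ F w := ge_of_tendsto' hw fun k => (hr.unit_orbitMean hS _).nonneg w
  have h2 : F w ≤ 1 := le_of_tendsto' hw fun k => (hr.unit_orbitMean hS _).le_one w
  rwa [h1, min_eq_right h2, max_eq_right h0]

theorem IsAverageDensity.sum_integral_mul_invariant {N : ℕ} (hN : 0 < N) {f : α → ℝ}
    (hf : UnitFun f) (hinv : ∀ w, f (S w) = f w) :
    ∑ j ∈ Finset.range N, ∫ w, r N (S^[j + 1] w) * f w ∂P = N * ∫ w, f w ∂P' := by
  have h := hr.sum_integral N hN f hf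
  simp only [iterate_eq_of_invariant hinv] at h
  rw [h, Finset.sum_const, Finset.card_range, nsmul_eq_mul]

theorem IsAverageDensity.integral_orbitMean_mul_invariant {N : ℕ} (hN : 0 < N) {f : α → ℝ}
    (hf : UnitFun f) (hinv : ∀ w, f (S w) = f w) :
    ∫ w, orbitMean S r N w * f w ∂P = ∫ w, f w ∂P' := by
  have hN' : (N : ℝ) ≠ 0 := Nat.cast_ne_zero.2 hN.ne'
  have h := hr.sum_integral_mul_invariant hS hN hf hinv
  rw [← integral_finsetSum _ fun j _ =>
    ((hr.unit_iterate hS N (j + 1)).mul hf).integrable P] at h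
  simp only [← Finset.sum_mul] at h
  simp only [orbitMean, div_mul_eq_mul_div]
  rw [integral_div, div_eq_iff hN', mul_comm]
  exact h

/-- The average densities converge in mean square to the density on the invariant sets. -/
theorem IsAverageDensity.tendsto_mean_sq (hP' : P' Set.univ ≤ 1) {p : α → ℝ} (hp : UnitFun p)
    (hpinv : ∀ w, p (S w) = p w)
    (hpd : ∀ f : α → ℝ, UnitFun f → (∀ w, f (S w) = f w) → ∫ w, p w * f w ∂P = ∫ w, f w ∂P') :
    Tendsto (fun N : ℕ => (∑ j ∈ Finset.range N, ∫ w, (r N (S^[j + 1] w) - p w) ^ 2 ∂P) / N)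
      atTop (𝓝 0) := by
  obtain ⟨ρ, hρ, hlim⟩ := hr.exists_tendsto_meanEnergy hS hP'
  obtain ⟨N, F, hN, hF, hFinv, hae⟩ := hr.exists_invariant_limit hS hP'
  have hconv : ∀ h : α → ℝ, UnitFun h →
      Tendsto (fun k => ∫ w, h w * orbitMean S r (N k) w ∂P) atTop (𝓝 (∫ w, h w * F w ∂P)) :=
    fun h hh => by
      refine tendsto_integral_of_dominated_convergence (fun _ => 1)
        (fun k => (hh.mul (hr.unit_orbitMean hS _)).measurable.aestronglyMeasurable)
        (integrable_const _) (fun k => ae_of_all _ fun w => ?_) ?_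
      · have := hh.mul (hr.unit_orbitMean hS (N k))
        rw [Real.norm_eq_abs, abs_of_nonneg (this.nonneg w)]
        exact this.le_one w
      · filter_upwards [hae] with w hw using hw.const_mul _
  have hsq : Tendsto (fun k => ∫ w, orbitMean S r (N k) w ^ 2 ∂P) atTop (𝓝 (∫ w, F w ^ 2 ∂P)) := by
    refine tendsto_integral_of_dominated_convergence (fun _ => 1)
      (fun k => ((hr.unit_orbitMean hS _).measurable.pow_const 2).aestronglyMeasurable)
      (integrable_const _) (fun k => ae_of_all _ fun w => ?_) ?_
    · rw [Real.norm_eq_abs, abs_of_nonneg (sq_nonneg _)]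
      exact pow_le_one₀ ((hr.unit_orbitMean hS _).nonneg w) ((hr.unit_orbitMean hS _).le_one w)
    · filter_upwards [hae] with w hw using hw.pow 2
  have hF2 : ∫ w, F w ^ 2 ∂P ≤ ρ := by
    refine le_of_tendsto_of_tendsto hsq (hlim.comp hN) ?_
    filter_upwards [hN.eventually_gt_atTop 0] with k hk
    exact hr.integral_orbitMean_sq_le hS hk
  -- Since `F` is invariant, pairing it with `p` or with the mean at scale `1` both gives its
  -- `P'`-integral. The latter pairing is the limit of correlations between scales `1` and `N k`,
  -- each at least `ρ - 2 / N k`.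
  have hpF : ρ ≤ ∫ w, p w * F w ∂P := by
    rw [hpd F hF hFinv, ← hr.integral_orbitMean_mul_invariant hS zero_lt_one hF hFinv]
    have h1 : Tendsto (fun k => ρ - 2 * (((1 : ℕ) : ℝ) / (N k : ℝ))) atTop (𝓝 (ρ - 2 * 0)) :=
      (((tendsto_const_div_atTop_nhds_zero_nat ((1 : ℕ) : ℝ)).comp hN).const_mul 2).const_sub ρ
    rw [mul_zero, sub_zero] at h1
    refine le_of_tendsto_of_tendsto h1 (hconv _ (hr.unit_orbitMean hS 1)) ?_
    filter_upwards [hN.eventually_gt_atTop 0] with k hk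
    have := hr.le_integral_orbitMean_mul hS hP' zero_lt_one hk
    have := hρ (N k) hk
    linarith
  -- From `∫ (p - F)² ≥ 0` together with `∫ F² ≤ ρ ≤ ∫ pF`.
  have hp2 : ρ ≤ ∫ w, p w ^ 2 ∂P := by
    have h1 := hp.integral_sub_sq hF P
    have h2 : 0 ≤ ∫ w, (p w - F w) ^ 2 ∂P := integral_nonneg fun w => sq_nonneg _
    linarith
  -- Testing the density of scale `N` against itself and against the invariant `p` evaluates the
  -- square and cross terms. The error is an energy minus `∫ p²`, and it is squeezed by `hp2`.
  have hexp : ∀ N : ℕ, 0 < N → (∑ j ∈ Finset.range N, ∫ w, (r N (S^[j + 1] w) - p w) ^ 2 ∂P) / N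
      = meanEnergy S P' r N - ∫ w, p w ^ 2 ∂P := fun N hN => by
    have hN' : (N : ℝ) ≠ 0 := Nat.cast_ne_zero.2 hN.ne'
    have h1 : ∫ w, p w ∂P' = ∫ w, p w ^ 2 ∂P := by
      rw [← hpd p hp hpinv]; simp only [sq]
    rw [Finset.sum_congr rfl fun j _ => (hr.unit_iterate hS N (j + 1)).integral_sub_sq hp P,
      Finset.sum_add_distrib, Finset.sum_sub_distrib, ← Finset.mul_sum, hr.sum_sq hS hN,
      hr.sum_integral_mul_invariant hS hN hp hpinv, h1, Finset.sum_const, Finset.card_range,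
      nsmul_eq_mul, meanEnergy]
    field_simp
    ring
  refine squeeze_zero' (g := fun N => meanEnergy S P' r N - ρ) (Eventually.of_forall fun N =>
    div_nonneg (Finset.sum_nonneg fun j _ => integral_nonneg fun w => sq_nonneg _)
      (Nat.cast_nonneg N)) ?_ ?_
  · filter_upwards [eventually_gt_atTop 0] with N hN
    rw [hexp N hN]
    linarith
  · have := hlim.sub_const ρ
    rwa [sub_self] at this

end InvariantLimit

/-! ### Uniform random times and a modulus for the entropy function. -/

section Uniform

/-- The uniform law on `{0, …, n}`. -/
noncomputable def meanLaw (n : ℕ) : Measure ℕ :=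
  ((n : ℝ≥0∞) + 1)⁻¹ • ∑ j ∈ Finset.range (n + 1), Measure.dirac j

theorem lintegral_meanLaw (n : ℕ) (f : ℕ → ℝ≥0∞) :
    ∫⁻ j, f j ∂meanLaw n = ((n : ℝ≥0∞) + 1)⁻¹ * ∑ j ∈ Finset.range (n + 1), f j := by
  simp [meanLaw, lintegral_finsetSum_measure]

theorem natCast_add_one_inv_mul (n : ℕ) : ((n : ℝ≥0∞) + 1)⁻¹ * ((n : ℝ≥0∞) + 1) = 1 :=
  ENNReal.inv_mul_cancel (by simp) (by simp)

instance (n : ℕ) : IsProbabilityMeasure (meanLaw n) := ⟨by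
  have := lintegral_meanLaw n 1
  simp only [Pi.one_apply, lintegral_one, Finset.sum_const, Finset.card_range, nsmul_eq_mul,
    mul_one, Nat.cast_add, Nat.cast_one] at this
  rw [this, natCast_add_one_inv_mul]⟩

theorem lintegral_meanLaw_ofReal (n : ℕ) {f : ℕ → ℝ} (hf : ∀ j, 0 ≤ f j) :
    ∫⁻ j, ENNReal.ofReal (f j) ∂meanLaw n
      = ENNReal.ofReal ((∑ j ∈ Finset.range (n + 1), f j) / ((n + 1 : ℕ) : ℝ)) := by
  have h1 : (0 : ℝ) < ((n + 1 : ℕ) : ℝ) := Nat.cast_pos.2 n.succ_pos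
  rw [lintegral_meanLaw, ← ENNReal.ofReal_sum_of_nonneg fun j _ => hf j, div_eq_inv_mul,
    ENNReal.ofReal_mul (inv_nonneg.2 h1.le), ENNReal.ofReal_inv_of_pos h1, ENNReal.ofReal_natCast]
  push_cast
  rfl

/-- A quadratic modulus of continuity for the entropy function. -/
theorem exists_negMulLog_le {ε : ℝ} (hε : 0 < ε) :
    ∃ C, 0 ≤ C ∧ ∀ a ∈ Set.Icc (0 : ℝ) 1, ∀ b ∈ Set.Icc (0 : ℝ) 1,
      Real.negMulLog b ≤ Real.negMulLog a + ε + C * (a - b) ^ 2 := by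
  have hc : ContinuousOn Real.negMulLog (Set.Icc 0 1) := Real.continuous_negMulLog.continuousOn
  obtain ⟨B, hB⟩ := isCompact_Icc.exists_bound_of_continuousOn hc
  have huc := isCompact_Icc.uniformContinuousOn_of_continuous hc
  obtain ⟨δ, hδ, h⟩ := Metric.uniformContinuousOn_iff.1 huc ε hε
  have hB0 : 0 ≤ B := (norm_nonneg _).trans (hB 0 (by simp))
  refine ⟨B / δ ^ 2, by positivity, fun a ha b hb => ?_⟩
  have ha0 := Real.negMulLog_nonneg ha.1 ha.2
  -- Nearby points are handled by uniform continuity; for distant points the quadratic term alone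
  -- dominates the supremum `B` of the entropy function.
  by_cases hd : dist a b < δ
  · have h1 := h a ha b hb hd
    rw [Real.dist_eq, abs_lt] at h1
    have : 0 ≤ B / δ ^ 2 * (a - b) ^ 2 := by positivity
    linarith [h1.1]
  · have h1 : δ ^ 2 ≤ (a - b) ^ 2 := by
      rw [← sq_abs (a - b)]
      exact pow_le_pow_left₀ hδ.le (not_lt.1 hd) 2
    have h2 : B ≤ B / δ ^ 2 * (a - b) ^ 2 := by
      rw [div_mul_eq_mul_div, le_div_iff₀ (by positivity)]
      exact mul_le_mul_of_nonneg_left h1 hB0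
    have h3 := (le_abs_self _).trans (hB b hb)
    linarith

end Uniform

/-! ### Entropy given the invariant sets is bounded by entropies at uniform times. -/

section LowerBound

variable {G : Type*} [Group G] [Countable G] [MeasurableSpace G] [DiscreteMeasurableSpace G]
variable {X : Type*} [MeasurableSpace X] [MulAction G X] [MeasurableConstSMul G X]
variable {μ : Measure G} [IsProbabilityMeasure μ] {η : Measure X} [IsProbabilityMeasure η]
  {L : SubgroupMap G X} {Q : Kernel X (ℕ → G)} [IsMarkovKernel Q]

theorem unitFun_toReal {α : Type*} [MeasurableSpace α] {r : α → ℝ≥0∞} (hr : Measurable r)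
    (hr1 : ∀ w, r w ≤ 1) : UnitFun fun w => (r w).toReal :=
  ⟨hr.ennreal_toReal, fun _ => ENNReal.toReal_nonneg,
    fun w => ENNReal.toReal_mono ENNReal.one_ne_top (hr1 w)⟩

theorem UnitFun.ofReal_integral {α : Type*} [MeasurableSpace α] {f : α → ℝ} (hf : UnitFun f)
    (m : Measure α) [IsFiniteMeasure m] :
    ENNReal.ofReal (∫ w, f w ∂m) = ∫⁻ w, ENNReal.ofReal (f w) ∂m :=
  ofReal_integral_eq_lintegral_ofReal (hf.integrable m) (ae_of_all _ hf.nonneg)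

/-- `meanLaw n` is uniform on `n + 1` times, hence the index `N - 1` for an average of `N` shifts.
-/
theorem IsFiberWalk.isAverageDensity (hQ : IsFiberWalk μ η L Q) (g : G) :
    IsAverageDensity (CosetPath.shift L) ((η ⊗ₘ Q).map (toCosetPath L))
      (firstCosetLaw L (η ⊗ₘ Q) g)
      (fun N w => (posteriorAt L Q (meanLaw (N - 1)) g w).toReal) := by
  have hu : ∀ N, UnitFun fun w => (posteriorAt L Q (meanLaw (N - 1)) g w).toReal := fun N =>
    unitFun_toReal (measurable_posteriorAt L Q _ g) (posteriorAt_le_one L Q _ g)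
  refine ⟨hu, fun N hN f hf => ?_⟩
  obtain ⟨n, rfl⟩ : ∃ n, N = n + 1 := ⟨N - 1, by omega⟩
  simp only [Nat.add_sub_cancel] at hu ⊢
  have hS := measurable_shift L
  have hm := measurable_posteriorAt L Q (meanLaw n) g
  have hn0 : ((n : ℝ≥0∞) + 1)⁻¹ ≠ 0 := by simp
  have hnt : ((n : ℝ≥0∞) + 1)⁻¹ ≠ ∞ := by simp
  have h := (hQ.isDensity (meanLaw n) g).lintegral_mul
    (f := fun w => ENNReal.ofReal (f w)) hf.measurable.ennreal_ofReal
  rw [lintegral_randomShift (f := fun w => posteriorAt L Q (meanLaw n) g w * ENNReal.ofReal (f w))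
    hS _ _ (hm.mul hf.measurable.ennreal_ofReal),
    lintegral_randomShift hS _ _ hf.measurable.ennreal_ofReal, lintegral_meanLaw,
    lintegral_meanLaw, ENNReal.mul_right_inj hn0 hnt] at h
  have hu1 : ∀ j, UnitFun fun w =>
      (posteriorAt L Q (meanLaw n) g ((CosetPath.shift L)^[j + 1] w)).toReal
        * f ((CosetPath.shift L)^[j + 1] w) := fun j =>
    ((hu (n + 1)).mul hf).comp (hS.iterate (j + 1))
  have hu2 : ∀ j, UnitFun fun w => f ((CosetPath.shift L)^[j + 1] w) := fun j =>
    hf.comp (hS.iterate (j + 1))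
  refine (ENNReal.ofReal_eq_ofReal_iff
    (Finset.sum_nonneg fun j _ => integral_nonneg (hu1 j).nonneg)
    (Finset.sum_nonneg fun j _ => integral_nonneg (hu2 j).nonneg)).1 ?_
  rw [ENNReal.ofReal_sum_of_nonneg fun j _ => integral_nonneg (hu1 j).nonneg,
    ENNReal.ofReal_sum_of_nonneg fun j _ => integral_nonneg (hu2 j).nonneg,
    Finset.sum_congr rfl fun j _ => (hu1 j).ofReal_integral _,
    Finset.sum_congr rfl fun j _ => (hu2 j).ofReal_integral _, ← h]
  refine Finset.sum_congr rfl fun j _ => lintegral_congr fun w => ?_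
  rw [ENNReal.ofReal_mul ENNReal.toReal_nonneg, ENNReal.ofReal_toReal
    (ne_top_of_le_ne_top ENNReal.one_ne_top (posteriorAt_le_one L Q _ g _))]

theorem firstCosetLaw_univ_le (g : G) : firstCosetLaw L (η ⊗ₘ Q) g Set.univ ≤ 1 := by
  rw [← measure_univ (μ := η ⊗ₘ Q), ← tsum_firstCosetLaw_univ (L := L)]
  exact ENNReal.le_tsum g

/-- Lower semicontinuity: entropy given the invariant sets is controlled by the entropies given
the coset at a uniform random time. -/
theorem IsFiberWalk.eventually_lintegral_nlog_le (hQ : IsFiberWalk μ η L Q) (g : G)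
    {p : CosetPath L → ℝ≥0∞} (hp : Measurable[invariantField L] p) (hp1 : ∀ w, p w ≤ 1)
    (hpd : ∀ f : CosetPath L → ℝ≥0∞, Measurable[invariantField L] f →
      ∫⁻ w, p w * f w ∂((η ⊗ₘ Q).map (toCosetPath L)) = ∫⁻ w, f w ∂(firstCosetLaw L (η ⊗ₘ Q) g))
    {ε : ℝ} (hε : 0 < ε) :
    ∀ᶠ n : ℕ in atTop, ∫⁻ w, p w * nlog (p w) ∂((η ⊗ₘ Q).map (toCosetPath L))
      ≤ ∫⁻ j, ∫⁻ q, posteriorAt L Q (meanLaw n) g (futureCosets L (j + 1) q)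
          * nlog (posteriorAt L Q (meanLaw n) g (futureCosets L (j + 1) q)) ∂(η ⊗ₘ Q) ∂meanLaw n
        + ENNReal.ofReal ε := by
  have hS := measurable_shift L
  have hpm : Measurable p := hp.mono (MeasurableSpace.invariants_le _) le_rfl
  have hpinv : ∀ w, p (CosetPath.shift L w) = p w := fun w =>
    congrFun (MeasurableSpace.comp_eq_of_measurable_invariants hp) w
  have hpu := unitFun_toReal hpm hp1
  have hconv := (hQ.isAverageDensity g).tendsto_mean_sq hS (firstCosetLaw_univ_le g) hpu
    (fun w => by rw [hpinv]) fun f hf hfinv => by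
      have hfm : Measurable[invariantField L] fun w => ENNReal.ofReal (f w) :=
        MeasurableSpace.measurable_invariants_dom.2 ⟨hf.measurable.ennreal_ofReal, fun s _ => by
          ext w; simp [hfinv]⟩
      have h := hpd _ hfm
      refine (ENNReal.ofReal_eq_ofReal_iff (integral_nonneg (hpu.mul hf).nonneg)
        (integral_nonneg hf.nonneg)).1 ?_
      rw [(hpu.mul hf).ofReal_integral, hf.ofReal_integral, ← h]
      refine lintegral_congr fun w => ?_
      rw [ENNReal.ofReal_mul ENNReal.toReal_nonneg,
        ENNReal.ofReal_toReal (ne_top_of_le_ne_top ENNReal.one_ne_top (hp1 w))]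
  -- Half of `ε` goes to the modulus of the entropy function, half to `C` times the mean square
  -- error between the posterior and the invariant density.
  obtain ⟨C, hC, hmod⟩ := exists_negMulLog_le (half_pos hε)
  have hconv2 := ((tendsto_add_atTop_iff_nat 1).2 hconv).const_mul C
  rw [mul_zero] at hconv2
  filter_upwards [hconv2.eventually_lt_const (half_pos hε)] with n hn
  simp only [Nat.add_sub_cancel] at hn
  have hm := measurable_posteriorAt L Q (meanLaw n) g
  have hru : UnitFun fun w => (posteriorAt L Q (meanLaw n) g w).toReal :=
    unitFun_toReal hm (posteriorAt_le_one L Q _ g)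
  set P := (η ⊗ₘ Q).map (toCosetPath L) with hP
  set r := posteriorAt L Q (meanLaw n) g with hr
  have hphi : Measurable fun w => r w * nlog (r w) := hm.mul (measurable_nlog.comp hm)
  have hphi' : ∀ j : ℕ, Measurable fun w =>
      r ((CosetPath.shift L)^[j + 1] w) * nlog (r ((CosetPath.shift L)^[j + 1] w)) := fun j =>
    hphi.comp (hS.iterate (j + 1))
  set d : ℕ → CosetPath L → ℝ := fun j w =>
    ((r ((CosetPath.shift L)^[j + 1] w)).toReal - (p w).toReal) ^ 2 with hd
  have hdm : ∀ j, Measurable (d j) := fun j =>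
    (((hru.comp (hS.iterate (j + 1))).measurable).sub hpu.measurable).pow_const 2
  have hdi : ∀ j, Integrable (d j) P := fun j =>
    .of_bound (hdm j).aestronglyMeasurable 1 (ae_of_all _ fun w => by
      rw [Real.norm_eq_abs, abs_of_nonneg (sq_nonneg _)]
      refine (sq_le_one_iff_abs_le_one _).2 (abs_le.2 ⟨?_, ?_⟩)
      · linarith [hru.nonneg ((CosetPath.shift L)^[j + 1] w), hpu.le_one w]
      · linarith [hru.le_one ((CosetPath.shift L)^[j + 1] w), hpu.nonneg w])
  have h1 : ∀ j : ℕ, ∫⁻ w, p w * nlog (p w) ∂P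
      ≤ ∫⁻ w, r ((CosetPath.shift L)^[j + 1] w) * nlog (r ((CosetPath.shift L)^[j + 1] w)) ∂P
        + ENNReal.ofReal (ε / 2 + C * ∫ w, d j w ∂P) := fun j => by
    have h2 : ENNReal.ofReal (ε / 2 + C * ∫ w, d j w ∂P)
        = ∫⁻ w, ENNReal.ofReal (ε / 2 + C * d j w) ∂P := by
      rw [← ofReal_integral_eq_lintegral_ofReal (f := fun w => ε / 2 + C * d j w)
        ((integrable_const (ε / 2)).add ((hdi j).const_mul C)) (ae_of_all _ fun w => by
          have : 0 ≤ d j w := sq_nonneg _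
          simp only [Pi.zero_apply]
          positivity)]
      congr 1
      rw [← integral_const_mul]
      have := integral_add (μ := P) (integrable_const (ε / 2)) ((hdi j).const_mul C)
      rw [integral_const, probReal_univ, one_smul] at this
      exact this.symm
    rw [h2, ← lintegral_add_left (hphi' j)]
    refine lintegral_mono fun w => ?_
    have h0 : 0 ≤ d j w := sq_nonneg _
    rw [← ofReal_negMulLog (hp1 w), ← ofReal_negMulLog (posteriorAt_le_one L Q _ g _),
      ← ENNReal.ofReal_add (Real.negMulLog_nonneg (hru.nonneg _) (hru.le_one _)) (by positivity)]
    refine ENNReal.ofReal_le_ofReal ?_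
    have := hmod _ ⟨hru.nonneg ((CosetPath.shift L)^[j + 1] w), hru.le_one _⟩ _
      ⟨hpu.nonneg w, hpu.le_one w⟩
    rw [add_assoc] at this
    exact this
  have hd0 : ∀ j, 0 ≤ ∫ w, d j w ∂P := fun j => integral_nonneg fun w => sq_nonneg _
  calc ∫⁻ w, p w * nlog (p w) ∂P = ∫⁻ _, ∫⁻ w, p w * nlog (p w) ∂P ∂meanLaw n := by
        rw [lintegral_const, measure_univ, mul_one]
    _ ≤ ∫⁻ j, (∫⁻ w, r ((CosetPath.shift L)^[j + 1] w) * nlog (r ((CosetPath.shift L)^[j + 1] w)) ∂P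
        + ENNReal.ofReal (ε / 2 + C * ∫ w, d j w ∂P)) ∂meanLaw n := lintegral_mono fun j => h1 j
    _ = ∫⁻ j, ∫⁻ w, r ((CosetPath.shift L)^[j + 1] w) * nlog (r ((CosetPath.shift L)^[j + 1] w)) ∂P
          ∂meanLaw n
        + ENNReal.ofReal ((∑ j ∈ Finset.range (n + 1), (ε / 2 + C * ∫ w, d j w ∂P))
          / ((n + 1 : ℕ) : ℝ)) := by
        rw [lintegral_add_left Measurable.of_discrete, lintegral_meanLaw_ofReal n fun j => by
          have := hd0 j
          positivity]
    _ ≤ _ := by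
        refine add_le_add (le_of_eq ?_) (ENNReal.ofReal_le_ofReal ?_)
        · rw [← lintegral_randomShift hS _ _ hphi, lintegral_randomShift_toCosetPath _ _ hphi]
        · have hpos : (0 : ℝ) < ((n + 1 : ℕ) : ℝ) := Nat.cast_pos.2 n.succ_pos
          rw [Finset.sum_add_distrib, ← Finset.mul_sum, Finset.sum_const, Finset.card_range,
            nsmul_eq_mul, add_div, mul_div_cancel_left₀ _ hpos.ne', mul_div_assoc]
          linarith

/-- Convergence is not uniform in `g`, so only finitely many steps are treated at once, with `ε`
shared among them. The bound `c` on the full sums passes to the supremum of the partial sums. -/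
theorem IsFiberWalk.tsum_lintegral_nlog_le (hQ : IsFiberWalk μ η L Q)
    {p : G → CosetPath L → ℝ≥0∞} (hp : ∀ g, Measurable[invariantField L] (p g))
    (hp1 : ∀ g w, p g w ≤ 1)
    (hpd : ∀ (g : G) (f : CosetPath L → ℝ≥0∞), Measurable[invariantField L] f →
      ∫⁻ w, p g w * f w ∂((η ⊗ₘ Q).map (toCosetPath L)) = ∫⁻ w, f w ∂(firstCosetLaw L (η ⊗ₘ Q) g))
    {c : ℝ≥0∞} (hc : ∀ n, stepEntropy η L Q (meanLaw n) ≤ c) :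
    ∑' g, ∫⁻ w, p g w * nlog (p g w) ∂((η ⊗ₘ Q).map (toCosetPath L)) ≤ c := by
  rw [ENNReal.tsum_eq_iSup_sum]
  refine iSup_le fun s => ENNReal.le_of_forall_pos_le_add fun ε hε _ => ?_
  have hpos : (0 : ℝ) < ε / ((s.card : ℝ) + 1) := by positivity
  obtain ⟨n, hn⟩ := ((eventually_all_finset s).2 fun g _ =>
    hQ.eventually_lintegral_nlog_le g (hp g) (hp1 g) (hpd g) hpos).exists
  refine (Finset.sum_le_sum hn).trans ?_
  rw [Finset.sum_add_distrib, Finset.sum_const]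
  refine add_le_add ((ENNReal.sum_le_tsum s).trans (hc n)) ?_
  rw [nsmul_eq_mul, ← ENNReal.ofReal_natCast, ← ENNReal.ofReal_mul (Nat.cast_nonneg _)]
  refine (ENNReal.ofReal_le_ofReal ?_).trans_eq (ENNReal.ofReal_coe_nnreal (p := ε))
  rw [mul_div_assoc', div_le_iff₀ (by positivity)]
  nlinarith [ε.coe_nonneg]

end LowerBound

/-! ### Comparing uniform times with deterministic times. -/

section TimeEntropy

variable {G : Type*} [Group G] [Countable G] [MeasurableSpace G] [DiscreteMeasurableSpace G]
variable {X : Type*} [MeasurableSpace X] [MulAction G X] [MeasurableConstSMul G X]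
variable {μ : Measure G} [IsProbabilityMeasure μ] {η : Measure X} [IsProbabilityMeasure η]
  {L : SubgroupMap G X} {Q : Kernel X (ℕ → G)} [IsMarkovKernel Q]

theorem preimage_rightCoset (H : Subgroup G) (h : G) :
    rightCoset H ⁻¹' {rightCoset H h} = rightCoset H h := by
  ext k
  refine ⟨fun hk => ?_, fun hk => rightCoset_eq_of_mem hk⟩
  have : rightCoset H k = rightCoset H h := hk
  rw [← this]
  exact mem_rightCoset_self H k

theorem timeEntropy_eq (b : Measure ℕ) [IsProbabilityMeasure b] :
    timeEntropy η L Q b = ∫⁻ j, ∫⁻ x, ∫⁻ ω, nlog (posLaw Q b x (rightCoset (L.toFun x) (ω j)))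
      ∂Q x ∂η ∂b := by
  refine lintegral_congr fun j => ?_
  rw [Measure.lintegral_compProd (f := fun p : X × (ℕ → G) =>
    nlog (posLaw Q b p.1 (rightCoset (L.toFun p.1) (p.2 j))))
    (measurable_nlog.comp (measurable_kernel_coset L _ _))]

theorem lintegral_posLaw_dirac (j : ℕ) (x : X) (F : G → ℝ≥0∞) :
    ∫⁻ h, F h ∂(posLaw Q (Measure.dirac j) x) = ∫⁻ ω, F (ω j) ∂Q x := by
  rw [lintegral_posLaw, lintegral_dirac]

theorem shannonEntropy_coset (j : ℕ) (x : X) :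
    shannonEntropy ((Q x).map fun ω => rightCoset (L.toFun x) (ω j))
      = ∫⁻ ω, nlog (posLaw Q (Measure.dirac j) x (rightCoset (L.toFun x) (ω j))) ∂Q x := by
  have hev : Measurable fun ω : ℕ → G => ω j := measurable_pi_apply j
  have h1 : posLaw Q (Measure.dirac j) x = (Q x).map fun ω => ω j := by
    refine Measure.ext_of_lintegral _ fun f hf => ?_
    rw [lintegral_posLaw_dirac, lintegral_map hf hev]
  have h2 : ((Q x).map fun ω => rightCoset (L.toFun x) (ω j))
      = (posLaw Q (Measure.dirac j) x).map (rightCoset (L.toFun x)) := by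
    rw [h1, Measure.map_map Measurable.of_discrete hev]
    rfl
  rw [h2, shannonEntropy_map, lintegral_posLaw_dirac]
  simp only [preimage_rightCoset]

theorem measurable_shannonEntropy_coset (L : SubgroupMap G X) (Q : Kernel X (ℕ → G))
    [IsMarkovKernel Q] (j : ℕ) :
    Measurable fun x => shannonEntropy ((Q x).map fun ω => rightCoset (L.toFun x) (ω j)) := by
  simp only [shannonEntropy_coset]
  exact Measurable.lintegral_kernel_prod_right' (κ := Q) (f := fun p : X × (ℕ → G) =>
    nlog (posLaw Q (Measure.dirac j) p.1 (rightCoset (L.toFun p.1) (p.2 j))))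
    (measurable_nlog.comp (measurable_kernel_coset L _ _))

theorem timeEntropy_dirac (j : ℕ) :
    timeEntropy η L Q (Measure.dirac j)
      = ∫⁻ x, shannonEntropy ((Q x).map fun ω => rightCoset (L.toFun x) (ω j)) ∂η := by
  rw [timeEntropy_eq, lintegral_dirac]
  exact lintegral_congr fun x => (shannonEntropy_coset j x).symm

/-- Entropy is a concave function of the law of the time. -/
theorem lintegral_timeEntropy_dirac_le (b : Measure ℕ) [IsProbabilityMeasure b] :
    ∫⁻ j, timeEntropy η L Q (Measure.dirac j) ∂b ≤ timeEntropy η L Q b := by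
  rw [timeEntropy_eq]
  refine lintegral_mono fun j => ?_
  rw [timeEntropy_eq, lintegral_dirac]
  refine lintegral_mono fun x => ?_
  have h := lintegral_nlog_fiber_le (posLaw Q (Measure.dirac j) x) (posLaw Q b x)
    (rightCoset (L.toFun x))
  simp only [preimage_rightCoset] at h
  rwa [lintegral_posLaw_dirac, lintegral_posLaw_dirac] at h

/-- The law at a random time dominates `b {j}` times the law at time `j`, so its information is at
most the sum of the two. This serves to keep the entropy at uniform times finite. -/
theorem timeEntropy_le (b : Measure ℕ) [IsProbabilityMeasure b] :
    timeEntropy η L Q b ≤ ∫⁻ j, (nlog (b {j}) + timeEntropy η L Q (Measure.dirac j)) ∂b := by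
  rw [timeEntropy_eq]
  refine lintegral_mono fun j => ?_
  have h1 : ∀ x (s : Set G), b {j} * posLaw Q (Measure.dirac j) x s ≤ posLaw Q b x s :=
    fun x s => by
      have hs : MeasurableSet s := MeasurableSet.of_discrete
      rw [← lintegral_indicator_one hs, ← lintegral_indicator_one hs, lintegral_posLaw_dirac,
        lintegral_posLaw, lintegral_countable' (μ := b), mul_comm]
      exact ENNReal.le_tsum (f := fun i => (∫⁻ ω, s.indicator 1 (ω i) ∂Q x) * b {i}) j
  have h2 : ∀ (x : X) (ω : ℕ → G), nlog (posLaw Q b x (rightCoset (L.toFun x) (ω j)))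
      ≤ nlog (b {j}) + nlog (posLaw Q (Measure.dirac j) x (rightCoset (L.toFun x) (ω j))) :=
    fun x ω => by
      rw [← nlog_mul prob_le_one prob_le_one]
      exact nlog_antitone (h1 x _) prob_le_one
  refine (lintegral_mono fun x => lintegral_mono fun ω => h2 x ω).trans_eq ?_
  simp only [lintegral_add_left measurable_const, lintegral_const, measure_univ, mul_one]
  rw [timeEntropy_eq, lintegral_dirac]

theorem IsFiberWalk.timeEntropy_dirac_zero (hQ : IsFiberWalk μ η L Q) :
    timeEntropy η L Q (Measure.dirac 0) = 0 := by
  rw [timeEntropy_eq, lintegral_dirac]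
  refine (lintegral_congr_ae ?_).trans lintegral_zero
  filter_upwards [Measure.ae_ae_of_ae_compProd hQ.step.ae_zero] with x hx
  refine (lintegral_congr_ae ?_).trans lintegral_zero
  filter_upwards [hx] with ω hω
  have h1 : posLaw Q (Measure.dirac 0) x (rightCoset (L.toFun x) (ω 0)) = 1 := by
    have hs : MeasurableSet (rightCoset (L.toFun x) (ω 0)) := MeasurableSet.of_discrete
    rw [← lintegral_indicator_one hs, lintegral_posLaw_dirac,
      ← lintegral_one.trans (measure_univ (μ := Q x))]
    refine lintegral_congr_ae ?_
    filter_upwards [hx] with ω' hω'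
    have h2 : ω 0 = 1 := hω
    have h3 : ω' 0 = 1 := hω'
    rw [h2, h3, Set.indicator_of_mem (mem_rightCoset_self _ _)]
    rfl
  rw [h1, nlog_one]

theorem succLaw_dirac (j : ℕ) : succLaw (Measure.dirac j) = Measure.dirac (j + 1) :=
  Measure.map_dirac j

theorem IsFiberWalk.stepEntropy_dirac_mono (hQ : IsFiberWalk μ η L Q) :
    Monotone fun n => stepEntropy η L Q (Measure.dirac n) :=
  monotone_nat_of_le_succ fun n => by
    rw [← succLaw_dirac]
    exact hQ.stepEntropy_le_succ _

theorem IsFiberWalk.stepEntropy_dirac_add (hQ : IsFiberWalk μ η L Q) (n : ℕ) :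
    stepEntropy η L Q (Measure.dirac n) + timeEntropy η L Q (Measure.dirac (n + 1))
      = baseEntropy η Q + timeEntropy η L Q (Measure.dirac n) := by
  rw [← succLaw_dirac]
  exact hQ.stepEntropy_add_timeEntropy _

/-- The chain rule telescopes from the deterministic position at time `0`. -/
theorem IsFiberWalk.sum_stepEntropy_dirac (hQ : IsFiberWalk μ η L Q) (n : ℕ) :
    ∑ i ∈ Finset.range n, stepEntropy η L Q (Measure.dirac i)
      + timeEntropy η L Q (Measure.dirac n) = n * baseEntropy η Q := by
  induction n with
  | zero => simp [hQ.timeEntropy_dirac_zero]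
  | succ n ih =>
    rw [Finset.sum_range_succ, add_assoc, hQ.stepEntropy_dirac_add, add_left_comm, ih]
    push_cast
    ring

theorem IsFiberWalk.timeEntropy_dirac_ne_top (hQ : IsFiberWalk μ η L Q)
    (hB : baseEntropy η Q ≠ ∞) (n : ℕ) : timeEntropy η L Q (Measure.dirac n) ≠ ∞ :=
  ne_top_of_le_ne_top (ENNReal.mul_ne_top (ENNReal.natCast_ne_top n) hB)
    (le_add_self.trans (hQ.sum_stepEntropy_dirac n).le)

theorem meanLaw_singleton_ne_zero {n j : ℕ} (hj : j ∈ Finset.range (n + 1)) :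
    meanLaw n {j} ≠ 0 := by
  have h : meanLaw n {j} = ∫⁻ i, ({j} : Set ℕ).indicator 1 i ∂meanLaw n :=
    (lintegral_indicator_one (measurableSet_singleton j)).symm
  rw [h, lintegral_meanLaw]
  refine mul_ne_zero (by simp) fun h0 => ?_
  have := (Finset.sum_eq_zero_iff.1 h0) j hj
  simp at this

theorem nlog_ne_top {t : ℝ≥0∞} (ht : t ≠ 0) : nlog t ≠ ∞ := by
  rw [nlog_of_ne_zero ht]
  exact ENNReal.ofReal_ne_top

theorem IsFiberWalk.timeEntropy_meanLaw_ne_top (hQ : IsFiberWalk μ η L Q)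
    (hB : baseEntropy η Q ≠ ∞) (n : ℕ) : timeEntropy η L Q (meanLaw n) ≠ ∞ := by
  refine ne_top_of_le_ne_top ?_ (timeEntropy_le _)
  rw [lintegral_meanLaw]
  refine ENNReal.mul_ne_top (by simp) (ENNReal.sum_ne_top.2 fun j hj => ?_)
  exact ENNReal.add_ne_top.2 ⟨nlog_ne_top (meanLaw_singleton_ne_zero hj),
    hQ.timeEntropy_dirac_ne_top hB j⟩

instance isProbabilityMeasure_iterate_succLaw (b : Measure ℕ) [IsProbabilityMeasure b] (n : ℕ) :
    IsProbabilityMeasure (succLaw^[n] b) := by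
  induction n with
  | zero => assumption
  | succ n ih => rw [Function.iterate_succ_apply']; infer_instance

theorem lintegral_iterate_succLaw (b : Measure ℕ) (n : ℕ) (f : ℕ → ℝ≥0∞) :
    ∫⁻ j, f j ∂(succLaw^[n] b) = ∫⁻ j, f (j + n) ∂b := by
  induction n generalizing f with
  | zero => rfl
  | succ n ih =>
    rw [Function.iterate_succ_apply', lintegral_succLaw, ih fun j => f (j + 1)]
    rfl

/-- The chain rule is iterated along the translates of `b`, each step entropy being bounded below by
the first one. The two claims are carried together through the induction. -/
theorem IsFiberWalk.mul_stepEntropy_add_le (hQ : IsFiberWalk μ η L Q) (b : Measure ℕ)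
    [IsProbabilityMeasure b] (n : ℕ) :
    stepEntropy η L Q b ≤ stepEntropy η L Q (succLaw^[n] b) ∧
    n * stepEntropy η L Q b + timeEntropy η L Q (succLaw^[n] b)
      ≤ n * baseEntropy η Q + timeEntropy η L Q b := by
  induction n with
  | zero => simp
  | succ n ih =>
    rw [Function.iterate_succ_apply']
    refine ⟨ih.1.trans (hQ.stepEntropy_le_succ _), ?_⟩
    push_cast
    calc ((n : ℝ≥0∞) + 1) * stepEntropy η L Q b + timeEntropy η L Q (succLaw (succLaw^[n] b))
        = n * stepEntropy η L Q b
          + (stepEntropy η L Q b + timeEntropy η L Q (succLaw (succLaw^[n] b))) := by ring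
      _ ≤ n * stepEntropy η L Q b + (stepEntropy η L Q (succLaw^[n] b)
          + timeEntropy η L Q (succLaw (succLaw^[n] b))) := by gcongr; exact ih.1
      _ = baseEntropy η Q + (n * stepEntropy η L Q b + timeEntropy η L Q (succLaw^[n] b)) := by
          rw [hQ.stepEntropy_add_timeEntropy]; ring
      _ ≤ baseEntropy η Q + (n * baseEntropy η Q + timeEntropy η L Q b) := add_le_add_right ih.2 _
      _ = _ := by ring

/-- The entropy of the first step given the coset at a uniform random time is at most the limit of
its entropies given the coset at a deterministic time. -/
theorem IsFiberWalk.stepEntropy_meanLaw_le (hQ : IsFiberWalk μ η L Q) (hB : baseEntropy η Q ≠ ∞)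
    {c : ℝ≥0∞} (hc : ∀ n, stepEntropy η L Q (Measure.dirac n) ≤ c) (m : ℕ) :
    stepEntropy η L Q (meanLaw m) ≤ c := by
  rcases eq_or_ne c ∞ with rfl | hct
  · exact le_top
  have hD : timeEntropy η L Q (meanLaw m) + m * c ≠ ∞ :=
    ENNReal.add_ne_top.2 ⟨hQ.timeEntropy_meanLaw_ne_top hB m,
      ENNReal.mul_ne_top (ENNReal.natCast_ne_top m) hct⟩
  -- If every `A_i ≤ c`, the entropy at time `j + n` is at least `(j + n)(B - c)`. Averaging over `j
  -- ≤ m` and using concavity bounds the entropy at the translated uniform time from below, stated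
  -- additively to avoid subtraction.
  have h1 : ∀ n : ℕ, (n : ℝ≥0∞) * baseEntropy η Q
      ≤ timeEntropy η L Q (succLaw^[n] (meanLaw m)) + (n + m) * c := fun n => by
    have h2 : ∀ j ∈ Finset.range (m + 1), (n : ℝ≥0∞) * baseEntropy η Q
        ≤ timeEntropy η L Q (Measure.dirac (j + n)) + (n + m) * c := fun j hj => by
      have hjm : j ≤ m := Nat.lt_succ_iff.1 (Finset.mem_range.1 hj)
      calc (n : ℝ≥0∞) * baseEntropy η Q ≤ ((j + n : ℕ) : ℝ≥0∞) * baseEntropy η Q := by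
            gcongr; omega
        _ = ∑ i ∈ Finset.range (j + n), stepEntropy η L Q (Measure.dirac i)
            + timeEntropy η L Q (Measure.dirac (j + n)) := (hQ.sum_stepEntropy_dirac _).symm
        _ ≤ ((j + n : ℕ) : ℝ≥0∞) * c + timeEntropy η L Q (Measure.dirac (j + n)) := by
            gcongr
            refine (Finset.sum_le_sum fun i _ => hc i).trans ?_
            rw [Finset.sum_const, Finset.card_range, nsmul_eq_mul]
        _ ≤ ((m + n : ℕ) : ℝ≥0∞) * c + timeEntropy η L Q (Measure.dirac (j + n)) := by gcongr
        _ = _ := by rw [add_comm, add_comm m n]; push_cast; rfl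
    have h3 : (n : ℝ≥0∞) * baseEntropy η Q
        ≤ ∫⁻ j, (timeEntropy η L Q (Measure.dirac (j + n)) + (n + m) * c) ∂meanLaw m := by
      rw [lintegral_meanLaw]
      calc (n : ℝ≥0∞) * baseEntropy η Q
          = ((m : ℝ≥0∞) + 1)⁻¹ * ∑ j ∈ Finset.range (m + 1), (n : ℝ≥0∞) * baseEntropy η Q := by
            rw [Finset.sum_const, Finset.card_range, nsmul_eq_mul, ← mul_assoc]
            push_cast
            rw [natCast_add_one_inv_mul, one_mul]
        _ ≤ _ := by gcongr with j hj; exact h2 j hj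
    refine h3.trans ?_
    rw [lintegral_add_right _ measurable_const, lintegral_const, measure_univ, mul_one,
      ← lintegral_iterate_succLaw (meanLaw m) n fun j => timeEntropy η L Q (Measure.dirac j)]
    exact add_le_add_left (lintegral_timeEntropy_dirac_le (η := η) (L := L) (Q := Q) _) _
  -- The upper bound from the iterated chain rule meets the lower bound `h1`. The term `n *
  -- baseEntropy` is finite and cancels, leaving an error independent of `n` that disappears after
  -- division by `n`.
  have h4 : ∀ n : ℕ, (n : ℝ≥0∞) * stepEntropy η L Q (meanLaw m)
      ≤ timeEntropy η L Q (meanLaw m) + m * c + n * c := fun n => by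
    have h5 : (n : ℝ≥0∞) * stepEntropy η L Q (meanLaw m) + n * baseEntropy η Q
        ≤ timeEntropy η L Q (meanLaw m) + m * c + n * c + n * baseEntropy η Q := by
      calc (n : ℝ≥0∞) * stepEntropy η L Q (meanLaw m) + n * baseEntropy η Q
          ≤ n * stepEntropy η L Q (meanLaw m)
            + (timeEntropy η L Q (succLaw^[n] (meanLaw m)) + (n + m) * c) := by
            gcongr; exact h1 n
        _ = n * stepEntropy η L Q (meanLaw m) + timeEntropy η L Q (succLaw^[n] (meanLaw m))
            + (n + m) * c := by ring
        _ ≤ n * baseEntropy η Q + timeEntropy η L Q (meanLaw m) + (n + m) * c :=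
          add_le_add_left (hQ.mul_stepEntropy_add_le (meanLaw m) n).2 _
        _ = _ := by ring
    exact ENNReal.le_of_add_le_add_right
      (ENNReal.mul_ne_top (ENNReal.natCast_ne_top n) hB) h5
  have hlim : Tendsto (fun n : ℕ => (timeEntropy η L Q (meanLaw m) + m * c) / (n : ℝ≥0∞) + c) atTop
      (𝓝 (0 + c)) := by
    refine Tendsto.add ?_ tendsto_const_nhds
    have := ENNReal.Tendsto.const_mul (a := timeEntropy η L Q (meanLaw m) + m * c)
      ENNReal.tendsto_inv_nat_nhds_zero (.inr hD)
    rwa [mul_zero] at this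
  rw [zero_add] at hlim
  refine ge_of_tendsto hlim ?_
  filter_upwards [eventually_gt_atTop 0] with n hn
  have hn0 : (n : ℝ≥0∞) ≠ 0 := Nat.cast_ne_zero.2 hn.ne'
  have hnt := ENNReal.natCast_ne_top n
  rw [← ENNReal.mul_le_mul_iff_right hn0 hnt, mul_add, ENNReal.mul_div_cancel hn0 hnt]
  exact h4 n

end TimeEntropy

/-! ### Furstenberg entropy and conditional entropy of the first step. -/

section Furstenberg

variable {α : Type*} [MeasurableSpace α]

/-- With `t` the density of `a • m'`, this is `a klFun(t / a) = t log(t / a) + a - t`, rearranged so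
that all terms are nonnegative. -/
theorem mul_klFun_add {a t : ℝ≥0∞} (ha0 : a ≠ 0) (ha : a ≤ 1) (ht : t ≤ 1) :
    a * ENNReal.ofReal (InformationTheory.klFun (a⁻¹ * t).toReal) + t * nlog t + t
      = t * nlog a + a := by
  have hat := ne_top_of_le_ne_top ENNReal.one_ne_top ha
  have htt := ne_top_of_le_ne_top ENNReal.one_ne_top ht
  have ha' := ENNReal.toReal_pos ha0 hat
  rcases eq_or_ne t 0 with rfl | ht0
  · simp [InformationTheory.klFun_zero]
  have ht' := ENNReal.toReal_pos ht0 htt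
  have h1 : ∀ {c : ℝ≥0∞}, c ≤ 1 → 0 ≤ -Real.log c.toReal := fun {c} hc =>
    neg_nonneg.2 (Real.log_nonpos ENNReal.toReal_nonneg
      (ENNReal.toReal_mono ENNReal.one_ne_top hc))
  have hk := InformationTheory.klFun_nonneg (x := (a⁻¹ * t).toReal) ENNReal.toReal_nonneg
  have h2 : t = ENNReal.ofReal t.toReal := (ENNReal.ofReal_toReal htt).symm
  have h3 : a = ENNReal.ofReal a.toReal := (ENNReal.ofReal_toReal hat).symm
  have h4 : a * ENNReal.ofReal (InformationTheory.klFun (a⁻¹ * t).toReal)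
      = ENNReal.ofReal (a.toReal * InformationTheory.klFun (a⁻¹ * t).toReal) := by
    rw [ENNReal.ofReal_mul ha'.le, ← h3]
  have h5 : t * ENNReal.ofReal (-Real.log t.toReal)
      = ENNReal.ofReal (t.toReal * -Real.log t.toReal) := by
    rw [ENNReal.ofReal_mul ht'.le, ← h2]
  have h6 : t * ENNReal.ofReal (-Real.log a.toReal)
      = ENNReal.ofReal (t.toReal * -Real.log a.toReal) := by
    rw [ENNReal.ofReal_mul ht'.le, ← h2]
  have h7 := mul_nonneg ha'.le hk
  have h8 := mul_nonneg ht'.le (h1 ht)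
  have h9 := mul_nonneg ht'.le (h1 ha)
  rw [nlog_of_ne_zero ht0, nlog_of_ne_zero ha0, h4, h5, h6]
  nth_rw 4 [h2]
  nth_rw 4 [h3]
  rw [← ENNReal.ofReal_add h7 h8, ← ENNReal.ofReal_add (add_nonneg h7 h8) ht'.le,
    ← ENNReal.ofReal_add h9 ha'.le]
  congr 1
  rw [InformationTheory.klFun, ENNReal.toReal_mul, ENNReal.toReal_inv,
    Real.log_mul (inv_ne_zero ha'.ne') ht'.ne', Real.log_inv]
  field_simp
  ring

/-- Kullback-Leibler divergence and the entropy of a density. -/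
theorem mul_klDiv_add {m m' : Measure α} [IsProbabilityMeasure m] [IsProbabilityMeasure m']
    {a : ℝ≥0∞} (ha : a ≤ 1) {r : α → ℝ≥0∞} (hr : IsDensity m (a • m') r) :
    a * InformationTheory.klDiv m' m + ∫⁻ z, r z * nlog (r z) ∂m = a * nlog a := by
  have hint : ∫⁻ z, r z ∂m = a := by
    have := hr.lintegral_mul (measurable_const (a := (1 : ℝ≥0∞)))
    simpa using this
  have hrn : Measurable fun z => nlog (r z) := measurable_nlog.comp hr.measurable
  rcases eq_or_ne a 0 with rfl | ha0
  · rw [lintegral_eq_zero_iff hr.measurable] at hint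
    simp only [zero_mul, zero_add]
    refine (lintegral_congr_ae ?_).trans lintegral_zero
    filter_upwards [hint] with z hz
    have : r z = 0 := hz
    rw [this, zero_mul]
  have hat := ne_top_of_le_ne_top ENNReal.one_ne_top ha
  have hm' : m' = m.withDensity fun z => a⁻¹ * r z := by
    have h1 : a⁻¹ • (a • m') = a⁻¹ • m.withDensity r := by rw [hr.withDensity_eq]
    rw [smul_smul, ENNReal.inv_mul_cancel ha0 hat, one_smul,
      ← withDensity_smul _ hr.measurable] at h1
    exact h1
  have hac : m' ≪ m := hm' ▸ withDensity_absolutelyContinuous _ _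
  have hrd : m'.rnDeriv m =ᵐ[m] fun z => a⁻¹ * r z := by
    conv_lhs => rw [hm']
    exact Measure.rnDeriv_withDensity _ (hr.measurable.const_mul _)
  have hkm : Measurable fun z =>
      ENNReal.ofReal (InformationTheory.klFun (a⁻¹ * r z).toReal) :=
    (InformationTheory.measurable_klFun.comp
      (hr.measurable.const_mul _).ennreal_toReal).ennreal_ofReal
  have hkl : InformationTheory.klDiv m' m
      = ∫⁻ z, ENNReal.ofReal (InformationTheory.klFun (a⁻¹ * r z).toReal) ∂m := by
    rw [InformationTheory.klDiv_eq_lintegral_klFun_of_ac hac]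
    refine lintegral_congr_ae ?_
    filter_upwards [hrd] with z hz
    rw [hz]
  have key : a * InformationTheory.klDiv m' m + ∫⁻ z, r z * nlog (r z) ∂m + ∫⁻ z, r z ∂m
      = a * nlog a + a := by
    rw [hkl, ← lintegral_const_mul _ hkm, ← lintegral_add_left (hkm.const_mul a),
      ← lintegral_add_right _ hr.measurable, lintegral_congr fun z => mul_klFun_add ha0 ha (hr.le_one z),
      lintegral_add_right _ measurable_const, lintegral_mul_const _ hr.measurable, hint,
      lintegral_const, measure_univ, mul_one]
  rw [hint] at key
  exact (ENNReal.add_left_inj hat).1 key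

variable {G : Type*} [Group G] [Countable G] [MeasurableSpace G] [DiscreteMeasurableSpace G]
variable {μ : Measure G} [IsProbabilityMeasure μ]

/-- Furstenberg entropy complements the conditional entropy of the first step. -/
theorem furstenbergEntropy_add [MulAction G α] [MeasurableConstSMul G α] {m : Measure α}
    [IsProbabilityMeasure m] {r : G → α → ℝ≥0∞}
    (hr : ∀ g, IsDensity m (μ {g} • m.map (g • ·)) (r g)) :
    furstenbergEntropy μ m + ∑' g, ∫⁻ z, r g z * nlog (r g z) ∂m = shannonEntropy μ := by
  rw [furstenbergEntropy, lintegral_countable', ← ENNReal.tsum_add, shannonEntropy_eq_lintegral,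
    lintegral_countable']
  refine tsum_congr fun g => ?_
  have : IsProbabilityMeasure (m.map (g • ·)) :=
    Measure.isProbabilityMeasure_map (measurable_const_smul g).aemeasurable
  rw [mul_comm, mul_klDiv_add prob_le_one (hr g), mul_comm]

end Furstenberg

/-! ### Entropy of the base and of the Poisson bundle. -/

section BundleEntropy

variable {G : Type*} [Group G] [Countable G] [MeasurableSpace G] [DiscreteMeasurableSpace G]
variable {X : Type*} [MeasurableSpace X] [MulAction G X] [MeasurableConstSMul G X]
variable {μ : Measure G} [IsProbabilityMeasure μ] {η : Measure X} [IsProbabilityMeasure η]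
  {L : SubgroupMap G X} {Q : Kernel X (ℕ → G)} [IsMarkovKernel Q]

/-- The complement of the entropy of the base. -/
theorem furstenbergEntropy_add_baseEntropy (hJ : IsStepInvariant μ (η ⊗ₘ Q)) :
    furstenbergEntropy μ η + baseEntropy η Q = shannonEntropy μ := by
  -- The density of `μ {g} • gη` with respect to `η` is the conditional probability that the first
  -- step is `g`.
  refine furstenbergEntropy_add fun g => .of_lintegral_mul
    (Q.measurable_coe (measurableSet_first g)) (fun x => prob_le_one) fun f hf => ?_
  have h1 := hJ.setLIntegral_first g (Ψ := fun p => f p.1) (hf.comp measurable_fst)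
  have h0 : Measurable fun p : X × (ℕ → G) => f p.1 := hf.comp measurable_fst
  rw [← lintegral_indicator (measurableSet_firstStep g), Measure.lintegral_compProd
    (h0.indicator (measurableSet_firstStep g)), Measure.lintegral_compProd (f := fun p : X × (ℕ → G) => f (g • p.1))
      ((hf.comp (measurable_const_smul g)).comp measurable_fst)] at h1
  rw [lintegral_smul_measure, lintegral_map hf (measurable_const_smul g)]
  simp only [lintegral_const, measure_univ, mul_one] at h1
  rw [smul_eq_mul, ← h1]
  refine lintegral_congr fun x => ?_
  have h2 : ∀ ω, ({p : X × (ℕ → G) | p.2 1 = g}).indicator (fun p => f p.1) (x, ω)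
      = ({ω : ℕ → G | ω 1 = g}).indicator (fun _ => f x) ω := fun ω => rfl
  exact ((lintegral_congr h2).trans (by
    rw [lintegral_indicator (measurableSet_first g), setLIntegral_const, mul_comm])).symm

theorem measurable_act (L : SubgroupMap G X) (g : G) : Measurable (CosetPath.act L g) := by
  refine Measurable.subtype_mk (f := fun w : CosetPath L => (g • w.1.1, fun n => g • w.1.2 n))
    (((measurable_fst.comp measurable_subtype_coe).const_smul g).prodMk
      (measurable_pi_lambda _ fun n => measurable_set_iff.2 fun h => ?_))
  have h1 : Measurable fun w : CosetPath L => w.1.2 n :=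
    (measurable_pi_apply n).comp (measurable_snd.comp measurable_subtype_coe)
  have h2 := measurable_set_iff.1 h1 (g⁻¹ * h)
  have h3 : (fun w : CosetPath L => h ∈ g • w.1.2 n) = fun w => g⁻¹ * h ∈ w.1.2 n :=
    funext fun w => by rw [Set.mem_smul_set_iff_inv_smul_mem, smul_eq_mul]
  exact h3 ▸ h2

theorem futureCosets_stepPath (L : SubgroupMap G X) (g : G) (p : X × (ℕ → G)) :
    futureCosets L 1 (g • p.1, stepPath g p.2) = CosetPath.act L g (toCosetPath L p) := by
  refine Subtype.ext (Prod.ext rfl (funext fun n => ?_))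
  simp only [futureCosets, toCosetPath, CosetPath.act, smul_rightCoset, add_comm 1 n,
    stepPath_succ]

theorem firstCosetLaw_le (J : Measure (X × (ℕ → G))) (g : G) :
    firstCosetLaw L J g ≤ J.map (toCosetPath L) :=
  Measure.map_mono Measure.restrict_le_self (measurable_toCosetPath L)

/-- On invariant sets, the trajectory law given the first step `g` is the translate by `g` of the
trajectory law. -/
theorem IsStepInvariant.firstCosetLaw_apply {J : Measure (X × (ℕ → G))}
    (hJ : IsStepInvariant μ J) (g : G) {A : Set (CosetPath L)}
    (hA : MeasurableSet[invariantField L] A) :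
    firstCosetLaw L J g A = μ {g} * J.map (toCosetPath L) (CosetPath.act L g ⁻¹' A) := by
  have hA' : MeasurableSet A := hA.1
  have hT := measurable_toCosetPath L
  have hinv : ∀ w, CosetPath.shift L w ∈ A ↔ w ∈ A := fun w => by
    rw [← Set.mem_preimage, hA.2]
  have h1 : Measurable fun p : X × (ℕ → G) =>
      A.indicator (1 : CosetPath L → ℝ≥0∞) (futureCosets L 1 p) :=
    (measurable_one.indicator hA').comp (measurable_futureCosets L 1)
  have h2 := hJ.setLIntegral_first g h1
  simp only [futureCosets_stepPath] at h2
  -- An invariant set cannot distinguish a trajectory from its shift, and after a first step `g` the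
  -- shifted trajectory is the translate by `g` of a fresh one.
  have h3 : ∀ p, A.indicator (1 : CosetPath L → ℝ≥0∞) (futureCosets L 1 p)
      = A.indicator 1 (toCosetPath L p) := fun p => by
    have h4 : futureCosets L 1 p = CosetPath.shift L (toCosetPath L p) :=
      (iterate_shift_toCosetPath L 1 p).symm
    rw [h4]
    by_cases hp : toCosetPath L p ∈ A
    · rw [Set.indicator_of_mem hp, Set.indicator_of_mem ((hinv _).2 hp)]; rfl
    · rw [Set.indicator_of_notMem hp, Set.indicator_of_notMem (mt (hinv _).1 hp)]
  simp only [h3] at h2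
  have hm1 : Measurable (A.indicator (1 : CosetPath L → ℝ≥0∞)) := measurable_one.indicator hA'
  rw [← lintegral_map hm1 hT, lintegral_indicator_one hA'] at h2
  rw [firstCosetLaw, h2, ← lintegral_indicator_one (measurable_act L g hA'),
    lintegral_map (measurable_one.indicator (measurable_act L g hA')) hT]
  rfl

/-- The Furstenberg entropy of a realisation of the invariant sets is complementary to the
entropy of the first step given the invariant sets. -/
theorem IsFiberWalk.exists_furstenbergEntropy_add (hQ : IsFiberWalk μ η L Q) {Z : Type*}
    [MeasurableSpace Z] [MulAction G Z] [MeasurableConstSMul G Z] {θ : CosetPath L → Z}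
    (hθ : AEMeasurable[invariantField L] θ
      (((η ⊗ₘ Q).map (toCosetPath L)).trim (MeasurableSpace.invariants_le (CosetPath.shift L))))
    (heq : ∀ g : G, ∀ᵐ w ∂((η ⊗ₘ Q).map (toCosetPath L)), θ (CosetPath.act L g w) = g • θ w)
    (hgen : ∀ A : Set (CosetPath L), MeasurableSet[invariantField L] A →
      ∃ B : Set Z, MeasurableSet B ∧ A =ᵐ[(η ⊗ₘ Q).map (toCosetPath L)] θ ⁻¹' B) :
    ∃ K, furstenbergEntropy μ (((η ⊗ₘ Q).map (toCosetPath L)).map θ) + K = shannonEntropy μ ∧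
      (∀ (b : Measure ℕ) [IsProbabilityMeasure b], stepEntropy η L Q b ≤ K) ∧
      ∀ c, (∀ n, stepEntropy η L Q (meanLaw n) ≤ c) → K ≤ c := by
  obtain ⟨θ', hθ', hae'⟩ := hθ
  set P := (η ⊗ₘ Q).map (toCosetPath L) with hP
  have hle : invariantField L ≤ _ := MeasurableSpace.invariants_le (CosetPath.shift L)
  have hθm : Measurable θ' := hθ'.mono hle le_rfl
  have hae : θ =ᵐ[P] θ' := ae_eq_of_ae_eq_trim hae'
  have hac : ∀ g, firstCosetLaw L (η ⊗ₘ Q) g ≪ P := fun g =>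
    Measure.absolutelyContinuous_of_le (firstCosetLaw_le _ g)
  rw [Measure.map_congr hae]
  have hprob : IsProbabilityMeasure (P.map θ') := Measure.isProbabilityMeasure_map hθm.aemeasurable
  have hfirst : ∀ g, (firstCosetLaw L (η ⊗ₘ Q) g).map θ' = μ {g} • (P.map θ').map (g • ·) :=
    fun g => by
      refine Measure.ext fun B hB => ?_
      rw [Measure.smul_apply, smul_eq_mul, Measure.map_apply hθm hB,
        Measure.map_apply (measurable_const_smul g) hB,
        Measure.map_apply hθm (measurable_const_smul g hB),
        hQ.step.firstCosetLaw_apply g (hθ' hB)]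
      rcases eq_or_ne (μ {g}) 0 with h0 | h0
      · simp [h0]
      -- The version `θ'` is only almost everywhere equal to `θ`, so equivariance also needs the
      -- preimage of the exceptional set under `g` to be null. The set can be enlarged to an
      -- invariant null set, to which `firstCosetLaw_apply` applies as `μ {g} ≠ 0`.
      have hz : P.trim hle {w | ¬ θ w = θ' w} = 0 := hae'
      obtain ⟨N, hNsub, hN, hN0⟩ :=
        @exists_measurable_superset_of_null _ (invariantField L) _ _ hz
      have hN1 : P N = 0 := by rwa [trim_measurableSet_eq hle hN] at hN0
      have hN2 : P (CosetPath.act L g ⁻¹' N) = 0 := by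
        have h1 := hQ.step.firstCosetLaw_apply g hN
        rw [hac g hN1] at h1
        exact (mul_eq_zero.1 h1.symm).resolve_left h0
      congr 1
      refine measure_congr ?_
      filter_upwards [heq g, hae, measure_eq_zero_iff_ae_notMem.1 hN2] with w h1 h2 h3
      have h4 : θ (CosetPath.act L g w) = θ' (CosetPath.act L g w) := by
        by_contra hne
        exact h3 (hNsub hne)
      have : (θ' (CosetPath.act L g w) ∈ B) = (g • θ' w ∈ B) := by rw [← h4, h1, h2]
      exact this
  have hden : ∀ g, ∃ t, IsDensity (P.map θ') ((firstCosetLaw L (η ⊗ₘ Q) g).map θ') t := fun g =>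
    exists_isDensity (Measure.map_mono (firstCosetLaw_le _ g) hθm)
  choose t ht using hden
  refine ⟨∑' g, ∫⁻ z, t g z * nlog (t g z) ∂(P.map θ'),
    furstenbergEntropy_add fun g => hfirst g ▸ ht g,
    fun b _ => hQ.stepEntropy_le_of_invariant b hθ' ht, fun c hc => ?_⟩
  have hpm : ∀ g, Measurable[invariantField L] fun w => t g (θ' w) := fun g =>
    (ht g).measurable.comp hθ'
  -- Every invariant set comes from `Z` modulo null sets, so the density on `Z`, pulled back, is the
  -- density on the whole invariant field.
  have hset : ∀ (g : G) (A : Set (CosetPath L)), MeasurableSet[invariantField L] A →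
      ∫⁻ w in A, t g (θ' w) ∂P = firstCosetLaw L (η ⊗ₘ Q) g A := fun g A hA => by
    obtain ⟨B, hB, hAB⟩ := hgen A hA
    have hAB' : A =ᵐ[P] θ' ⁻¹' B := by
      filter_upwards [hAB, hae] with w h1 h2
      have h3 : (w ∈ A) = (θ w ∈ B) := h1
      have : (w ∈ A) = (θ' w ∈ B) := by rw [h3, h2]
      exact this
    rw [setLIntegral_congr hAB', ← setLIntegral_map hB (ht g).measurable hθm,
      ← withDensity_apply _ hB, (ht g).withDensity_eq, Measure.map_apply hθm hB]
    exact (measure_congr ((hac g).ae_eq hAB')).symm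
  have key := hQ.tsum_lintegral_nlog_le (p := fun g w => t g (θ' w)) hpm
    (fun g w => (ht g).le_one _) (fun g f hf => ?_) hc
  · refine le_trans (le_of_eq (tsum_congr fun g => ?_)) key
    have hm : Measurable fun z => t g z * nlog (t g z) :=
      (ht g).measurable.mul (measurable_nlog.comp (ht g).measurable)
    exact lintegral_map hm hθm
  · have hpm' : Measurable fun w => t g (θ' w) := (hpm g).mono hle le_rfl
    have hf' : Measurable f := hf.mono hle le_rfl
    have htrim : (P.withDensity fun w => t g (θ' w)).trim hle
        = (firstCosetLaw L (η ⊗ₘ Q) g).trim hle := by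
      refine @Measure.ext _ (invariantField L) _ _ fun A hA => ?_
      rw [trim_measurableSet_eq hle hA, trim_measurableSet_eq hle hA, withDensity_apply _ (hle _ hA)]
      exact hset g A hA
    rw [← lintegral_trim hle hf, ← htrim, lintegral_trim hle hf,
      lintegral_withDensity_eq_lintegral_mul _ hpm' hf']
    rfl

end BundleEntropy

/-! ### Limits of increments and of averages. -/

section Asymptotics

theorem isGLB_range_of_tendsto {u : ℕ → ℝ} {l : ℝ} (h : ∀ n, l ≤ u n)
    (hu : Tendsto u atTop (𝓝 l)) : IsGLB (Set.range u) l :=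
  ⟨by rintro _ ⟨n, rfl⟩; exact h n, fun _ hb => ge_of_tendsto' hu fun n => hb ⟨n, rfl⟩⟩

/-- Convergence of the increments and of the averages of a concave sequence. -/
theorem tendsto_of_antitone_increments {T : ℕ → ℝ} {l : ℝ} (h0 : T 0 = 0)
    (hle : ∀ n, l ≤ T (n + 1) - T n) (hlim : Tendsto (fun n => T (n + 1) - T n) atTop (𝓝 l)) :
    Tendsto (fun n : ℕ => 1 / (n : ℝ) * T n) atTop (𝓝 l) ∧
      IsGLB (Set.range fun n : ℕ => 1 / ((n : ℝ) + 1) * T (n + 1)) l := by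
  have hsum : ∀ n, ∑ i ∈ Finset.range n, (T (i + 1) - T i) = T n := fun n => by
    rw [Finset.sum_range_sub, h0, sub_zero]
  have h1 : Tendsto (fun n : ℕ => 1 / (n : ℝ) * T n) atTop (𝓝 l) := by
    simpa only [hsum, one_div] using hlim.cesaro
  refine ⟨h1, isGLB_range_of_tendsto (fun n => ?_) ?_⟩
  · have h2 : ((n : ℝ) + 1) * l ≤ T (n + 1) := by
      rw [← hsum (n + 1)]
      have := Finset.sum_le_sum fun i (_ : i ∈ Finset.range (n + 1)) => hle i
      rw [Finset.sum_const, Finset.card_range, nsmul_eq_mul] at this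
      exact_mod_cast this
    rw [one_div, ← div_eq_inv_mul, le_div_iff₀ (by positivity), mul_comm]
    exact h2
  · have := h1.comp (tendsto_add_atTop_nat 1)
    refine this.congr fun n => ?_
    simp only [Function.comp, Nat.cast_add, Nat.cast_one]

variable {G : Type*} [Group G] [Countable G] [MeasurableSpace G] [DiscreteMeasurableSpace G]
variable {X : Type*} [MeasurableSpace X] [MulAction G X] [MeasurableConstSMul G X]
variable {μ : Measure G} [IsProbabilityMeasure μ] {η : Measure X} [IsProbabilityMeasure η]
  {L : SubgroupMap G X} {Q : Kernel X (ℕ → G)} [IsMarkovKernel Q]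

theorem IsFiberWalk.stepEntropy_dirac_ne_top (hQ : IsFiberWalk μ η L Q)
    (hB : baseEntropy η Q ≠ ∞) (n : ℕ) : stepEntropy η L Q (Measure.dirac n) ≠ ∞ :=
  ne_top_of_le_ne_top (ENNReal.add_ne_top.2 ⟨hB, hQ.timeEntropy_dirac_ne_top hB n⟩)
    (le_self_add.trans (hQ.stepEntropy_dirac_add n).le)

theorem IsFiberWalk.timeEntropy_dirac_sub (hQ : IsFiberWalk μ η L Q)
    (hB : baseEntropy η Q ≠ ∞) (n : ℕ) :
    (timeEntropy η L Q (Measure.dirac (n + 1))).toReal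
        - (timeEntropy η L Q (Measure.dirac n)).toReal
      = (baseEntropy η Q).toReal - (stepEntropy η L Q (Measure.dirac n)).toReal := by
  have h := congrArg ENNReal.toReal (hQ.stepEntropy_dirac_add n)
  rw [ENNReal.toReal_add (hQ.stepEntropy_dirac_ne_top hB n) (hQ.timeEntropy_dirac_ne_top hB _),
    ENNReal.toReal_add hB (hQ.timeEntropy_dirac_ne_top hB _)] at h
  linarith

/-- The entropies of the first step given the coset at time `n` increase to its entropy given the
invariant sets. -/
theorem IsFiberWalk.tendsto_stepEntropy_dirac (hQ : IsFiberWalk μ η L Q)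
    (hB : baseEntropy η Q ≠ ∞) {K : ℝ≥0∞} (hK : ∀ n, stepEntropy η L Q (Measure.dirac n) ≤ K)
    (hK' : ∀ c, (∀ n, stepEntropy η L Q (meanLaw n) ≤ c) → K ≤ c) :
    Tendsto (fun n => stepEntropy η L Q (Measure.dirac n)) atTop (𝓝 K) := by
  have h1 : K = ⨆ n, stepEntropy η L Q (Measure.dirac n) :=
    le_antisymm (hK' _ (hQ.stepEntropy_meanLaw_le hB fun n =>
      le_iSup (fun n => stepEntropy η L Q (Measure.dirac n)) n)) (iSup_le hK)
  rw [h1]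
  exact tendsto_atTop_iSup hQ.stepEntropy_dirac_mono

end Asymptotics

/-! ### The fiber walk of a standard system. -/

section StandardSystem

variable {G : Type*} [Group G] [Countable G] [MeasurableSpace G] [DiscreteMeasurableSpace G]
  {X : Type*} [MeasurableSpace X] [StandardBorelSpace X] [Nonempty X]
  [MulAction G X] [MeasurableConstSMul G X]
  {Y : Type*} [MeasurableSpace Y] [StandardBorelSpace Y] [Nonempty Y]
  [MulAction G Y] [MeasurableConstSMul G Y]
  {μ : Measure G} [IsProbabilityMeasure μ] {η : Measure X} [IsProbabilityMeasure η]
  {ν : Measure Y} [IsProbabilityMeasure ν] {π : X → Y} (h : IsStandardSystem μ η ν π)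

/-- The conditional law of the walk over a point, as a function of its image in the boundary. -/
noncomputable def IsStandardSystem.fiberKernel : Kernel X (ℕ → G) :=
  (pathKernel μ ν).comap π h.measurePreserving.measurable

instance : IsMarkovKernel h.fiberKernel := by
  unfold IsStandardSystem.fiberKernel; infer_instance

/-- Assumption (S) makes `L_x` fix `π x`, so a kernel factoring through `π` is invariant at every
point. This is why `fiberKernel` is used rather than `pathKernel μ η`, which equals it only almost
everywhere. -/
theorem IsStandardSystem.isFiberWalk {L : SubgroupMap G X}
    (hS : ∀ x : X, L.toFun x ≤ MulAction.stabilizer G (π x)) :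
    IsFiberWalk μ η L h.fiberKernel := by
  refine ⟨?_, fun x l k hl => ?_⟩
  · rw [IsStandardSystem.fiberKernel, ← h.joining_eq]
    exact isStepInvariant_joining h.stationary
  · have h1 : l⁻¹ • π x = π x := (MulAction.stabilizer G (π x)).inv_mem (hS x hl)
    simp only [IsStandardSystem.fiberKernel, Kernel.comap_apply, h.equivariant, h1]

/-- The path law factors through `π`, so the first step has the same entropy given `x` as given `π
x`; the complement formula is then applied on `Y`. -/
theorem IsStandardSystem.furstenbergEntropy_add_baseEntropy :
    furstenbergEntropy μ ν + baseEntropy η h.fiberKernel = shannonEntropy μ := by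
  have h1 : baseEntropy η h.fiberKernel = baseEntropy ν (pathKernel μ ν) := by
    refine tsum_congr fun g => ?_
    have hm : Measurable fun y => pathKernel μ ν y {ω | ω 1 = g} :=
      (pathKernel μ ν).measurable_coe (measurableSet_first g)
    exact h.measurePreserving.lintegral_comp (hm.mul (measurable_nlog.comp hm))
  rw [h1]
  refine PoissonBundle.furstenbergEntropy_add_baseEntropy ?_
  rw [← joining_eq_compProd h.boundary.stationary]
  exact isStepInvariant_joining h.boundary.stationary

theorem IsStandardSystem.fiberEntropy_ae_eq (L : SubgroupMap G X) (n : ℕ) :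
    (fun x => shannonEntropy ((h.fiberKernel x).map fun ω => rightCoset (L.toFun x) (ω n)))
      =ᵐ[η] fiberEntropy μ η L n := by
  filter_upwards [h.pathKernel_ae_eq] with x hx
  have h1 : h.fiberKernel x = condDistrib Prod.snd Prod.fst (joining μ η) x := hx.symm
  simp only [fiberEntropy, fiberLaw, h1]

theorem IsStandardSystem.timeEntropy_dirac (L : SubgroupMap G X) (n : ℕ) :
    timeEntropy η L h.fiberKernel (Measure.dirac n) = condEntropy μ η L n := by
  rw [PoissonBundle.timeEntropy_dirac]
  exact lintegral_congr_ae (h.fiberEntropy_ae_eq L n)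

include h in
theorem IsStandardSystem.aemeasurable_fiberEntropy (L : SubgroupMap G X) (n : ℕ) :
    AEMeasurable (fiberEntropy μ η L n) η :=
  ⟨_, measurable_shannonEntropy_coset L h.fiberKernel n, (h.fiberEntropy_ae_eq L n).symm⟩

include h in
theorem IsStandardSystem.integral_fiberEntropy (L : SubgroupMap G X) {n : ℕ}
    (hn : condEntropy μ η L n ≠ ∞) :
    ∫ x, (fiberEntropy μ η L n x).toReal ∂η = (condEntropy μ η L n).toReal :=
  integral_toReal (h.aemeasurable_fiberEntropy L n)
    (ae_lt_top' (h.aemeasurable_fiberEntropy L n) hn)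

end StandardSystem

end PoissonBundle

/-! ### The random walk entropy formula. -/

theorem mainTheorem9
    {G : Type*} [Group G] [Countable G] [MeasurableSpace G] [DiscreteMeasurableSpace G]
    {X : Type*} [MeasurableSpace X] [StandardBorelSpace X] [Nonempty X]
    [MulAction G X] [MeasurableConstSMul G X]
    {Y : Type*} [MeasurableSpace Y] [StandardBorelSpace Y]
    [MulAction G Y] [MeasurableConstSMul G Y]
    {Z : Type*} [MeasurableSpace Z] [MulAction G Z] [MeasurableConstSMul G Z]
    (μ : Measure G) [IsProbabilityMeasure μ] (hμ : Nondegenerate μ)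
    (hμH : shannonEntropy μ ≠ ∞)
    (η : Measure X) [IsProbabilityMeasure η] (ν : Measure Y) (π : X → Y)
    (hstd : IsStandardSystem μ η ν π)
    (L : SubgroupMap G X)
    (hS : ∀ x : X, L.toFun x ≤ MulAction.stabilizer G (π x))
    (lam : Measure Z) (hlam : IsPoissonBundle μ η L lam) :
    furstenbergEntropy μ lam ≠ ∞ ∧ furstenbergEntropy μ ν ≠ ∞ ∧
    (∀ n, condEntropy μ η L n ≠ ∞) ∧
    (∀ n, Integrable (fun x => (fiberEntropy μ η L n x).toReal) η) ∧
    -- first formula, with the limit and with the infimum over `n ≥ 1`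
    Tendsto (fun n : ℕ => ∫ x, ((fiberEntropy μ η L (n + 1) x).toReal
        - (fiberEntropy μ η L n x).toReal) ∂η) atTop
      (𝓝 ((furstenbergEntropy μ lam).toReal - (furstenbergEntropy μ ν).toReal)) ∧
    IsGLB (Set.range fun n : ℕ => ∫ x, ((fiberEntropy μ η L (n + 1) x).toReal
        - (fiberEntropy μ η L n x).toReal) ∂η)
      ((furstenbergEntropy μ lam).toReal - (furstenbergEntropy μ ν).toReal) ∧
    -- second formula, with the limit and with the infimum over `n ≥ 1`
    Tendsto (fun n : ℕ => 1 / (n : ℝ) * (condEntropy μ η L n).toReal) atTop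
      (𝓝 ((furstenbergEntropy μ lam).toReal - (furstenbergEntropy μ ν).toReal)) ∧
    IsGLB (Set.range fun n : ℕ => 1 / ((n : ℝ) + 1) * (condEntropy μ η L (n + 1)).toReal)
      ((furstenbergEntropy μ lam).toReal - (furstenbergEntropy μ ν).toReal) := by
  have hY : Nonempty Y := ⟨π (Classical.arbitrary X)⟩
  have hν : IsProbabilityMeasure ν := by
    rw [← hstd.measurePreserving.map_eq]
    exact Measure.isProbabilityMeasure_map hstd.measurePreserving.measurable.aemeasurable
  have hQ := hstd.isFiberWalk hS
  have hJ : joining μ η = η ⊗ₘ hstd.fiberKernel := hstd.joining_eq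
  have hYB := hstd.furstenbergEntropy_add_baseEntropy
  have hB : baseEntropy η hstd.fiberKernel ≠ ∞ :=
    ne_top_of_le_ne_top hμH (le_add_self.trans hYB.le)
  have hYt : furstenbergEntropy μ ν ≠ ∞ := ne_top_of_le_ne_top hμH (le_self_add.trans hYB.le)
  obtain ⟨θ, hθ, hmap, heq, hgen⟩ := hlam
  have hlaw : cosetPathLaw μ η L = (η ⊗ₘ hstd.fiberKernel).map (toCosetPath L) := by
    rw [cosetPathLaw, hJ]
  rw [hlaw] at hmap heq
  simp only [hlaw] at hθ hgen
  obtain ⟨K, hZK, hK, hK'⟩ := hQ.exists_furstenbergEntropy_add hθ heq hgen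
  rw [hmap] at hZK
  have hZt : furstenbergEntropy μ lam ≠ ∞ := ne_top_of_le_ne_top hμH (le_self_add.trans hZK.le)
  have hKt : K ≠ ∞ := ne_top_of_le_ne_top hμH (le_add_self.trans hZK.le)
  have hcond : ∀ n, condEntropy μ η L n ≠ ∞ := fun n => by
    rw [← hstd.timeEntropy_dirac]
    exact hQ.timeEntropy_dirac_ne_top hB n
  have hint : ∀ n, Integrable (fun x => (fiberEntropy μ η L n x).toReal) η := fun n =>
    integrable_toReal_of_lintegral_ne_top (hstd.aemeasurable_fiberEntropy L n) (hcond n)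
  -- Both Furstenberg entropies are complementary, within the same finite `H(μ)`, to an entropy of
  -- the first step. Subtraction gives `B - K`.
  have hval : (furstenbergEntropy μ lam).toReal - (furstenbergEntropy μ ν).toReal
      = (baseEntropy η hstd.fiberKernel).toReal - K.toReal := by
    have h1 := congrArg ENNReal.toReal (hZK.trans hYB.symm)
    rw [ENNReal.toReal_add hZt hKt, ENNReal.toReal_add hYt hB] at h1
    linarith
  have hincr : ∀ n, (condEntropy μ η L (n + 1)).toReal - (condEntropy μ η L n).toReal
      = (baseEntropy η hstd.fiberKernel).toReal
        - (stepEntropy η L hstd.fiberKernel (Measure.dirac n)).toReal := fun n => by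
    rw [← hstd.timeEntropy_dirac, ← hstd.timeEntropy_dirac]
    exact hQ.timeEntropy_dirac_sub hB n
  have hdiff : ∀ n, ∫ x, ((fiberEntropy μ η L (n + 1) x).toReal
      - (fiberEntropy μ η L n x).toReal) ∂η
      = (condEntropy μ η L (n + 1)).toReal - (condEntropy μ η L n).toReal := fun n => by
    rw [integral_sub (hint _) (hint _), hstd.integral_fiberEntropy L (hcond _),
      hstd.integral_fiberEntropy L (hcond _)]
  -- The first step entropy at time `n` never exceeds `K`, so every increment is at least the limit,
  -- which is therefore also the infimum.
  have hle : ∀ n, (furstenbergEntropy μ lam).toReal - (furstenbergEntropy μ ν).toReal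
      ≤ (condEntropy μ η L (n + 1)).toReal - (condEntropy μ η L n).toReal := fun n => by
    rw [hval, hincr]
    exact sub_le_sub_left (ENNReal.toReal_mono hKt (hK _)) _
  have hlim : Tendsto (fun n => (condEntropy μ η L (n + 1)).toReal - (condEntropy μ η L n).toReal)
      atTop (𝓝 ((furstenbergEntropy μ lam).toReal - (furstenbergEntropy μ ν).toReal)) := by
    simp only [hincr, hval]
    exact ((ENNReal.tendsto_toReal hKt).comp
      (hQ.tendsto_stepEntropy_dirac hB (fun n => hK _) hK')).const_sub _
  have hzero : (condEntropy μ η L 0).toReal = 0 := by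
    rw [← hstd.timeEntropy_dirac, hQ.timeEntropy_dirac_zero, ENNReal.toReal_zero]
  have hces := tendsto_of_antitone_increments (T := fun n => (condEntropy μ η L n).toReal)
    hzero hle hlim
  simp only [hdiff]
  exact ⟨hZt, hYt, hcond, hint, hlim, isGLB_range_of_tendsto hle hlim, hces.1, hces.2⟩
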